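/- **Setting.** Let $r\in\mathbb N=\{1,2,\dots\}$ and $M\ge 0$. For $d\in\mathbb N$ let $$F_{r,M}^d=\Big\{\mathbf x\mapsto\prod_{i=1}^d f_i(x_i)\ \Big|\ f_i:[0,1]\to[-1,1],\ f_i\in W^r_\infty([0,1]),\ \|f_i^{(r)}\|_\infty\le M\Big\},$$ where $f_i^{(r)}$ is the $r$-th weak derivative and elements of $W^r_\infty([0,1])$ are identified with their continuous representatives. We approximate $f\in F_{r,M}^d$ in the uniform norm on $[0,1]^d$. A deterministic algorithm is a map $A=\phi\circ N$ from $F_{r,M}^d$ to the bounded functions on $[0,1]^d$, where $N(f)$ is a finite sequence of at least one function value of $f$ at points that may be chosen adaptively, with an adaptive stopping rule, and $\phi$ is arbitrary. Its error is $\operatorname{err}(A)=\sup_f\|f-A(f)\|_\infty$. Its cost is the maximal number of function values used, $\sup_f n(f)$, minimized over the representations $(\phi,N)$ of $A$. Let $\operatorname{comp}(\varepsilon,d)=\min\{\operatorname{cost}(A)\mid \operatorname{err}(A)\le\varepsilon\}$. The problem * is strongly polynomially tractable if $\operatorname{comp}(\varepsilon,d)\le c\,\varepsilon^{-p}$ for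 some $c,p>0$, * is polynomially tractable if $\operatorname{comp}(\varepsilon,d)\le c\,\varepsilon^{-p}d^{q}$ for some $c,p,q>0$, * is quasi-polynomially tractable if $\operatorname{comp}(\varepsilon,d)\le c\exp\big(t(1+\ln\varepsilon^{-1})(1+\ln d)\big)$ for some $c,t>0$, in each case for all $\varepsilon\in(0,1)$, $d\in\mathbb N$; it suffers from the curse of dimensionality if there are $\varepsilon>0$, $c>0$, $\alpha>1$ with $\operatorname{comp}(\varepsilon,d)\ge c\,\alpha^d$ for all $d\in\mathbb N$. A finite set $P\subset[0,1]^d$ is an $\varepsilon$-detector if every $f\in F_{r,M}^d$ with $\|f\|_\infty>\varepsilon$ has a nonzero in $P$. Its dispersion is the supremum of the volumes of the boxes (products of intervals) in $[0,1]^d$ that contain no point of $P$. For $m\in\mathbb N_0$, the algorithm $A_{P,m}$ evaluates $f$ at the points of $P$ in some fixed order. If $f|_P=0$, it returns $0$; otherwise, at the first $\mathbf z\in P$ with $f(\mathbf z)\ne0$, it returns $I_m(\mathbf z,f)(\mathbf x)=f(\mathbf z)^{1-d}\prod_{i=1}^d (Q g_i)(x_i)$, where $g_i(t)=f(z_1,\dots,z_{i-1},t,z_{i+1},\dots,z_d)$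 and $Q$ is piecewise polynomial interpolation of degree less than $r$ on $k=\lfloor m/(dr)\rfloor$ equal cells, with the $r$ nodes in each cell taken from the midpoints $(2l+1)/(2rk)$, $0\le l<rk$ ($Q=0$ if $k=0$). So $I_m(\mathbf z,\cdot)$ uses at most $m$ further function values. **Theorem.** (A) Uniform approximation on $F_{r,M}^d$ from function values, with deterministic algorithms in the worst case setting, * suffers from the curse of dimensionality iff $M\ge 2^r r!$, * is quasi-polynomially tractable iff $M<2^r r!$, * is polynomially tractable iff $M\le r!$, * is strongly polynomially tractable iff $M=0$ and $r=1$. (B) Let $M>0$. There are positive constants $C,c_1,\dots,c_4$, depending only on $r$ and $M$, such that for all $d\in\mathbb N$ and $\varepsilon\in(0,1)$ the following holds with $m=\lfloor C d^{1+1/r}\varepsilon^{-1/r}\rfloor$. There is an $\varepsilon$-detector $P\subset[0,1]^d$ with $\operatorname{err}(A_{P,m})\le\varepsilon$ that satisfies all those of the following bounds whose condition on $M$ holds: $$\operatorname{cost}(A_{P,m})\le\begin{cases}c_1^d\,\varepsilon^{-1/r}&\text{if } M\in(0,\infty),\\ c_2\exp\big(c_3(1+\ln\varepsilon^{-1})(1+\ln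 d)\big)&\text{if } M\in(0,2^r r!),\\ c_4\,d^2\,\varepsilon^{-1/r}\big(1+\ln(\varepsilon^{-1/r})\big)&\text{if } M\in(0,r!].\end{cases}$$ (C) With the same $C,c_1,\dots,c_4$ and $m$, each single bound of (B), together with $\operatorname{err}(A_{P,m})\le\varepsilon$, is attained by an $\varepsilon$-detector $P$ of the following form. Put $\varrho=\max\{r,M^{1/r}\}$. 1. For $M>0$: $P$ has dispersion at most $\varrho^{-d}\varepsilon^{1/r}$. 2. For $0<M<2^r r!$: there is $\delta\in(0,1/2]$, independent of $d$ and $\varepsilon$, with $C_\delta:=M(1+2\delta)^r/(2^r r!)<1$. Let $d_0$ be the largest number in $\{0,\dots,d\}$ with $C_\delta^{d_0}>\varepsilon$. Then $$P=\bigcup_{J\subset\{1,\dots,d\},\,|J|=d_0}\{\mathbf x\in[0,1]^d\mid \mathbf x_J\in P_1,\ \mathbf x_{J^c}\in P_2\},$$ where $P_1\subset[0,1]^{d_0}$ is finite with dispersion at most $\varrho^{-d_0}\varepsilon^{1/r}$ and $P_2\subset[0,1]^{d-d_0}$ is the diagonal set of the points $\big(\tfrac12-\delta+\tfrac{2\delta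 j}{(r-1)(d-d_0)}\big)\mathbf 1$, $0\le j\le (r-1)(d-d_0)$ (with $0/0=0$). 3. For $0<M\le r!$: with $\gamma=(1-2^{-1/d})\varepsilon^{1/r}$ and a finite set $P_0\subset[0,1]^d$ of dispersion at most $\varepsilon^{1/r}/2$, $$P=\Big\{(1-\gamma)\mathbf x+\tfrac{\gamma j}{(r-1)d}\mathbf 1\ \Big|\ \mathbf x\in P_0,\ 0\le j\le (r-1)d\Big\}\quad(\text{with }0/0=0).$$ -/

import Mathlib

open Set MeasureTheory
open scoped ENNReal Nat unitInterval ContDiff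

noncomputable section

namespace RankOne

/-! ### Abstract problems and tractability -/

/-- A problem: a set of algorithms, each with an error and a cost. -/
structure Problem where
  Alg : Type
  err : Alg → ℝ≥0∞
  cost : Alg → ℕ∞

/-- The `ε`-complexity: the minimal cost of an algorithm with error at most `ε`
(`⊤` if there is no such algorithm). -/
def Problem.comp (p : Problem) (ε : ℝ) : ℕ∞ :=
  sInf {n | ∃ A : p.Alg, p.err A ≤ ENNReal.ofReal ε ∧ p.cost A = n}

/-- Families of problems are indexed by the dimension `d = 1, 2, …`; the value at `0` is ignored. -/
def StronglyPolynomiallyTractable (p : ℕ → Problem) : Prop :=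
  ∃ c q : ℝ, 0 < c ∧ 0 < q ∧ ∀ ε : ℝ, 0 < ε → ε < 1 → ∀ d : ℕ, 1 ≤ d →
    ((p d).comp ε : ℝ≥0∞) ≤ ENNReal.ofReal (c * ε ^ (-q))

def PolynomiallyTractable (p : ℕ → Problem) : Prop :=
  ∃ c q s : ℝ, 0 < c ∧ 0 < q ∧ 0 < s ∧ ∀ ε : ℝ, 0 < ε → ε < 1 → ∀ d : ℕ, 1 ≤ d →
    ((p d).comp ε : ℝ≥0∞) ≤ ENNReal.ofReal (c * ε ^ (-s) * (d : ℝ) ^ q)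

def QuasiPolynomiallyTractable (p : ℕ → Problem) : Prop :=
  ∃ c t : ℝ, 0 < c ∧ 0 < t ∧ ∀ ε : ℝ, 0 < ε → ε < 1 → ∀ d : ℕ, 1 ≤ d →
    ((p d).comp ε : ℝ≥0∞) ≤
      ENNReal.ofReal (c * Real.exp (t * (1 + Real.log ε⁻¹) * (1 + Real.log d)))

def CurseOfDimensionality (p : ℕ → Problem) : Prop :=
  ∃ ε c α : ℝ, 0 < ε ∧ 0 < c ∧ 1 < α ∧ ∀ d : ℕ, 1 ≤ d →
    ENNReal.ofReal (c * α ^ d) ≤ ((p d).comp ε : ℝ≥0∞)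

/-! ### Deterministic (adaptive) algorithms, worst case error and information cost -/

section Algorithms

variable {F G : Type}

/-- The first `n` pieces of information `(y₁, …, yₙ)` about `f`, where
`yᵢ = Lᵢ(f, y₁, …, yᵢ₋₁)` and the index `i` is read off from the length of the list. -/
def collected (L : List ℝ → F → ℝ) (f : F) : ℕ → List ℝ
  | 0 => []
  | n + 1 => collected L f n ++ [L (collected L f n) f]

/-- `N` is an (adaptive) information mapping based on the class `Λ` of measurements: the
measurements are chosen from the values seen so far, and the first `n ≥ 1` at which the
termination function `T` says `false` ends the process. -/
def IsInformationMapping (Λ : Set (F → ℝ)) (N : F → List ℝ) : Prop :=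
  ∃ (L : List ℝ → F → ℝ) (T : List ℝ → Bool), (∀ y, L y ∈ Λ) ∧
    ∀ f, ∃ n, IsLeast {n : ℕ | 1 ≤ n ∧ T (collected L f n) = false} n ∧ N f = collected L f n

/-- Worst case cost of an information mapping: the maximal number of measurements. -/
def informationCost (N : F → List ℝ) : ℕ∞ := ⨆ f, ((N f).length : ℕ∞)

/-- `(out, N)` is a representation of the map `A` as an algorithm based on `Λ`. -/
def IsRepresentation (Λ : Set (F → ℝ)) (A : F → G) (out : List ℝ → G) (N : F → List ℝ) : Prop :=
  IsInformationMapping Λ N ∧ ∀ f, A f = out (N f)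

def IsDeterministicAlgorithm (Λ : Set (F → ℝ)) (A : F → G) : Prop :=
  ∃ out N, IsRepresentation Λ A out N

/-- Worst case cost of an algorithm: the cost of an optimal representation. -/
def worstCaseCost (Λ : Set (F → ℝ)) (A : F → G) : ℕ∞ :=
  sInf {n | ∃ out N, IsRepresentation Λ A out N ∧ informationCost N = n}

/-- Worst case error of `A` for the solution operator `S`. -/
def worstCaseError [MetricSpace G] (S A : F → G) : ℝ≥0∞ := ⨆ f, edist (S f) (A f)

/-- The problem of approximating `S` by deterministic algorithms based on `Λ` in the
worst case setting. -/
def deterministicProblem [MetricSpace G] (S : F → G) (Λ : Set (F → ℝ)) : Problem where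
  Alg := {A : F → G // IsDeterministicAlgorithm Λ A}
  err A := worstCaseError S A.1
  cost A := worstCaseCost Λ A.1

end Algorithms

/-- Standard information: function evaluations. -/
def standardInformation {D : Type} (F : Set (D → ℝ)) : Set (F → ℝ) :=
  {L | ∃ x : D, L = fun f => f.1 x}

/-! ### The class of rank one tensors -/

/-- The unit cube `[0,1]^d`. -/
abbrev Cube (d : ℕ) : Type := Fin d → I

/-- `h` is the `k`-th weak derivative of `g` on `[0,1]`. -/
def IsWeakDeriv (k : ℕ) (g h : I → ℝ) : Prop :=
  ∀ u : ℝ → ℝ, ContDiff ℝ ∞ u → HasCompactSupport u → tsupport u ⊆ Ioo 0 1 →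
    ∫ t : I, g t * iteratedDeriv k u t = (-1) ^ k * ∫ t : I, h t * u t

/-- The Sobolev class `W^r_∞([0,1])`; as usual for `r ≥ 1`, its elements are identified with
their continuous representatives, so that they have function values. -/
def sobolevClass (r : ℕ) : Set (I → ℝ) :=
  {g | Continuous g ∧ ∀ k ≤ r, ∃ h : I → ℝ, MemLp h ∞ volume ∧ IsWeakDeriv k g h}

/-- Functions `g : [0,1] → [-1,1]` with `‖g^(r)‖_∞ ≤ M`. -/
def factorClass (r : ℕ) (M : ℝ) : Set (I → ℝ) :=
  {g | (∀ t, g t ∈ Icc (-1 : ℝ) 1) ∧ g ∈ sobolevClass r ∧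
    ∃ h : I → ℝ, MemLp h ∞ volume ∧ IsWeakDeriv r g h ∧
      eLpNorm h ∞ volume ≤ ENNReal.ofReal M}

/-- The class `F_{r,M}^d` of rank one tensors. -/
def tensorClass (r : ℕ) (M : ℝ) (d : ℕ) : Set (Cube d → ℝ) :=
  {f | ∃ g : Fin d → I → ℝ, (∀ i, g i ∈ factorClass r M) ∧ f = fun x => ∏ i, g i (x i)}

/-- The space `B([0,1]^d)` of bounded real functions with the uniform norm. -/
abbrev BoundedFun (d : ℕ) : Type := lp (fun _ : Cube d => ℝ) ∞

theorem abs_le_one_of_mem {r : ℕ} {M : ℝ} {d : ℕ} {f : Cube d → ℝ} (hf : f ∈ tensorClass r M d)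
    (x : Cube d) : |f x| ≤ 1 := by
  obtain ⟨g, hg, rfl⟩ := hf
  rw [Finset.abs_prod]
  exact Finset.prod_le_one (fun _ _ => abs_nonneg _) fun i _ => abs_le.2 ((hg i).1 _)

theorem memℓp_of_bound {d : ℕ} {f : Cube d → ℝ} (B : ℝ) (h : ∀ x, |f x| ≤ B) :
    Memℓp (E := fun _ : Cube d => ℝ) f ∞ :=
  memℓp_infty ⟨B, by rintro _ ⟨x, rfl⟩; exact h x⟩

/-- The embedding `APP : F_{r,M}^d → B([0,1]^d)`, `f ↦ f`. -/
def app (r : ℕ) (M : ℝ) (d : ℕ) (f : tensorClass r M d) : BoundedFun d :=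
  ⟨f.1, memℓp_of_bound 1 (abs_le_one_of_mem f.2)⟩

/-- Uniform approximation on `F_{r,M}^d` from function values, deterministic, worst case. -/
def appProblem (r : ℕ) (M : ℝ) (d : ℕ) : Problem :=
  deterministicProblem (app r M d) (standardInformation (tensorClass r M d))

/-! ### The algorithm `A_{P,m}` -/

/-- The `l`-th of the `n` equidistant midpoints `(2l+1)/(2n)`, `l < n`, of `[0,1]`. -/
def node (n l : ℕ) : I := projIcc (0 : ℝ) 1 zero_le_one ((2 * l + 1) / (2 * n))

/-- The polynomial of degree less than `r` that interpolates `g` at the `r` nodes in the cell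
`[j/k, (j+1)/k]`. -/
def cellPolynomial (r k : ℕ) (g : I → ℝ) (j : ℕ) : Polynomial ℝ :=
  Lagrange.interpolate (Finset.range r) (fun i => (node (r * k) (r * j + i) : ℝ))
    (fun i => g (node (r * k) (r * j + i)))

/-- Piecewise polynomial interpolation of `g` on `k` cells, `r` nodes in each (zero if `k = 0`). -/
def interpolant (r k : ℕ) (g : I → ℝ) (x : I) : ℝ :=
  if k = 0 then 0 else (cellPolynomial r k g (min ⌊(k : ℝ) * x⌋₊ (k - 1))).eval (x : ℝ)

theorem exists_interpolant_bound (r k : ℕ) (g : I → ℝ) :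
    ∃ B : ℝ, ∀ x, |interpolant r k g x| ≤ B := by
  have hb : ∀ j : ℕ, ∃ B : ℝ, ∀ x : I, |(cellPolynomial r k g j).eval (x : ℝ)| ≤ B := by
    intro j
    obtain ⟨B, hB⟩ := (isCompact_Icc : IsCompact (Icc (0 : ℝ) 1)).exists_bound_of_continuousOn
      (f := fun x => (cellPolynomial r k g j).eval x) (Polynomial.continuous _).continuousOn
    exact ⟨B, fun x => hB x x.2⟩
  choose B hB using hb
  have h0 : ∀ j, 0 ≤ B j := fun j => (abs_nonneg _).trans (hB j 0)
  refine ⟨∑ j ∈ Finset.range k, B j, fun x => ?_⟩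
  unfold interpolant
  split_ifs with hk
  · simpa using Finset.sum_nonneg fun j _ => h0 j
  · refine (hB _ x).trans (Finset.single_le_sum (f := B) (fun j _ => h0 j) ?_)
    rw [Finset.mem_range]
    omega

/-- The function `I_m(z,f)` for a known nonzero `z` of `f`. It uses at most `m` values of `f`
on the lines `{x | xⱼ = zⱼ for all j ≠ i}`, `i = 1, …, d`, interpolates `f` on each of them, and
multiplies the results according to
`f(x) = f(z)^(1-d) ∏ᵢ f(z₁, …, zᵢ₋₁, xᵢ, zᵢ₊₁, …, z_d)`. -/
def recoverFun (r m : ℕ) {d : ℕ} (z : Cube d) (f : Cube d → ℝ) (x : Cube d) : ℝ :=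
  (∏ i, interpolant r (m / (d * r)) (fun t => f (Function.update z i t)) (x i)) / f z ^ (d - 1)

theorem memℓp_recoverFun (r m : ℕ) {d : ℕ} (z : Cube d) (f : Cube d → ℝ) :
    Memℓp (E := fun _ : Cube d => ℝ) (recoverFun r m z f) ∞ := by
  choose B hB using fun i : Fin d =>
    exists_interpolant_bound r (m / (d * r)) (fun t => f (Function.update z i t))
  refine memℓp_of_bound ((∏ i, B i) / |f z ^ (d - 1)|) fun x => ?_
  unfold recoverFun
  rw [abs_div, Finset.abs_prod]
  gcongr
  exact hB _ _

def recover (r m : ℕ) {d : ℕ} (z : Cube d) (f : Cube d → ℝ) : BoundedFun d :=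
  ⟨recoverFun r m z f, memℓp_recoverFun r m z f⟩

open Classical in
/-- The algorithm `A_{P,m}`: go through the points of `P`; at the first nonzero `z` of `f` found,
return `I_m(z,f)`; if `f` vanishes on `P`, return the zero function. -/
def detectAndRecover (r : ℕ) (M : ℝ) {d : ℕ} (P : Finset (Cube d)) (m : ℕ)
    (f : tensorClass r M d) : BoundedFun d :=
  match P.toList.find? (fun z => decide (f.1 z ≠ 0)) with
  | some z => recover r m z f.1
  | none => 0

/-! ### Detectors and point sets -/

/-- `P` contains a nonzero of every `f ∈ F_{r,M}^d` with uniform norm greater than `ε`. -/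
def IsDetector (r : ℕ) (M : ℝ) (d : ℕ) (ε : ℝ) (P : Finset (Cube d)) : Prop :=
  ∀ f : tensorClass r M d, ε < ‖app r M d f‖ → ∃ z ∈ P, f.1 z ≠ 0

/-- The supremum of the volumes of the boxes (products of intervals) in `[0,1]^d` that contain no
point of `P`. -/
def dispersion {d : ℕ} (P : Finset (Cube d)) : ℝ≥0∞ :=
  ⨆ (J : Fin d → Set I) (_ : ∀ i, (J i).OrdConnected) (_ : Disjoint (univ.pi J) (P : Set (Cube d))),
    volume (univ.pi J)

/-- `P` is an `ε`-detector, and `A_{P,m}` is a deterministic algorithm based on function values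
whose worst case error is at most `ε` and whose cost is at most `b`. -/
def DetectorAlgorithmBound (r : ℕ) (M : ℝ) (d : ℕ) (ε : ℝ) (P : Finset (Cube d)) (m : ℕ)
    (b : ℝ) : Prop :=
  IsDetector r M d ε P ∧
  IsDeterministicAlgorithm (standardInformation (tensorClass r M d)) (detectAndRecover r M P m) ∧
  worstCaseError (app r M d) (detectAndRecover r M P m) ≤ ENNReal.ofReal ε ∧
  (worstCaseCost (standardInformation (tensorClass r M d)) (detectAndRecover r M P m) : ℝ≥0∞) ≤
    ENNReal.ofReal b

/-- `ϱ = max {r, M^(1/r)}`. -/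
def rho (r : ℕ) (M : ℝ) : ℝ := max (r : ℝ) (M ^ (1 / (r : ℝ)))

/-- `C_δ = M (1+2δ)^r / (2^r r!)`. -/
def cDelta (r : ℕ) (M δ : ℝ) : ℝ := M * (1 + 2 * δ) ^ r / (2 ^ r * (r ! : ℝ))

open Classical in
/-- The largest `k ∈ {0, …, d}` with `C_δ^k > ε`. -/
def pseudoDim (r : ℕ) (M δ ε : ℝ) (d : ℕ) : ℕ :=
  Nat.findGreatest (fun k => ε < cDelta r M δ ^ k) d

/-- The union, over all `J ⊆ {1, …, d}` with `d₀` elements, of the sets of `x ∈ [0,1]^d` such that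
`x_J ∈ P₁` and the remaining coordinates form a point of the diagonal set
`{(1/2 - δ + 2δj/((r-1)(d-d₀))) · 𝟏 | 0 ≤ j ≤ (r-1)(d-d₀)}`. -/
def crossDiagonalSet (r d d₀ : ℕ) (δ : ℝ) (P₁ : Finset (Cube d₀)) : Set (Cube d) :=
  {x | ∃ (J : Finset (Fin d)) (hJ : J.card = d₀),
    (fun i => x (J.orderEmbOfFin hJ i)) ∈ P₁ ∧
    ∃ j : ℕ, j ≤ (r - 1) * (d - d₀) ∧
      ∀ i ∉ J, (x i : ℝ) = 1 / 2 - δ + 2 * δ * j / ((r - 1) * (d - d₀) : ℕ)}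

/-- `γ = (1 - 2^(-1/d)) ε^(1/r)`. -/
def gam (r d : ℕ) (ε : ℝ) : ℝ := (1 - (2 : ℝ) ^ (-(1 / (d : ℝ)))) * ε ^ (1 / (r : ℝ))

/-- The set `{(1-γ) x + γj/((r-1)d) · 𝟏 | x ∈ P₀, 0 ≤ j ≤ (r-1)d}`. -/
def shiftedDiagonalSet (r d : ℕ) (γ : ℝ) (P₀ : Finset (Cube d)) : Set (Cube d) :=
  {x | ∃ y ∈ P₀, ∃ j : ℕ, j ≤ (r - 1) * d ∧
    ∀ i, (x i : ℝ) = (1 - γ) * (y i : ℝ) + γ * j / ((r - 1) * d : ℕ)}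

/-- `⌊C d^(1+1/r) ε^(-1/r)⌋`. -/
def sampleBudget (r : ℕ) (C : ℝ) (d : ℕ) (ε : ℝ) : ℕ :=
  ⌊C * (d : ℝ) ^ (1 + 1 / (r : ℝ)) * ε ^ (-(1 / (r : ℝ)))⌋₊

/-- The three cost bounds. -/
def exponentialBound (r : ℕ) (c : ℝ) (d : ℕ) (ε : ℝ) : ℝ :=
  c ^ d * ε ^ (-(1 / (r : ℝ)))

def quasiPolynomialBound (c c' : ℝ) (d : ℕ) (ε : ℝ) : ℝ :=
  c * Real.exp (c' * (1 + Real.log ε⁻¹) * (1 + Real.log d))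

def polynomialBound (r : ℕ) (c : ℝ) (d : ℕ) (ε : ℝ) : ℝ :=
  c * (d : ℝ) ^ 2 * ε ^ (-(1 / (r : ℝ))) * (1 + Real.log (ε ^ (-(1 / (r : ℝ)))))

end RankOne

end

/-!
The upper bounds come from detectors: once a nonzero of a rank one tensor `f` is known, `f` is
determined by its restrictions to the axis-parallel lines through that point, and these are
univariate functions that piecewise interpolation recovers
(`detectorAlgorithmBound_of_isDetector`). The cost is thus at most `|P| + m + 1`, where `P` is the
detector, `m` bounds the number of samples on the lines, and `1` makes the information nonempty. The
only analytic input is the interpolation error bound for functions with a bounded weak derivative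
(`abs_sub_interpolate_le`, by mollification and Rolle's theorem), in the form that a
function `g` of the univariate class with zeros `z₁, …, zᵣ` satisfies
`|g x| ≤ M / r! * ∏ |x - zᵢ|` (`abs_le_of_zeros`). It limits the zeros of the factors of a
function with norm greater than `ε` in three ways.

* A factor with `|g x| = s > 0` has no zeros in some interval of length `s^(1/r) / ϱ`, so sets of
  dispersion at most `ϱ^(-d) ε^(1/r)` are detectors (`isDetector_of_dispersion_le`).
* A factor with `r` zeros in `[1/2 - δ, 1/2 + δ]` is bounded by `C_δ < 1`. As the product exceeds
  `ε`, there are at most `d₀` such factors. The others have few zeros on the diagonal, and the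
  pigeonhole principle gives a point of the diagonal that is a zero of none of them
  (`isDetector_of_crossDiagonalSet`).
* For `M ≤ r!`, each factor has less than `r` zeros in an interval of length `s^(1/r)`. The box of
  these intervals has volume greater than `ε^(1/r)`, and again the pigeonhole principle applies to
  a short piece of a diagonal in it (`isDetector_of_shiftedDiagonalSet`).

Two bounds for the minimal cardinality of sets of dispersion at most `η` are needed, of order
`d η⁻¹ (1 + ln η⁻¹)` (`exists_dispersion_le_linear`) and `A^d η⁻¹` without a logarithm
(`exists_dispersion_le_exponential`). The first one follows by a covering argument over the boxes
with endpoints on a grid. For the second one, the digits of the coordinates in a prime base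
`q ∈ (2d, 4d]` are scaled Taylor coefficients, at `d` points, of polynomials over the field with `q`
elements. A box prescribes `K i` digits of the `i`-th coordinate and a set of values for the next
one. Hermite interpolation (`exists_hermite`) takes care of the prescribed digits; the next digits
then run through a translated and scaled Reed–Solomon code, and a second moment estimate
(`card_affine_hits_ge`) shows that a proportion `2^(-d-1)` of all scales and translates hit the set
of admissible values. The covering argument yields a list of exponentially many scales and
translates that suffices for all boxes, and its length does not depend on `η`
(`exists_polynomial_family`).

The lower bounds use functions that vanish at all sample points and have large norm, so that they
cannot be distinguished from their negatives (`le_comp_of_fooling`). For `M ≥ 2^r r!`, multiples of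
`(1/2 - t)₊^r` and `(t - 1/2)₊^r` give `2^d` functions of norm one with disjoint supports
(`two_pow_le_comp`). For `M > r!`, the interval is split at some `a < 1` such that a function of the
class that vanishes on `[a, 1]` still has norm one; with `k` factors that vanish on `[0, a]` and
`d - k` factors that vanish on `[a, 1]`, the norm depends on `k` only, and there are `d.choose k`
choices (`choose_le_comp`). For `M > 0` or `r ≥ 2`, the number of samples has to grow with `d`: few
samples have the same pattern of halves in two of many coordinates (`lt_comp_of_two_pow_lt`), and
products of `d` affine factors can vanish at any `d` samples (`lt_comp_of_two_le`).
-/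

noncomputable section

namespace RankOne

/-! ### Interpolation of functions with a bounded weak derivative -/

/-- Iterated Rolle theorem: a smooth function with `n + 1` zeros has a zero of its `n`-th
derivative between them. -/
theorem exists_iteratedDeriv_eq_zero (n : ℕ) : ∀ (f : ℝ → ℝ), ContDiff ℝ ∞ f →
    ∀ e : Fin (n + 1) → ℝ, StrictMono e → (∀ i, f (e i) = 0) →
      ∃ ξ ∈ Icc (e 0) (e (Fin.last n)), iteratedDeriv n f ξ = 0 := by
  induction n with
  | zero =>
    intro f _ e _ h0
    exact ⟨e 0, by simp, by simpa using h0 0⟩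
  | succ n ih =>
    intro f hf e he h0
    have hd : ContDiff ℝ ∞ (deriv f) := (contDiff_infty_iff_deriv.1 hf).2
    have hex : ∀ i : Fin (n + 1), ∃ c ∈ Ioo (e i.castSucc) (e i.succ), deriv f c = 0 := fun i =>
      exists_deriv_eq_zero (he (Fin.castSucc_lt_succ)) hf.continuous.continuousOn
        ((h0 _).trans (h0 _).symm)
    choose c hc hc0 using hex
    have hmono : StrictMono c := by
      intro i j hij
      refine (hc i).2.trans_le (le_trans ?_ (hc j).1.le)
      exact he.monotone (Fin.succ_le_castSucc_iff.2 hij)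
    obtain ⟨ξ, hξ, h⟩ := ih (deriv f) hd c hmono hc0
    refine ⟨ξ, ⟨?_, ?_⟩, by rw [iteratedDeriv_succ']; exact h⟩
    · exact le_trans (le_trans (he.monotone (Fin.zero_le _)) (hc 0).1.le) hξ.1
    · exact hξ.2.trans ((hc (Fin.last n)).2.le.trans (he.monotone (Fin.le_last _)))

theorem iteratedDeriv_polynomial_eval (p : Polynomial ℝ) (n : ℕ) :
    iteratedDeriv n (fun x => p.eval x) =
      fun x => ((Polynomial.derivative^[n]) p).eval x := by
  induction n generalizing p with
  | zero => simp
  | succ n ih =>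
    rw [iteratedDeriv_succ', Function.iterate_succ_apply, ← ih]
    congr 1
    ext x
    simp

/-- The error formula of Lagrange interpolation, as an estimate for smooth functions. -/
theorem abs_sub_interpolate_le_of_contDiff {f : ℝ → ℝ} (hf : ContDiff ℝ ∞ f) {r : ℕ} {M : ℝ}
    (hM : ∀ x ∈ Icc (0 : ℝ) 1, |iteratedDeriv r f x| ≤ M) {ι : Type*} [DecidableEq ι] (s : Finset ι)
    (v : ι → ℝ) (hv : InjOn v s) (hs : s.card = r) (hv01 : ∀ i ∈ s, v i ∈ Icc (0 : ℝ) 1)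
    {x : ℝ} (hx : x ∈ Icc (0 : ℝ) 1) :
    |f x - (Lagrange.interpolate s v (fun i => f (v i))).eval x| ≤
      M / r ! * ∏ i ∈ s, |x - v i| := by
  classical
  by_cases hxs : x ∈ s.image v
  · obtain ⟨i, hi, rfl⟩ := Finset.mem_image.1 hxs
    rw [Lagrange.eval_interpolate_at_node _ hv hi, sub_self, abs_zero,
      Finset.prod_eq_zero hi (by simp), mul_zero]
  set p := Lagrange.interpolate s v (fun i => f (v i)) with hp
  set W : Polynomial ℝ := ∏ a ∈ s.image v, (Polynomial.X - Polynomial.C a) with hW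
  have hWx : ∀ y, W.eval y = ∏ i ∈ s, (y - v i) := by
    intro y
    rw [hW, Polynomial.eval_prod, Finset.prod_image hv]
    simp
  have hW0 : W.eval x ≠ 0 := by
    rw [hWx, Finset.prod_ne_zero_iff]
    intro i hi h
    exact hxs (Finset.mem_image.2 ⟨i, hi, by linarith⟩)
  set c := (f x - p.eval x) / W.eval x with hc
  -- the auxiliary function vanishes at the nodes and at `x`
  set Q : Polynomial ℝ := p + Polynomial.C c * W with hQ
  have hQd : ContDiff ℝ ∞ (fun y => Q.eval y) := by
    simpa using Q.contDiff_aeval (𝕜 := ℝ) ∞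
  set T := insert x (s.image v) with hT
  have hTc : T.card = r + 1 := by
    rw [hT, Finset.card_insert_of_notMem hxs, Finset.card_image_of_injOn hv, hs]
  have hT01 : ∀ y ∈ T, y ∈ Icc (0 : ℝ) 1 := by
    intro y hy
    rcases Finset.mem_insert.1 hy with rfl | hy
    · exact hx
    · obtain ⟨i, hi, rfl⟩ := Finset.mem_image.1 hy
      exact hv01 i hi
  have hQ0 : ∀ y ∈ T, f y - Q.eval y = 0 := by
    intro y hy
    rcases Finset.mem_insert.1 hy with rfl | hy
    · simp only [hQ, Polynomial.eval_add, Polynomial.eval_mul, Polynomial.eval_C, hc]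
      field_simp
      ring
    · obtain ⟨i, hi, rfl⟩ := Finset.mem_image.1 hy
      simp only [hQ, Polynomial.eval_add, Polynomial.eval_mul, Polynomial.eval_C]
      rw [hWx, Finset.prod_eq_zero hi (by simp), hp, Lagrange.eval_interpolate_at_node _ hv hi]
      simp
  obtain ⟨ξ, hξ, h0⟩ := exists_iteratedDeriv_eq_zero r (fun y => f y - Q.eval y)
    (hf.sub hQd) (T.orderEmbOfFin hTc) (T.orderEmbOfFin hTc).strictMono
    (fun i => hQ0 _ (T.orderEmbOfFin_mem hTc i))
  have hξ01 : ξ ∈ Icc (0 : ℝ) 1 :=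
    ⟨(hT01 _ (T.orderEmbOfFin_mem hTc _)).1.trans hξ.1,
      hξ.2.trans (hT01 _ (T.orderEmbOfFin_mem hTc _)).2⟩
  have hQr : iteratedDeriv r (fun y => Q.eval y) ξ = c * r ! := by
    rw [iteratedDeriv_polynomial_eval]
    have h1 : (Polynomial.derivative^[r]) p = 0 :=
      Polynomial.iterate_derivative_eq_zero_of_degree_lt
        (hs ▸ Lagrange.degree_interpolate_lt _ hv)
    have hcard : (s.image v).card = r := by rw [Finset.card_image_of_injOn hv, hs]
    have h2 : (Polynomial.derivative^[r]) W = Polynomial.C (r ! : ℝ) := by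
      have := Polynomial.iterate_derivative_prod_X_sub_C (S := s.image v) (k := r) hcard.ge
      rw [hW, this, hcard, Nat.sub_self, Finset.powersetCard_zero]
      simp
    simp [hQ, iterate_map_add, Polynomial.iterate_derivative_C_mul, h1, h2]
  have hsub : iteratedDeriv r (fun y => f y - Q.eval y) ξ = iteratedDeriv r f ξ - c * r ! := by
    rw [← hQr]
    exact iteratedDeriv_fun_sub ((hf.of_le (by exact_mod_cast le_top)).contDiffAt)
      ((hQd.of_le (by exact_mod_cast le_top)).contDiffAt)
  rw [hsub, sub_eq_zero] at h0
  have hcM : |c| ≤ M / r ! := by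
    rw [le_div_iff₀ (by positivity)]
    have := hM ξ hξ01
    rwa [h0, abs_mul, Nat.abs_cast] at this
  have hfin : f x - p.eval x = c * ∏ i ∈ s, (x - v i) := by
    rw [← hWx, hc]; field_simp
  rw [hfin, abs_mul, Finset.abs_prod]
  gcongr

open Filter Topology in
theorem tsupport_iteratedDeriv_subset (n : ℕ) (u : ℝ → ℝ) :
    tsupport (iteratedDeriv n u) ⊆ tsupport u := by
  induction n with
  | zero => simp
  | succ n ih =>
    rw [iteratedDeriv_succ]
    exact (closure_minimal support_deriv_subset (isClosed_tsupport _)).trans ih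

theorem iteratedDeriv_convolution (n : ℕ) {g : ℝ → ℝ} (hg : Continuous g) :
    ∀ {u : ℝ → ℝ}, ContDiff ℝ ∞ u → HasCompactSupport u →
      iteratedDeriv n (convolution u g (ContinuousLinearMap.lsmul ℝ ℝ) volume) =
        convolution (iteratedDeriv n u) g (ContinuousLinearMap.lsmul ℝ ℝ) volume := by
  induction n with
  | zero => simp
  | succ n ih =>
    intro u hu hc
    rw [iteratedDeriv_succ', iteratedDeriv_succ', ← ih (contDiff_infty_iff_deriv.1 hu).2 hc.deriv]
    congr 1
    ext x
    exact (hc.hasDerivAt_convolution_left _ (hu.of_le (by exact_mod_cast le_top))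
      hg.locallyIntegrable x).deriv

/-- A test function supported in `(0,1)` sees only the restriction of a function to `[0,1]`. -/
theorem integral_mul_eq_integral_unitInterval {u G : ℝ → ℝ} (hu : tsupport u ⊆ Ioo 0 1) :
    ∫ t, u t * G t = ∫ t : I, G t * u t := by
  rw [unitInterval.volume_def, integral_subtype_comap measurableSet_Icc (fun t => G t * u t),
    setIntegral_eq_integral_of_forall_compl_eq_zero]
  · simp_rw [mul_comm]
  · intro x hx
    rw [image_eq_zero_of_notMem_tsupport fun h => hx (Ioo_subset_Icc_self (hu h)), mul_zero]

/-- Pairing the weak derivative of a function with a nonnegative test function of integral at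
most one gives at most the bound on that derivative. -/
theorem abs_integral_mul_iteratedDeriv_le {r : ℕ} {M : ℝ} (hM : 0 ≤ M) {g : I → ℝ}
    (hg : g ∈ factorClass r M) {u : ℝ → ℝ} (hu : ContDiff ℝ ∞ u) (hc : HasCompactSupport u)
    (hs : tsupport u ⊆ Ioo 0 1) (h0 : ∀ t, 0 ≤ u t) (h1 : ∫ t, u t = 1) :
    |∫ t : I, g t * iteratedDeriv r u t| ≤ M := by
  obtain ⟨-, -, h, hmem, hw, hb⟩ := hg
  rw [hw u hu hc hs, abs_mul, abs_pow, abs_neg, abs_one, one_pow, one_mul]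
  have hae : ∀ᵐ t : I, ‖h t‖ ≤ M := by
    filter_upwards [ae_le_eLpNormEssSup (f := h) (μ := volume)] with t ht
    rw [eLpNorm_exponent_top] at hb
    have := ht.trans hb
    rwa [← ofReal_norm, ENNReal.ofReal_le_ofReal_iff hM] at this
  have hI : ∫ t : I, u t = 1 := by
    rw [← h1]
    simpa using (integral_mul_eq_integral_unitInterval (G := fun _ => 1) hs).symm
  have hint : Integrable (fun t : I => u t) := by
    by_contra hni
    rw [integral_undef hni] at hI
    exact zero_ne_one hI
  calc |∫ t : I, h t * u t| ≤ ∫ t : I, M * u t := by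
        rw [← Real.norm_eq_abs]
        refine norm_integral_le_of_norm_le (hint.const_mul M) ?_
        filter_upwards [hae] with t ht
        rw [norm_mul, Real.norm_of_nonneg (h0 t)]
        exact mul_le_mul_of_nonneg_right ht (h0 _)
    _ = M := by rw [integral_const_mul, hI, mul_one]

open Filter Topology in
/-- Interpolation error on the class: `r` nodes leave an error of at most
`M / r! ∏ |x - vᵢ|`. The function is replaced by mollified functions, read on a slightly
smaller interval so that the mollifiers stay inside `(0,1)`. -/
theorem abs_sub_interpolate_le {r : ℕ} {M : ℝ} (hM : 0 ≤ M) {g : I → ℝ}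
    (hg : g ∈ factorClass r M) {ι : Type*} [DecidableEq ι] (s : Finset ι) (v : ι → I)
    (hv : InjOn v s) (hs : s.card = r) (x : I) :
    |g x - (Lagrange.interpolate s (fun i => (v i : ℝ)) (fun i => g (v i))).eval (x : ℝ)| ≤
      M / r ! * ∏ i ∈ s, |(x : ℝ) - v i| := by
  have hgc : Continuous g := hg.2.1.1
  set G : ℝ → ℝ := fun t => g (projIcc 0 1 zero_le_one t) with hG
  have hGc : Continuous G := hgc.comp continuous_projIcc
  have hGI : ∀ t : I, G t = g t := fun t => by simp [hG]
  let ρ : ℕ → ℝ := fun n => 1 / (n + 1 : ℝ) / 8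
  have hρ0 : ∀ n, 0 < ρ n := fun n => by positivity
  have hρ1 : ∀ n, ρ n ≤ 1 / 8 := fun n => by
    have : 1 / ((n : ℝ) + 1) ≤ 1 := by
      rw [div_le_one (by positivity)]
      have : (0 : ℝ) ≤ n := n.cast_nonneg
      linarith
    simp only [ρ]; linarith
  have hρt : Tendsto ρ atTop (𝓝 0) := by
    simpa [ρ] using (tendsto_one_div_add_atTop_nhds_zero_nat (𝕜 := ℝ)).div_const 8
  let η : ℕ → ContDiffBump (0 : ℝ) := fun n =>
    ⟨ρ n / 2, ρ n, by linarith [hρ0 n], by linarith [hρ0 n]⟩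
  let H : ℕ → ℝ → ℝ := fun n =>
    convolution ((η n).normed volume) G (ContinuousLinearMap.lsmul ℝ ℝ) volume
  have hHs : ∀ n, ContDiff ℝ ∞ (H n) := fun n =>
    (η n).hasCompactSupport_normed.contDiff_convolution_left _ (η n).contDiff_normed
      hGc.locallyIntegrable
  let f : ℕ → ℝ → ℝ := fun n y => H n (2 * ρ n + (1 - 4 * ρ n) * y)
  have hfs : ∀ n, ContDiff ℝ ∞ (f n) := fun n => (hHs n).comp (by fun_prop)
  -- the smooth approximations satisfy the same bound on the derivative
  have hfM : ∀ n, ∀ y ∈ Icc (0 : ℝ) 1, |iteratedDeriv r (f n) y| ≤ M := by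
    intro n y hy
    have h1 : iteratedDeriv r (f n) y =
        (1 - 4 * ρ n) ^ r * iteratedDeriv r (H n) (2 * ρ n + (1 - 4 * ρ n) * y) := by
      have := iteratedDeriv_comp_const_mul (n := r) (f := fun z => H n (2 * ρ n + z))
        (((hHs n).comp (by fun_prop)).of_le (by exact_mod_cast le_top)) (1 - 4 * ρ n)
      rw [iteratedDeriv_comp_const_add] at this
      exact congrFun this y
    set z := 2 * ρ n + (1 - 4 * ρ n) * y with hz
    have hz1 : 2 * ρ n ≤ z := by
      have := hρ1 n
      have : 0 ≤ (1 - 4 * ρ n) * y := mul_nonneg (by linarith) hy.1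
      linarith
    have hz2 : z ≤ 1 - 2 * ρ n := by
      have := hρ1 n
      have : (1 - 4 * ρ n) * y ≤ (1 - 4 * ρ n) * 1 := mul_le_mul_of_nonneg_left hy.2 (by linarith)
      linarith
    set u : ℝ → ℝ := fun t => (η n).normed volume (z - t) with hu
    have hus : ContDiff ℝ ∞ u := (η n).contDiff_normed.comp (by fun_prop)
    have hut : tsupport u ⊆ Icc (z - ρ n) (z + ρ n) := by
      refine closure_minimal ?_ isClosed_Icc
      intro t ht
      have : z - t ∈ Function.support ((η n).normed volume) := ht
      rw [(η n).support_normed_eq, Metric.mem_ball, dist_zero_right, Real.norm_eq_abs,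
        abs_lt] at this
      have h3 := this.1
      have h4 := this.2
      change -ρ n < _ at h3
      change _ < ρ n at h4
      constructor <;> linarith
    have hu01 : tsupport u ⊆ Ioo 0 1 := hut.trans fun t ht =>
      ⟨by linarith [ht.1, hρ0 n], by linarith [ht.2, hρ0 n]⟩
    have huc : HasCompactSupport u := isCompact_Icc.of_isClosed_subset (isClosed_tsupport _) hut
    have h2 : iteratedDeriv r (H n) z = (-1) ^ r * ∫ t : I, g t * iteratedDeriv r u t := by
      have hd : iteratedDeriv r u =
          fun t => (-1) ^ r * iteratedDeriv r ((η n).normed volume) (z - t) :=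
        iteratedDeriv_comp_const_sub r _ z
      have h3 := integral_mul_eq_integral_unitInterval (G := G)
        ((tsupport_iteratedDeriv_subset r u).trans hu01)
      simp only [hGI] at h3
      rw [← h3, iteratedDeriv_convolution r hGc (η n).contDiff_normed
        (η n).hasCompactSupport_normed, convolution_eq_swap, ← integral_const_mul]
      congr 1
      ext t
      rw [hd]
      simp only [ContinuousLinearMap.lsmul_apply, smul_eq_mul]
      rw [← mul_assoc, ← mul_assoc, ← mul_pow]
      simp
    have h4 := abs_integral_mul_iteratedDeriv_le hM hg hus huc hu01
      (fun t => (η n).nonneg_normed _) (by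
        rw [hu, integral_sub_left_eq_self (fun t => (η n).normed volume t) volume z]
        exact (η n).integral_normed)
    rw [h1, abs_mul, h2, abs_mul, abs_pow, abs_pow, abs_neg, abs_one, one_pow, one_mul]
    have h5 : |1 - 4 * ρ n| ^ r ≤ 1 := by
      apply pow_le_one₀ (abs_nonneg _)
      rw [abs_le]
      constructor <;> linarith [hρ0 n, hρ1 n]
    calc _ ≤ 1 * M := mul_le_mul h5 h4 (abs_nonneg _) zero_le_one
      _ = M := one_mul M
  have hlim : ∀ y : I, Tendsto (fun n => f n y) atTop (𝓝 (g y)) := by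
    intro y
    rw [← hGI]
    have hη : Tendsto (fun n => (η n).rOut) atTop (𝓝 0) := hρt
    refine ContDiffBump.convolution_tendsto_right hη
      (Eventually.of_forall fun _ => hGc.aestronglyMeasurable)
      ((hGc.tendsto (y : ℝ)).comp tendsto_snd) ?_
    have : Tendsto (fun n => 2 * ρ n + (1 - 4 * ρ n) * (y : ℝ)) atTop
        (𝓝 (2 * 0 + (1 - 4 * 0) * (y : ℝ))) :=
      (hρt.const_mul 2).add (((hρt.const_mul 4).const_sub 1).mul_const _)
    simpa using this
  have hv' : InjOn (fun i => (v i : ℝ)) s := fun i hi j hj h => hv hi hj (Subtype.ext h)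
  have key : Tendsto (fun n => |f n x - (Lagrange.interpolate s (fun i => (v i : ℝ))
      (fun i => f n (v i))).eval (x : ℝ)|) atTop
      (𝓝 |g x -
        (Lagrange.interpolate s (fun i => (v i : ℝ)) (fun i => g (v i))).eval (x : ℝ)|) := by
    refine ((hlim x).sub ?_).abs
    simp only [Lagrange.interpolate_apply, Polynomial.eval_finsetSum, Polynomial.eval_mul,
      Polynomial.eval_C]
    exact tendsto_finsetSum _ fun i _ => (hlim (v i)).mul_const _
  exact le_of_tendsto' key fun n =>
    abs_sub_interpolate_le_of_contDiff (hfs n) (hfM n) s _ hv' hs (fun i _ => (v i).2) x.2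

/-- A function of the class with `r` known zeros is small near them. -/
theorem abs_le_of_zeros {r : ℕ} {M : ℝ} (hM : 0 ≤ M) {g : I → ℝ} (hg : g ∈ factorClass r M)
    {ι : Type*} (s : Finset ι) (v : ι → I) (hv : InjOn v s) (hs : s.card = r)
    (h0 : ∀ i ∈ s, g (v i) = 0) (x : I) :
    |g x| ≤ M / r ! * ∏ i ∈ s, |(x : ℝ) - v i| := by
  classical
  have h := abs_sub_interpolate_le hM hg s v hv hs x
  have hz : Lagrange.interpolate s (fun i => (v i : ℝ)) (fun i => g (v i)) = 0 := by
    rw [Lagrange.interpolate_apply]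
    exact Finset.sum_eq_zero fun i hi => by rw [h0 i hi]; simp
  rwa [hz, Polynomial.eval_zero, sub_zero] at h

/-! ### The information cost of the algorithm -/

section Information

variable {F G : Type}

theorem length_collected (L : List ℝ → F → ℝ) (f : F) (n : ℕ) : (collected L f n).length = n := by
  induction n with
  | zero => rfl
  | succ n ih => simp [collected, ih]

theorem collected_congr_of_le {L : List ℝ → F → ℝ} {f f' : F} {n : ℕ}
    (h : collected L f n = collected L f' n) {k : ℕ} (hk : k ≤ n) :
    collected L f k = collected L f' k := by
  induction n with
  | zero => rw [Nat.le_zero.1 hk]; rfl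
  | succ n ih =>
    rcases hk.eq_or_lt with rfl | hk
    · exact h
    · exact ih (List.append_inj' h rfl).1 (Nat.lt_succ_iff.1 hk)

/-- Equal results of two functions come from equal measurements at equal points. -/
theorem value_congr_of_lt {L : List ℝ → F → ℝ} {f f' : F} {n : ℕ}
    (h : collected L f n = collected L f' n) {k : ℕ} (hk : k < n) :
    L (collected L f k) f = L (collected L f k) f' := by
  have h1 : collected L f (k + 1) = collected L f' (k + 1) := collected_congr_of_le h hk
  have h2 := List.append_inj' h1 rfl
  have h3 := h2.2
  rw [← h2.1] at h3
  simpa using h3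

/-- An information mapping of fixed length: `n` measurements, the next one chosen from the
values seen so far. -/
theorem isInformationMapping_collected {Λ : Set (F → ℝ)} {L : List ℝ → F → ℝ}
    (hL : ∀ y, L y ∈ Λ) {n : ℕ} (hn : 1 ≤ n) :
    IsInformationMapping Λ (fun f => collected L f n) := by
  refine ⟨L, fun y => decide (y.length < n), hL, fun f => ⟨n, ⟨⟨hn, ?_⟩, ?_⟩, rfl⟩⟩
  · simp [length_collected]
  · rintro k ⟨-, hk⟩
    simpa [length_collected] using hk

/-- A map whose value at `f` depends only on `N f` is an algorithm based on `N`. -/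
theorem exists_isRepresentation [Nonempty G] {Λ : Set (F → ℝ)} {A : F → G} {N : F → List ℝ}
    (hN : IsInformationMapping Λ N) (h : ∀ f f', N f = N f' → A f = A f') :
    ∃ out, IsRepresentation Λ A out N := by
  refine ⟨Function.extend N A fun _ => Classical.arbitrary G, hN, fun f => ?_⟩
  rw [Function.FactorsThrough.extend_apply (fun f f' hf => h f f' hf)]

end Information

/-- The next sample point of `A_{P,m}`: first the points of the list `l`, then the points
`w z 0, w z 1, …` that belong to the first `z` in `l` with a nonzero value. -/
def nextPoint {D : Type} (l : List D) (w : D → ℕ → D) (x₀ : D) (y : List ℝ) : D :=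
  if h : y.length < l.length then l[y.length]
  else match (l.zip y).find? (fun p => decide (p.2 ≠ 0)) with
    | some p => w p.1 (y.length - l.length)
    | none => x₀

section NextPoint

variable {D : Type} {F : Set (D → ℝ)} (l : List D) (w : D → ℕ → D) (x₀ : D)

theorem collected_nextPoint_of_le (f : F) {k : ℕ} (hk : k ≤ l.length) :
    collected (fun y (f : F) => f.1 (nextPoint l w x₀ y)) f k = (l.take k).map f.1 := by
  induction k with
  | zero => rfl
  | succ k ih =>
    have h1 : k < l.length := hk
    rw [collected, ih h1.le]
    simp only [nextPoint, List.length_map, List.length_take, Nat.min_eq_left h1.le, h1, dite_true]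
    rw [← List.take_append_getElem h1, List.map_append]
    rfl

theorem collected_nextPoint_add (f : F) (j : ℕ) :
    ∃ t : List ℝ, t.length = j ∧
      collected (fun y (f : F) => f.1 (nextPoint l w x₀ y)) f (l.length + j) = l.map f.1 ++ t := by
  induction j with
  | zero => exact ⟨[], rfl, by simp [collected_nextPoint_of_le l w x₀ f le_rfl]⟩
  | succ j ih =>
    obtain ⟨t, ht, h⟩ := ih
    exact ⟨t ++ [_], by simp [ht], by rw [← add_assoc, collected, h, List.append_assoc]⟩

/-- After the points of `l`, the sample points belong to the first nonzero found in `l`. -/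
theorem nextPoint_of_find_eq_some (f : F) {z : D}
    (hz : l.find? (fun z => decide (f.1 z ≠ 0)) = some z) (j : ℕ) :
    nextPoint l w x₀
      (collected (fun y (f : F) => f.1 (nextPoint l w x₀ y)) f (l.length + j)) = w z j := by
  obtain ⟨t, ht, h⟩ := collected_nextPoint_add l w x₀ f j
  have hzip : l.zip (l.map f.1 ++ t) = l.map fun z => (z, f.1 z) := by
    have := List.zip_append (l₁ := l) (l₂ := l.map f.1) (r₁ := []) (r₂ := t) (by simp)
    rw [List.append_nil, List.zip_nil_left, List.append_nil] at this
    rw [this, List.map_prod_left_eq_zip]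
  rw [h, nextPoint]
  rw [dif_neg (by simp), hzip, List.find?_map]
  have : ((fun p : D × ℝ => decide (p.2 ≠ 0)) ∘ fun z => (z, f.1 z)) =
      fun z => decide (f.1 z ≠ 0) := rfl
  rw [this, hz]
  simp [ht]

end NextPoint

theorem interpolant_congr {r k : ℕ} {g g' : I → ℝ}
    (h : ∀ l < r * k, g (node (r * k) l) = g' (node (r * k) l)) (x : I) :
    interpolant r k g x = interpolant r k g' x := by
  unfold interpolant
  split_ifs with hk
  · rfl
  · congr 1
    refine Lagrange.interpolate_eq_of_values_eq_on _ _ fun i hi => h _ ?_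
    have h1 : min ⌊(k : ℝ) * x⌋₊ (k - 1) + 1 ≤ k := by omega
    calc r * min ⌊(k : ℝ) * x⌋₊ (k - 1) + i < r * min ⌊(k : ℝ) * x⌋₊ (k - 1) + r :=
          Nat.add_lt_add_left (Finset.mem_range.1 hi) _
      _ = r * (min ⌊(k : ℝ) * x⌋₊ (k - 1) + 1) := by ring
      _ ≤ r * k := Nat.mul_le_mul_left _ h1

/-- The sample points used for the recovery at `z`, in the order `(i, l) ↦ i * n + l`. -/
def recoverPoint {d : ℕ} (n : ℕ) (z : Cube d) (j : ℕ) : Cube d :=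
  if h : j / n < d then Function.update z ⟨j / n, h⟩ (node n (j % n)) else z

theorem recover_congr {r m d : ℕ} {z : Cube d} {f f' : Cube d → ℝ} (hz : f z = f' z)
    (h : ∀ j < d * (r * (m / (d * r))),
      f (recoverPoint (r * (m / (d * r))) z j) = f' (recoverPoint (r * (m / (d * r))) z j)) :
    recover r m z f = recover r m z f' := by
  apply Subtype.ext
  funext x
  change recoverFun r m z f x = recoverFun r m z f' x
  unfold recoverFun
  rw [hz]
  congr 1
  refine Finset.prod_congr rfl fun i _ => interpolant_congr (fun l hl => ?_) _
  set n := r * (m / (d * r)) with hn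
  have hn0 : 0 < n := lt_of_le_of_lt (Nat.zero_le _) hl
  have h1 : (i * n + l) / n = i := by
    rw [mul_comm, Nat.mul_add_div hn0, Nat.div_eq_of_lt hl, add_zero]
  have h2 : (i * n + l) % n = l := by
    rw [mul_comm, Nat.mul_add_mod, Nat.mod_eq_of_lt hl]
  have h3 : i * n + l < d * n := by
    calc i * n + l < i * n + n := Nat.add_lt_add_left hl _
      _ = (i + 1) * n := by ring
      _ ≤ d * n := Nat.mul_le_mul_right _ i.2
  have := h _ h3
  simpa [recoverPoint, h1, h2] using this

/-- `A_{P,m}` is a deterministic algorithm that uses at most `|P| + m + 1` function values; the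
additional value only serves to make this number positive. -/
theorem exists_representation_detectAndRecover (r : ℕ) (M : ℝ) {d : ℕ} (P : Finset (Cube d))
    (m : ℕ) : ∃ out N, IsRepresentation (standardInformation (tensorClass r M d))
      (detectAndRecover r M P m) out N ∧ informationCost N ≤ ((P.card + m + 1 : ℕ) : ℕ∞) := by
  classical
  set n := r * (m / (d * r)) with hn
  set q := nextPoint P.toList (recoverPoint n) (0 : Cube d) with hq
  set L : List ℝ → tensorClass r M d → ℝ := fun y f => f.1 (q y) with hL
  have hLΛ : ∀ y, L y ∈ standardInformation (tensorClass r M d) := fun y => ⟨q y, rfl⟩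
  have hN : IsInformationMapping (standardInformation (tensorClass r M d))
      (fun f => collected L f (P.toList.length + (d * n + 1))) :=
    isInformationMapping_collected hLΛ (by omega)
  suffices h : ∀ f f', collected L f (P.toList.length + (d * n + 1)) =
      collected L f' (P.toList.length + (d * n + 1)) →
        detectAndRecover r M P m f = detectAndRecover r M P m f' by
    obtain ⟨out, hout⟩ := exists_isRepresentation hN h
    refine ⟨out, _, hout, iSup_le fun f => ?_⟩
    rw [length_collected]
    have h1 : d * n ≤ m := by
      rw [hn, ← mul_assoc]
      exact Nat.mul_div_le m (d * r)
    have : P.toList.length + (d * n + 1) ≤ P.card + m + 1 := by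
      rw [Finset.length_toList]; omega
    exact_mod_cast this
  · intro f f' hff
    have hP : ∀ z ∈ P.toList, f.1 z = f'.1 z := by
      have := collected_congr_of_le hff (Nat.le_add_right _ _)
      rw [collected_nextPoint_of_le P.toList _ _ f le_rfl,
        collected_nextPoint_of_le P.toList _ _ f' le_rfl, List.take_length] at this
      exact fun z hz => List.map_inj_left.1 this z hz
    have hfind : P.toList.find? (fun z => decide (f'.1 z ≠ 0)) =
        P.toList.find? (fun z => decide (f.1 z ≠ 0)) := by
      refine List.find?_congr fun z hz => ?_
      rw [hP z hz]
    unfold detectAndRecover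
    rw [hfind]
    rcases hfz : P.toList.find? (fun z => decide (f.1 z ≠ 0)) with _ | z
    · rfl
    · refine recover_congr (hP z (List.mem_of_find?_eq_some hfz)) fun j hj => ?_
      have := value_congr_of_lt hff (k := P.toList.length + j) (by rw [← hn] at hj; omega)
      simp only [hL] at this
      rwa [hq, nextPoint_of_find_eq_some _ _ _ f hfz] at this

theorem worstCaseCost_detectAndRecover_le (r : ℕ) (M : ℝ) {d : ℕ} (P : Finset (Cube d)) (m : ℕ) :
    worstCaseCost (standardInformation (tensorClass r M d)) (detectAndRecover r M P m) ≤
      ((P.card + m + 1 : ℕ) : ℕ∞) := by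
  obtain ⟨out, N, h, hc⟩ := exists_representation_detectAndRecover r M P m
  have h1 : worstCaseCost (standardInformation (tensorClass r M d)) (detectAndRecover r M P m) ≤
      informationCost N := sInf_le ⟨out, N, h, rfl⟩
  exact h1.trans hc

/-! ### The error of the algorithm -/

theorem coe_node {n l : ℕ} (h : l < n) : (node n l : ℝ) = (2 * l + 1) / (2 * n) := by
  have hn : (0 : ℝ) < n := by exact_mod_cast (Nat.zero_le l).trans_lt h
  have hl : (l : ℝ) + 1 ≤ n := by exact_mod_cast h
  rw [node, projIcc_of_mem]
  constructor
  · positivity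
  · rw [div_le_one (by positivity)]; linarith

/-- The error of piecewise polynomial interpolation is at most `M / r! · k⁻ʳ`. -/
theorem abs_sub_interpolant_le {r : ℕ} (hr : 1 ≤ r) {M : ℝ} (hM : 0 ≤ M) {g : I → ℝ}
    (hg : g ∈ factorClass r M) {k : ℕ} (hk : 1 ≤ k) (x : I) :
    |g x - interpolant r k g x| ≤ M / r ! * (1 / (k : ℝ)) ^ r := by
  have hk0 : (0 : ℝ) < k := by exact_mod_cast hk
  have hr0 : (0 : ℝ) < r := by exact_mod_cast hr
  rw [interpolant, if_neg (by omega)]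
  set j := min ⌊(k : ℝ) * x⌋₊ (k - 1) with hj
  have hjk : j + 1 ≤ k := by omega
  have hx0 : 0 ≤ (x : ℝ) := x.2.1
  have hx1 : (x : ℝ) ≤ 1 := x.2.2
  have hjx : (j : ℝ) ≤ k * x := by
    have h1 : (j : ℝ) ≤ (⌊(k : ℝ) * x⌋₊ : ℝ) := by exact_mod_cast min_le_left _ _
    exact h1.trans (Nat.floor_le (by positivity))
  have hxj : (k : ℝ) * x ≤ j + 1 := by
    rcases le_total ⌊(k : ℝ) * x⌋₊ (k - 1) with h | h
    · rw [hj, min_eq_left h]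
      exact (Nat.lt_floor_add_one _).le
    · have h2 : j + 1 = k := by omega
      have h3 : (j : ℝ) + 1 = k := by exact_mod_cast h2
      rw [h3]
      exact mul_le_of_le_one_right hk0.le hx1
  have hlt : ∀ i ∈ Finset.range r, r * j + i < r * k := by
    intro i hi
    calc r * j + i < r * j + r := Nat.add_lt_add_left (Finset.mem_range.1 hi) _
      _ = r * (j + 1) := by ring
      _ ≤ r * k := Nat.mul_le_mul_left _ hjk
  have hnode : ∀ i ∈ Finset.range r,
      (node (r * k) (r * j + i) : ℝ) = (2 * (r * j + i) + 1) / (2 * (r * k)) := by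
    intro i hi
    rw [coe_node (hlt i hi)]
    push_cast
    ring
  have hinj : InjOn (fun i => node (r * k) (r * j + i)) (Finset.range r) := by
    intro a ha b hb hab
    have h1 : (node (r * k) (r * j + a) : ℝ) = node (r * k) (r * j + b) := congrArg _ hab
    rw [hnode a ha, hnode b hb, div_left_inj' (by positivity)] at h1
    have : (a : ℝ) = b := by linarith
    exact_mod_cast this
  refine (abs_sub_interpolate_le hM hg (Finset.range r) (fun i => node (r * k) (r * j + i)) hinj
    (Finset.card_range r) x).trans ?_
  refine mul_le_mul_of_nonneg_left ?_ (by positivity)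
  calc ∏ i ∈ Finset.range r, |(x : ℝ) - node (r * k) (r * j + i)|
      ≤ ∏ i ∈ Finset.range r, (1 / (k : ℝ)) := by
        refine Finset.prod_le_prod (fun _ _ => abs_nonneg _) fun i hi => ?_
        rw [hnode i hi]
        have hi' : (i : ℝ) + 1 ≤ r := by exact_mod_cast Finset.mem_range.1 hi
        have hi0 : (0 : ℝ) ≤ i := i.cast_nonneg
        have e : (x : ℝ) - (2 * (r * j + i) + 1) / (2 * (r * k)) =
            ((k * x - j) - (2 * i + 1) / (2 * r)) / k := by
          field_simp
          ring
        rw [e, abs_div, abs_of_pos hk0]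
        refine div_le_div_of_nonneg_right ?_ hk0.le
        have h2 : (2 * (i : ℝ) + 1) / (2 * r) ≤ 1 := by
          rw [div_le_one (by positivity)]; linarith
        have h3 : 0 ≤ (2 * (i : ℝ) + 1) / (2 * r) := by positivity
        rw [abs_le]
        constructor <;> linarith
    _ = (1 / (k : ℝ)) ^ r := by simp

theorem interpolant_const_mul (r k : ℕ) (c : ℝ) (g : I → ℝ) (x : I) :
    interpolant r k (fun t => c * g t) x = c * interpolant r k g x := by
  unfold interpolant
  split_ifs with hk
  · simp
  · have : cellPolynomial r k (fun t => c * g t) (min ⌊(k : ℝ) * x⌋₊ (k - 1)) =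
        c • cellPolynomial r k g (min ⌊(k : ℝ) * x⌋₊ (k - 1)) := by
      unfold cellPolynomial
      rw [← map_smul]
      rfl
    rw [this, Polynomial.eval_smul, smul_eq_mul]

/-- From a nonzero `z` of a rank one tensor, `I_m(z, ·)` recovers the product of the interpolated
factors. -/
theorem recoverFun_prod (r m : ℕ) {d : ℕ} (hd : 1 ≤ d) (g : Fin d → I → ℝ) {z : Cube d}
    (hz : ∏ i, g i (z i) ≠ 0) (x : Cube d) :
    recoverFun r m z (fun x => ∏ i, g i (x i)) x =
      ∏ i, interpolant r (m / (d * r)) (g i) (x i) := by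
  classical
  unfold recoverFun
  have hzi : ∀ i, g i (z i) ≠ 0 := fun i => (Finset.prod_ne_zero_iff.1 hz) i (Finset.mem_univ i)
  have h1 : ∀ i : Fin d, (fun t => ∏ j, g j (Function.update z i t j)) =
      fun t => (∏ j, g j (z j)) / g i (z i) * g i t := by
    intro i
    ext t
    rw [← Finset.mul_prod_erase _ (fun j => g j (Function.update z i t j)) (Finset.mem_univ i),
      ← Finset.mul_prod_erase _ (fun j => g j (z j)) (Finset.mem_univ i)]
    simp only [Function.update_self]
    rw [mul_div_cancel_left₀ _ (hzi i), mul_comm]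
    congr 1
    refine Finset.prod_congr rfl fun j hj => ?_
    rw [Function.update_of_ne (Finset.ne_of_mem_erase hj)]
  simp only [h1, interpolant_const_mul]
  rw [Finset.prod_mul_distrib, Finset.prod_div_distrib, Finset.prod_const, Finset.card_univ,
    Fintype.card_fin]
  obtain ⟨e, rfl⟩ : ∃ e, d = e + 1 := ⟨d - 1, by omega⟩
  rw [Nat.add_sub_cancel, pow_succ]
  field_simp

theorem abs_prod_sub_prod_le {ι : Type*} (s : Finset ι) (a b : ι → ℝ) {e : ℝ} (he : 0 ≤ e)
    (ha : ∀ i ∈ s, |a i| ≤ 1) (hab : ∀ i ∈ s, |a i - b i| ≤ e) :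
    |∏ i ∈ s, a i - ∏ i ∈ s, b i| ≤ (1 + e) ^ s.card - 1 := by
  classical
  induction s using Finset.induction_on with
  | empty => simp
  | insert i s hi ih =>
    rw [Finset.prod_insert hi, Finset.prod_insert hi, Finset.card_insert_of_notMem hi]
    have ih' := ih (fun j hj => ha j (Finset.mem_insert_of_mem hj))
      (fun j hj => hab j (Finset.mem_insert_of_mem hj))
    have h1 := ha i (Finset.mem_insert_self i s)
    have h2 := hab i (Finset.mem_insert_self i s)
    have h3 : |∏ j ∈ s, b j| ≤ (1 + e) ^ s.card := by
      rw [Finset.abs_prod, ← Finset.prod_const]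
      refine Finset.prod_le_prod (fun _ _ => abs_nonneg _) fun j hj => ?_
      have := abs_sub_abs_le_abs_sub (b j) (a j)
      rw [abs_sub_comm] at this
      linarith [ha j (Finset.mem_insert_of_mem hj), hab j (Finset.mem_insert_of_mem hj)]
    have e1 : a i * ∏ j ∈ s, a j - b i * ∏ j ∈ s, b j =
        a i * (∏ j ∈ s, a j - ∏ j ∈ s, b j) + (a i - b i) * ∏ j ∈ s, b j := by ring
    rw [e1]
    calc _ ≤ |a i| * |∏ j ∈ s, a j - ∏ j ∈ s, b j| + |a i - b i| * |∏ j ∈ s, b j| := by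
          rw [← abs_mul, ← abs_mul]; exact abs_add_le _ _
      _ ≤ 1 * ((1 + e) ^ s.card - 1) + e * (1 + e) ^ s.card := by gcongr
      _ = (1 + e) ^ (s.card + 1) - 1 := by ring

theorem one_add_div_pow_sub_one_le {ε : ℝ} (h0 : 0 < ε) (h1 : ε < 1) {d : ℕ} (hd : 1 ≤ d) :
    (1 + ε / (2 * d)) ^ d - 1 ≤ ε := by
  have hd0 : (0 : ℝ) < d := by exact_mod_cast hd
  have h2 : (1 + ε / (2 * d)) ^ d ≤ Real.exp (ε / 2) := by
    calc (1 + ε / (2 * d)) ^ d ≤ Real.exp (ε / (2 * d)) ^ d := by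
          gcongr
          linarith [Real.add_one_le_exp (ε / (2 * d))]
      _ = Real.exp (ε / 2) := by
          rw [← Real.exp_nat_mul]
          congr 1
          field_simp
  have h3 : Real.exp (ε / 2) ≤ 1 + ε := by
    have h4 := Real.abs_exp_sub_one_le (x := ε / 2) (by rw [abs_le]; constructor <;> linarith)
    rw [abs_of_pos (by linarith : 0 < ε / 2)] at h4
    have := (abs_le.1 h4).2
    linarith
  linarith

theorem norm_le_of_forall {d : ℕ} {f : BoundedFun d} {b : ℝ} (h : ∀ x, |f x| ≤ b) : ‖f‖ ≤ b :=
  lp.norm_le_of_forall_le' b h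

theorem exists_lt_abs_of_lt_norm {r : ℕ} {M : ℝ} {d : ℕ} {f : tensorClass r M d} {ε : ℝ}
    (h : ε < ‖app r M d f‖) : ∃ x, ε < |f.1 x| := by
  by_contra! hx
  exact absurd h (not_lt.2 (norm_le_of_forall hx))

/-- The number of cells per direction is large enough to make the error of the interpolation
of one factor at most `ε / (2d)`. -/
theorem interpolation_error_le {r : ℕ} (hr : 1 ≤ r) {M M₁ : ℝ} (hM : 0 ≤ M) (hMM : M ≤ M₁)
    {d : ℕ} (hd : 1 ≤ d) {ε : ℝ} (h0 : 0 < ε) (h1 : ε < 1) {g : I → ℝ}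
    (hg : g ∈ factorClass r M) (x : I) :
    |g x - interpolant r (sampleBudget r (2 * r * (2 * M₁ + 1)) d ε / (d * r)) g x| ≤
      ε / (2 * d) := by
  have hd0 : (0 : ℝ) < d := by exact_mod_cast hd
  have hd1 : (1 : ℝ) ≤ d := by exact_mod_cast hd
  have hr0 : (0 : ℝ) < r := by exact_mod_cast hr
  have hM1 : 0 ≤ M₁ := hM.trans hMM
  set C := 2 * r * (2 * M₁ + 1) with hC
  set T : ℝ := (d : ℝ) ^ (1 / (r : ℝ)) * ε ^ (-(1 / (r : ℝ))) with hT
  have hTr : T ^ r = d / ε := by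
    rw [hT, mul_pow, ← Real.rpow_natCast, ← Real.rpow_natCast, ← Real.rpow_mul hd0.le,
      ← Real.rpow_mul h0.le]
    rw [one_div, inv_mul_cancel₀ hr0.ne', neg_mul, inv_mul_cancel₀ hr0.ne', Real.rpow_one,
      Real.rpow_neg_one]
    rfl
  have hT1 : 1 ≤ T := by
    have h2 : 1 ≤ (d : ℝ) ^ (1 / (r : ℝ)) := Real.one_le_rpow hd1 (by positivity)
    have h3 : 1 ≤ ε ^ (-(1 / (r : ℝ))) :=
      Real.one_le_rpow_of_pos_of_le_one_of_nonpos h0 h1.le (by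
        have : 0 < 1 / (r : ℝ) := by positivity
        linarith)
    calc (1 : ℝ) = 1 * 1 := by ring
      _ ≤ T := mul_le_mul h2 h3 zero_le_one (by positivity)
  set k := sampleBudget r C d ε / (d * r) with hk
  have hkf : k = ⌊2 * (2 * M₁ + 1) * T⌋₊ := by
    rw [hk, sampleBudget, ← Nat.floor_div_natCast]
    congr 1
    rw [hC, hT, Real.rpow_add hd0, Real.rpow_one]
    push_cast
    field_simp
  have hk1 : (2 * M₁ + 1) * T ≤ k := by
    have h2 : 1 ≤ (2 * M₁ + 1) * T := by nlinarith
    have h3 := Nat.lt_floor_add_one (2 * (2 * M₁ + 1) * T)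
    rw [← hkf] at h3
    linarith
  have hkpos : (0 : ℝ) < k := lt_of_lt_of_le (by positivity) hk1
  have hk1' : 1 ≤ k := by
    have : 0 < k := by exact_mod_cast hkpos
    exact this
  refine (abs_sub_interpolant_le hr hM hg hk1' x).trans ?_
  have hfac : (1 : ℝ) ≤ r ! := by exact_mod_cast Nat.one_le_iff_ne_zero.2 (Nat.factorial_ne_zero r)
  have h5 : (2 * M₁ + 1) ≤ (2 * M₁ + 1) ^ r := le_self_pow₀ (by linarith) (by omega)
  have h4 : (2 * M₁ + 1) * (d / ε) ≤ (k : ℝ) ^ r := by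
    calc (2 * M₁ + 1) * (d / ε) ≤ (2 * M₁ + 1) ^ r * (d / ε) := by gcongr
      _ = ((2 * M₁ + 1) * T) ^ r := by rw [mul_pow, hTr]
      _ ≤ (k : ℝ) ^ r := by gcongr
  calc M / r ! * (1 / (k : ℝ)) ^ r ≤ M / 1 * (1 / (k : ℝ) ^ r) := by
        rw [div_pow, one_pow]; gcongr
    _ ≤ M₁ / 1 * (1 / ((2 * M₁ + 1) * (d / ε))) := by gcongr
    _ ≤ ε / (2 * d) := by
      rw [div_one, mul_one_div, div_le_div_iff₀ (by positivity) (by positivity)]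
      field_simp
      linarith

/-- A detector with at most `b - m - 1` points gives an algorithm of error `ε` and cost `b`. -/
theorem detectorAlgorithmBound_of_isDetector {r : ℕ} (hr : 1 ≤ r) {M M₁ : ℝ} (hM : 0 ≤ M)
    (hMM : M ≤ M₁) {d : ℕ} (hd : 1 ≤ d) {ε : ℝ} (h0 : 0 < ε) (h1 : ε < 1) {P : Finset (Cube d)}
    (hP : IsDetector r M d ε P) {b : ℝ}
    (hb : (P.card : ℝ) + sampleBudget r (2 * r * (2 * M₁ + 1)) d ε + 1 ≤ b) :
    DetectorAlgorithmBound r M d ε P (sampleBudget r (2 * r * (2 * M₁ + 1)) d ε) b := by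
  set m := sampleBudget r (2 * r * (2 * M₁ + 1)) d ε with hm
  refine ⟨hP, ?_, ?_, ?_⟩
  · obtain ⟨out, N, h, -⟩ := exists_representation_detectAndRecover r M P m
    exact ⟨out, N, h⟩
  · refine iSup_le fun f => ?_
    rw [edist_dist, dist_eq_norm]
    refine ENNReal.ofReal_le_ofReal ?_
    unfold detectAndRecover
    rcases hfind : P.toList.find? (fun z => decide (f.1 z ≠ 0)) with _ | z
    · simp only [sub_zero]
      by_contra! hlt
      obtain ⟨z, hz, hz0⟩ := hP f hlt
      have := List.find?_eq_none.1 hfind z (by simpa using hz)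
      simp [hz0] at this
    · have hz0 : f.1 z ≠ 0 := by simpa using List.find?_some hfind
      refine norm_le_of_forall fun x => ?_
      change |f.1 x - recoverFun r m z f.1 x| ≤ ε
      obtain ⟨g, hg, hf⟩ := f.2
      rw [hf] at hz0 ⊢
      rw [recoverFun_prod r m hd g hz0]
      have h2 := abs_prod_sub_prod_le Finset.univ (fun i => g i (x i))
        (fun i => interpolant r (m / (d * r)) (g i) (x i)) (e := ε / (2 * d)) (by positivity)
        (fun i _ => abs_le.2 ((hg i).1 _))
        (fun i _ => interpolation_error_le hr hM hMM hd h0 h1 (hg i) (x i))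
      rw [Finset.card_univ, Fintype.card_fin] at h2
      exact h2.trans (one_add_div_pow_sub_one_le h0 h1 hd)
  · have h2 := worstCaseCost_detectAndRecover_le r M P m
    have h3 : ((worstCaseCost (standardInformation (tensorClass r M d))
        (detectAndRecover r M P m) : ℕ∞) : ℝ≥0∞) ≤ ((P.card + m + 1 : ℕ) : ℝ≥0∞) := by
      exact_mod_cast h2
    refine h3.trans ?_
    rw [← ENNReal.ofReal_natCast]
    refine ENNReal.ofReal_le_ofReal ?_
    push_cast
    exact hb

/-! ### Members of the class of factors -/

/-- The function that is `0` on `[0,a)` and equal to the polynomial `p` on `[a,1]`. -/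
def truncPoly (a : ℝ) (p : Polynomial ℝ) (t : I) : ℝ := if (t : ℝ) < a then 0 else p.eval (t : ℝ)

theorem integral_truncPoly_mul {a : ℝ} (ha : a ∈ Icc (0 : ℝ) 1) (p : Polynomial ℝ) (v : ℝ → ℝ) :
    ∫ t : I, truncPoly a p t * v t = ∫ t in a..1, p.eval t * v t := by
  have h1 : ∀ t : I, truncPoly a p t * v t =
      (Ici a).indicator (fun t => p.eval t * v t) (t : ℝ) := by
    intro t
    unfold truncPoly
    by_cases h : (t : ℝ) < a
    · rw [if_pos h, zero_mul, indicator_of_notMem (by simpa using h)]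
    · rw [if_neg h, indicator_of_mem (by simpa using h)]
  simp_rw [h1]
  rw [unitInterval.volume_def, integral_subtype_comap measurableSet_Icc
    ((Ici a).indicator (fun t => p.eval t * v t)), setIntegral_indicator measurableSet_Ici,
    intervalIntegral.integral_of_le ha.2, ← integral_Icc_eq_integral_Ioc]
  congr 2
  ext t
  simp only [mem_inter_iff, mem_Icc, mem_Ici]
  constructor
  · rintro ⟨⟨_, h⟩, h'⟩
    exact ⟨h', h⟩
  · rintro ⟨h, h'⟩
    exact ⟨⟨ha.1.trans h, h'⟩, h⟩

/-- Truncated polynomials may be differentiated termwise as long as no jump appears at `a`; at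
`a = 0` no jump is visible, because test functions vanish there. -/
theorem isWeakDeriv_truncPoly {a : ℝ} (ha : a ∈ Icc (0 : ℝ) 1) (k : ℕ) :
    ∀ p : Polynomial ℝ, (∀ j < k, a = 0 ∨ ((Polynomial.derivative^[j]) p).eval a = 0) →
      IsWeakDeriv k (truncPoly a p) (truncPoly a ((Polynomial.derivative^[k]) p)) := by
  induction k with
  | zero => intro p _ u _ _ _; simp
  | succ k ih =>
    intro p hp u hu hc hs
    have h0 : ∀ x ∉ Ioo (0 : ℝ) 1, iteratedDeriv k u x = 0 := fun x hx =>
      image_eq_zero_of_notMem_tsupport fun h => hx (hs (tsupport_iteratedDeriv_subset k u h))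
    have hb : p.eval a * iteratedDeriv k u a = 0 := by
      rcases hp 0 (Nat.succ_pos k) with h | h
      · rw [h0 a (by simp [h]), mul_zero]
      · rw [Function.iterate_zero, id] at h
        rw [h, zero_mul]
    have hdiff : ∀ x, HasDerivAt (iteratedDeriv k u) (iteratedDeriv (k + 1) u x) x := by
      intro x
      rw [iteratedDeriv_succ]
      exact ((hu.differentiable_iteratedDeriv k
          (by exact_mod_cast WithTop.coe_lt_top k)) x).hasDerivAt
    have hcont : Continuous (iteratedDeriv (k + 1) u) :=
      hu.continuous_iteratedDeriv (k + 1) (by exact_mod_cast le_top)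
    have hparts := intervalIntegral.integral_mul_deriv_eq_deriv_mul (a := a) (b := 1)
      (u := fun x => p.eval x) (u' := fun x => (Polynomial.derivative p).eval x)
      (v := iteratedDeriv k u) (v' := iteratedDeriv (k + 1) u)
      (fun x _ => p.hasDerivAt x) (fun x _ => hdiff x)
      ((Polynomial.continuous _).intervalIntegrable _ _) (hcont.intervalIntegrable _ _)
    rw [h0 1 (by simp), mul_zero, hb, zero_sub, neg_zero, zero_sub] at hparts
    rw [integral_truncPoly_mul ha, hparts, ← integral_truncPoly_mul ha,
      ih (Polynomial.derivative p) (fun j hj => by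
        have := hp (j + 1) (Nat.succ_lt_succ hj)
        rwa [Function.iterate_succ_apply] at this) u hu hc hs, Function.iterate_succ_apply,
      pow_succ]
    ring

theorem exists_bound_eval (p : Polynomial ℝ) : ∃ B, ∀ t : I, |p.eval (t : ℝ)| ≤ B := by
  obtain ⟨B, hB⟩ := (isCompact_Icc : IsCompact (Icc (0 : ℝ) 1)).exists_bound_of_continuousOn
    (f := fun x => p.eval x) (Polynomial.continuous _).continuousOn
  exact ⟨B, fun t => hB t t.2⟩

theorem measurable_truncPoly (a : ℝ) (p : Polynomial ℝ) : Measurable (truncPoly a p) := by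
  unfold truncPoly
  refine Measurable.ite ?_ measurable_const (by fun_prop)
  exact measurableSet_lt measurable_subtype_coe measurable_const

theorem abs_truncPoly_le {a : ℝ} {p : Polynomial ℝ} {t : I} {B : ℝ} (h : |p.eval (t : ℝ)| ≤ B) :
    |truncPoly a p t| ≤ B := by
  unfold truncPoly
  split_ifs
  · rw [abs_zero]; exact (abs_nonneg _).trans h
  · exact h

theorem memLp_truncPoly (a : ℝ) (p : Polynomial ℝ) : MemLp (truncPoly a p) ∞ volume := by
  obtain ⟨B, hB⟩ := exists_bound_eval p
  exact memLp_top_of_bound (measurable_truncPoly a p).aestronglyMeasurable B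
    (Filter.Eventually.of_forall fun t => abs_truncPoly_le (hB t))

theorem continuous_truncPoly {a : ℝ} {p : Polynomial ℝ} (h : a = 0 ∨ p.eval a = 0) :
    Continuous (truncPoly a p) := by
  rcases h with rfl | h
  · have : truncPoly 0 p = fun t : I => p.eval (t : ℝ) := by
      ext t
      rw [truncPoly, if_neg (not_lt.2 t.2.1)]
    rw [this]
    fun_prop
  · have : truncPoly a p = fun t : I => p.eval (max (t : ℝ) a) := by
      ext t
      unfold truncPoly
      split_ifs with h1
      · rw [max_eq_right h1.le, h]
      · rw [max_eq_left (not_lt.1 h1)]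
    rw [this]
    fun_prop

theorem truncPoly_mem_factorClass {r : ℕ} (hr : 1 ≤ r) {M a : ℝ} (ha : a ∈ Icc (0 : ℝ) 1)
    {p : Polynomial ℝ} (hp : ∀ j < r, a = 0 ∨ ((Polynomial.derivative^[j]) p).eval a = 0)
    (h1 : ∀ t, |truncPoly a p t| ≤ 1)
    (hM : ∀ t : I, |((Polynomial.derivative^[r]) p).eval (t : ℝ)| ≤ M) :
    truncPoly a p ∈ factorClass r M := by
  refine ⟨fun t => abs_le.1 (h1 t), ⟨continuous_truncPoly (hp 0 hr), fun k hk =>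
    ⟨_, memLp_truncPoly a _, isWeakDeriv_truncPoly ha k p fun j hj => hp j (hj.trans_le hk)⟩⟩,
    _, memLp_truncPoly a _, isWeakDeriv_truncPoly ha r p hp, ?_⟩
  rw [eLpNorm_exponent_top]
  exact eLpNormEssSup_le_of_ae_bound (Filter.Eventually.of_forall fun t => abs_truncPoly_le (hM t))

theorem const_mem_factorClass {r : ℕ} (hr : 1 ≤ r) {M : ℝ} (hM : 0 ≤ M) {c : ℝ} (hc : |c| ≤ 1) :
    (fun _ => c) ∈ factorClass r M := by
  have : (fun _ => c) = truncPoly 0 (Polynomial.C c) := by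
    ext t
    rw [truncPoly, if_neg (not_lt.2 t.2.1), Polynomial.eval_C]
  rw [this]
  refine truncPoly_mem_factorClass hr (by simp) (fun _ _ => Or.inl rfl)
    (fun t => abs_truncPoly_le (by simpa using hc)) fun t => ?_
  rw [Polynomial.iterate_derivative_C hr]
  simpa using hM

theorem affine_mem_factorClass {r : ℕ} (hr : 2 ≤ r) {M : ℝ} (hM : 0 ≤ M) {α β : ℝ}
    (h : ∀ t : I, |α + β * (t : ℝ)| ≤ 1) : (fun t : I => α + β * (t : ℝ)) ∈ factorClass r M := by
  set p : Polynomial ℝ := Polynomial.C α + Polynomial.C β * Polynomial.X with hp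
  have he : ∀ t : ℝ, p.eval t = α + β * t := fun t => by simp [hp]
  have : (fun t : I => α + β * (t : ℝ)) = truncPoly 0 p := by
    ext t
    rw [truncPoly, if_neg (not_lt.2 t.2.1), he]
  rw [this]
  refine truncPoly_mem_factorClass (by omega) (by simp) (fun _ _ => Or.inl rfl)
    (fun t => abs_truncPoly_le (by rw [he]; exact h t)) fun t => ?_
  rw [hp, Polynomial.iterate_derivative_eq_zero_of_degree_lt]
  · simpa using hM
  · rw [← hp]
    refine lt_of_le_of_lt (b := ((1 : ℕ) : WithBot ℕ)) ?_ (by exact_mod_cast hr)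
    rw [hp, add_comm]
    exact Polynomial.degree_linear_le

/-- The function `β (t - a)₊ʳ`. -/
def powerRight (r : ℕ) (a β : ℝ) (t : I) : ℝ := if (t : ℝ) < a then 0 else β * ((t : ℝ) - a) ^ r

/-- The function `β (1 - a - t)₊ʳ`. -/
def powerLeft (r : ℕ) (a β : ℝ) (t : I) : ℝ := powerRight r a β (unitInterval.symm t)

theorem powerRight_mem_factorClass {r : ℕ} (hr : 1 ≤ r) {M a β : ℝ} (ha : a ∈ Icc (0 : ℝ) 1)
    (hβ : 0 ≤ β) (hM : β * r ! ≤ M) (h1 : β * (1 - a) ^ r ≤ 1) :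
    powerRight r a β ∈ factorClass r M := by
  set p : Polynomial ℝ := Polynomial.C β * (Polynomial.X - Polynomial.C a) ^ r with hp
  have he : ∀ t : ℝ, p.eval t = β * (t - a) ^ r := fun t => by simp [hp]
  have hd : ∀ j, (Polynomial.derivative^[j]) p = Polynomial.C β *
      (r.descFactorial j • (Polynomial.X - Polynomial.C a) ^ (r - j)) := by
    intro j
    rw [hp, Polynomial.iterate_derivative_C_mul, Polynomial.iterate_derivative_X_sub_pow]
  have : powerRight r a β = truncPoly a p := by
    ext t
    rw [truncPoly, he]
    rfl
  rw [this]
  refine truncPoly_mem_factorClass hr ha (fun j hj => Or.inr ?_) (fun t => ?_) fun t => ?_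
  · rw [hd]
    have : r - j ≠ 0 := by omega
    simp [this]
  · unfold truncPoly
    split_ifs with h
    · simp
    · rw [he]
      have h0 : 0 ≤ (t : ℝ) - a := by linarith
      have h2 : (t : ℝ) - a ≤ 1 - a := by linarith [t.2.2]
      rw [abs_of_nonneg (by positivity)]
      exact le_trans (by gcongr) h1
  · rw [hd]
    simp only [Nat.descFactorial_self, Nat.sub_self, pow_zero]
    simpa [abs_mul, abs_of_nonneg hβ] using hM

theorem iteratedDeriv_comp_one_sub (k : ℕ) (u : ℝ → ℝ) :
    iteratedDeriv k (fun t => u (1 - t)) = fun t => (-1) ^ k * iteratedDeriv k u (1 - t) :=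
  iteratedDeriv_comp_const_sub k u 1

theorem integral_comp_symm (g : I → ℝ) : ∫ t : I, g (unitInterval.symm t) = ∫ t : I, g t :=
  unitInterval.measurePreserving_symm.integral_comp
    unitInterval.symmMeasurableEquiv.measurableEmbedding g

theorem IsWeakDeriv.comp_symm {k : ℕ} {g h : I → ℝ} (hg : IsWeakDeriv k g h) :
    IsWeakDeriv k (fun t => g (unitInterval.symm t))
      (fun t => (-1) ^ k * h (unitInterval.symm t)) := by
  intro u hu hc hs
  have hu' : ContDiff ℝ ∞ (fun t => u (1 - t)) := hu.comp (by fun_prop)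
  have hsupp : tsupport (fun t => u (1 - t)) ⊆ (fun t => 1 - t) ⁻¹' tsupport u :=
    tsupport_comp_subset_preimage u (by fun_prop)
  have hs' : tsupport (fun t => u (1 - t)) ⊆ Ioo 0 1 := by
    intro t ht
    have := hs (hsupp ht)
    simp only [mem_Ioo] at this ⊢
    constructor <;> linarith [this.1, this.2]
  have hc' : HasCompactSupport (fun t => u (1 - t)) :=
    isCompact_Icc.of_isClosed_subset (isClosed_tsupport _) (hs'.trans Ioo_subset_Icc_self)
  have key := hg _ hu' hc' hs'
  rw [iteratedDeriv_comp_one_sub] at key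
  have e1 : ∫ t : I, g (unitInterval.symm t) * iteratedDeriv k u t =
      ∫ t : I, g t * iteratedDeriv k u (1 - t) := by
    rw [← integral_comp_symm]
    simp
  have e2 : ∫ t : I, (-1) ^ k * h (unitInterval.symm t) * u t =
      (-1) ^ k * ∫ t : I, h t * u (1 - t) := by
    rw [← integral_const_mul, ← integral_comp_symm]
    simp [mul_assoc]
  rw [e1, e2, ← key, ← integral_const_mul]
  congr 1
  ext t
  have : ((-1 : ℝ) ^ k) * (-1) ^ k = 1 := by rw [← mul_pow]; simp
  calc _ = ((-1 : ℝ) ^ k * (-1) ^ k) * (g t * iteratedDeriv k u (1 - t)) := by rw [this, one_mul]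
    _ = _ := by ring

theorem comp_symm_mem_factorClass {r : ℕ} {M : ℝ} {g : I → ℝ} (hg : g ∈ factorClass r M) :
    (fun t => g (unitInterval.symm t)) ∈ factorClass r M := by
  have hmem : ∀ k (h : I → ℝ), MemLp h ∞ volume →
      MemLp (fun t => (-1) ^ k * h (unitInterval.symm t)) ∞ volume := fun k h hh =>
    (hh.comp_measurePreserving unitInterval.measurePreserving_symm).const_mul _
  obtain ⟨h1, ⟨h2, h3⟩, h, h4, h5, h6⟩ := hg
  refine ⟨fun t => h1 _, ⟨h2.comp unitInterval.continuous_symm, fun k hk => ?_⟩,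
    _, hmem r h h4, h5.comp_symm, ?_⟩
  · obtain ⟨w, hw, hw'⟩ := h3 k hk
    exact ⟨_, hmem k w hw, hw'.comp_symm⟩
  · have e1 : (fun t => (-1) ^ r * h (unitInterval.symm t)) =
        ((-1 : ℝ) ^ r) • (h ∘ unitInterval.symm) := rfl
    rw [e1, eLpNorm_const_smul, eLpNorm_comp_measurePreserving h4.1
      unitInterval.measurePreserving_symm]
    simpa [enorm_pow] using h6

theorem powerLeft_mem_factorClass {r : ℕ} (hr : 1 ≤ r) {M a β : ℝ} (ha : a ∈ Icc (0 : ℝ) 1)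
    (hβ : 0 ≤ β) (hM : β * r ! ≤ M) (h1 : β * (1 - a) ^ r ≤ 1) :
    powerLeft r a β ∈ factorClass r M :=
  comp_symm_mem_factorClass (powerRight_mem_factorClass hr ha hβ hM h1)

theorem neg_mem_factorClass {r : ℕ} {M : ℝ} {g : I → ℝ} (hg : g ∈ factorClass r M) :
    (fun t => -g t) ∈ factorClass r M := by
  have hwd : ∀ {k : ℕ} {g h : I → ℝ}, IsWeakDeriv k g h →
      IsWeakDeriv k (fun t => -g t) (fun t => -h t) := by
    intro k g h hg u hu hc hs
    simp only [neg_mul, integral_neg, hg u hu hc hs, mul_neg]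
  obtain ⟨h1, ⟨h2, h3⟩, h, h4, h5, h6⟩ := hg
  refine ⟨fun t => ⟨by linarith [(h1 t).2], by linarith [(h1 t).1]⟩, ⟨h2.neg, fun k hk => ?_⟩,
    _, h4.neg, hwd h5, ?_⟩
  · obtain ⟨w, hw, hw'⟩ := h3 k hk
    exact ⟨_, hw.neg, hwd hw'⟩
  · exact (eLpNorm_neg h ∞ volume).trans_le h6

/-! ### Lower bounds for the complexity -/

theorem zero_mem_tensorClass {r : ℕ} (hr : 1 ≤ r) {M : ℝ} (hM : 0 ≤ M) {d : ℕ} (hd : 1 ≤ d) :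
    (fun _ => 0 : Cube d → ℝ) ∈ tensorClass r M d := by
  refine ⟨fun _ _ => 0, fun _ => const_mem_factorClass hr hM (by simp), ?_⟩
  ext x
  have : d ≠ 0 := by omega
  simp [this]

theorem neg_mem_tensorClass {r : ℕ} {M : ℝ} {d : ℕ} (hd : 1 ≤ d) {f : Cube d → ℝ}
    (hf : f ∈ tensorClass r M d) : (fun x => -f x) ∈ tensorClass r M d := by
  obtain ⟨g, hg, rfl⟩ := hf
  obtain ⟨e, rfl⟩ : ∃ e, d = e + 1 := ⟨d - 1, by omega⟩
  refine ⟨Function.update g 0 (fun t => -g 0 t), fun i => ?_, ?_⟩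
  · rcases eq_or_ne i 0 with rfl | hi
    · rw [Function.update_self]; exact neg_mem_factorClass (hg 0)
    · rw [Function.update_of_ne hi]; exact hg i
  · ext x
    simp [Fin.prod_univ_succ]

/-- If `f` vanishes at the points at which the zero function is sampled, then `f` gives the same
information as the zero function. -/
theorem information_eq_of_vanish {r : ℕ} {M : ℝ} {d : ℕ} {L : List ℝ → tensorClass r M d → ℝ}
    {T : List ℝ → Bool} {N : tensorClass r M d → List ℝ}
    (hN : ∀ f, ∃ n, IsLeast {n : ℕ | 1 ≤ n ∧ T (collected L f n) = false} n ∧ N f = collected L f n)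
    {f₀ f : tensorClass r M d}
    (hf : ∀ k < (N f₀).length, L (collected L f₀ k) f = L (collected L f₀ k) f₀) :
    N f = N f₀ := by
  obtain ⟨n₀, h₀, e₀⟩ := hN f₀
  obtain ⟨n, h, e⟩ := hN f
  rw [e₀, length_collected] at hf
  have hk : ∀ k ≤ n₀, collected L f k = collected L f₀ k := by
    intro k
    induction k with
    | zero => intro _; rfl
    | succ k ih =>
      intro hk
      rw [collected, collected, ih (by omega), hf k (by omega)]
  have h1 : n ≤ n₀ := h.2 ⟨h₀.1.1, by rw [hk n₀ le_rfl]; exact h₀.1.2⟩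
  have h2 : n₀ ≤ n := h₀.2 ⟨h.1.1, by rw [← hk n h1]; exact h.1.2⟩
  rw [e, e₀, ← hk n₀ le_rfl, le_antisymm h1 h2]

/-- Fooling functions: if for any `n` sample points there is a function of the class that vanishes
there and has norm larger than `ε`, then more than `n` function values are needed. -/
theorem le_comp_of_fooling {r : ℕ} (hr : 1 ≤ r) {M : ℝ} (hM : 0 ≤ M) {d : ℕ} (hd : 1 ≤ d) {ε : ℝ}
    (hε : 0 ≤ ε) {n : ℕ} (h : ∀ X : Finset (Cube d), X.card < n →
      ∃ f ∈ tensorClass r M d, (∀ x ∈ X, f x = 0) ∧ ∃ x, ε < |f x|) :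
    (n : ℕ∞) ≤ (appProblem r M d).comp ε := by
  classical
  refine le_sInf ?_
  rintro _ ⟨⟨A, hA⟩, herr, rfl⟩
  refine le_sInf ?_
  rintro _ ⟨out, N, ⟨⟨L, T, hL, hN⟩, hrep⟩, rfl⟩
  let f₀ : tensorClass r M d := ⟨_, zero_mem_tensorClass hr hM hd⟩
  by_cases hlen : n ≤ (N f₀).length
  · refine le_trans ?_ (le_iSup (fun f => ((N f).length : ℕ∞)) f₀)
    exact_mod_cast hlen
  exfalso
  choose q hq using hL
  set X : Finset (Cube d) :=
    (Finset.range (N f₀).length).image fun k => q (collected L f₀ k) with hX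
  have hXc : X.card < n := by
    refine lt_of_le_of_lt Finset.card_image_le ?_
    rw [Finset.card_range]
    omega
  obtain ⟨f, hf, hf0, x, hx⟩ := h X hXc
  have hmem : ∀ k < (N f₀).length, q (collected L f₀ k) ∈ X := fun k hk =>
    Finset.mem_image_of_mem _ (Finset.mem_range.2 hk)
  let f₁ : tensorClass r M d := ⟨f, hf⟩
  let f₂ : tensorClass r M d := ⟨_, neg_mem_tensorClass hd hf⟩
  have e1 : N f₁ = N f₀ := information_eq_of_vanish hN fun k hk => by
    rw [hq]
    exact hf0 _ (hmem k hk)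
  have e2 : N f₂ = N f₀ := information_eq_of_vanish hN fun k hk => by
    rw [hq]
    change -f _ = 0
    rw [hf0 _ (hmem k hk), neg_zero]
  change ∀ f, A f = out (N f) at hrep
  have hAe : A f₁ = A f₂ := by rw [hrep, hrep, e1, e2]
  have hdist : ∀ f, dist (app r M d f) (A f) ≤ ε := by
    intro f
    have h1 : edist (app r M d f) (A f) ≤ ENNReal.ofReal ε :=
      (le_iSup (fun f => edist (app r M d f) (A f)) f).trans herr
    rw [edist_dist, ENNReal.ofReal_le_ofReal_iff hε] at h1
    exact h1
  have h3 : ‖app r M d f₁ - app r M d f₂‖ ≤ 2 * ε := by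
    rw [← dist_eq_norm]
    have := dist_triangle_right (app r M d f₁) (app r M d f₂) (A f₁)
    have h4 := hdist f₁
    have h5 := hdist f₂
    rw [← hAe] at h5
    linarith
  have h6 : |f x - -f x| ≤ 2 * ε :=
    (lp.norm_apply_le_norm ENNReal.top_ne_zero (app r M d f₁ - app r M d f₂) x).trans h3
  have h7 : f x - -f x = 2 * f x := by ring
  rw [h7, abs_mul, abs_two] at h6
  linarith

/-- Functions that live on different cells of the partition of the cube by the hyperplanes
`xᵢ = a` have disjoint supports, so each of them needs its own sample point. -/
theorem card_le_comp_of_patterns {r : ℕ} (hr : 1 ≤ r) {M : ℝ} (hM : 0 ≤ M) {d : ℕ} (hd : 1 ≤ d)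
    {ε : ℝ} (hε : 0 ≤ ε) {a : ℝ} {g₀ g₁ : I → ℝ} (hg₀ : g₀ ∈ factorClass r M)
    (hg₁ : g₁ ∈ factorClass r M) (h₀ : ∀ t : I, a ≤ (t : ℝ) → g₀ t = 0)
    (h₁ : ∀ t : I, (t : ℝ) ≤ a → g₁ t = 0) {t₀ t₁ : I} (ht₀ : g₀ t₀ = 1)
    (J : Finset (Finset (Fin d))) (hJ : ∀ s ∈ J, ε < |g₁ t₁| ^ s.card) :
    (J.card : ℕ∞) ≤ (appProblem r M d).comp ε := by
  classical
  refine le_comp_of_fooling hr hM hd hε fun X hX => ?_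
  set pat : Cube d → Finset (Fin d) := fun x => Finset.univ.filter fun i => a < (x i : ℝ) with hpat
  obtain ⟨s, hs, hsX⟩ : ∃ s ∈ J, s ∉ X.image pat := by
    by_contra! hcon
    exact absurd ((Finset.card_le_card hcon).trans Finset.card_image_le) (not_le.2 hX)
  refine ⟨fun x => ∏ i, (if i ∈ s then g₁ else g₀) (x i),
    ⟨fun i => if i ∈ s then g₁ else g₀, fun i => by dsimp only; split_ifs <;> assumption, rfl⟩,
    fun x hx => ?_, fun i => if i ∈ s then t₁ else t₀, ?_⟩
  · by_contra hne
    have hne' := Finset.prod_ne_zero_iff.1 hne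
    refine hsX (Finset.mem_image.2 ⟨x, hx, ?_⟩)
    ext i
    have hi := hne' i (Finset.mem_univ i)
    simp only [hpat, Finset.mem_filter, Finset.mem_univ, true_and]
    by_cases his : i ∈ s
    · rw [if_pos his] at hi
      simp only [his, iff_true]
      by_contra hle
      exact hi (h₁ _ (not_lt.1 hle))
    · rw [if_neg his] at hi
      simp only [his, iff_false, not_lt]
      by_contra hle
      exact hi (h₀ _ (not_le.1 hle).le)
  · rw [Finset.abs_prod]
    have : ∀ i, |(if i ∈ s then g₁ else g₀) (if i ∈ s then t₁ else t₀)| =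
        if i ∈ s then |g₁ t₁| else 1 := by
      intro i
      split_ifs <;> simp [ht₀]
    simp only [this]
    rw [Finset.prod_ite_mem, Finset.univ_inter, Finset.prod_const]
    exact hJ s hs

theorem powerRight_of_le {r : ℕ} (hr : 1 ≤ r) {a β : ℝ} {t : I} (h : (t : ℝ) ≤ a) :
    powerRight r a β t = 0 := by
  unfold powerRight
  split_ifs with h1
  · rfl
  · have : (t : ℝ) - a = 0 := by linarith
    have h0 : r ≠ 0 := by omega
    rw [this, zero_pow h0, mul_zero]

theorem powerLeft_of_ge {r : ℕ} (hr : 1 ≤ r) {a β : ℝ} {t : I} (h : 1 - a ≤ (t : ℝ)) :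
    powerLeft r a β t = 0 :=
  powerRight_of_le hr (by rw [unitInterval.coe_symm_eq]; linarith)

theorem powerRight_one {r : ℕ} {a β : ℝ} (ha : a ≤ 1) : powerRight r a β 1 = β * (1 - a) ^ r := by
  rw [powerRight, if_neg (by simpa using ha)]
  simp

theorem powerLeft_zero {r : ℕ} {a β : ℝ} (ha : a ≤ 1) : powerLeft r a β 0 = β * (1 - a) ^ r := by
  rw [powerLeft, unitInterval.symm_zero, powerRight_one ha]

/-- For `M ≥ 2ʳ r!` there are `2ᵈ` functions of norm one with disjoint supports, one for each
corner of the cube. -/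
theorem two_pow_le_comp {r : ℕ} (hr : 1 ≤ r) {M : ℝ} (hM : 2 ^ r * (r ! : ℝ) ≤ M) {d : ℕ}
    (hd : 1 ≤ d) {ε : ℝ} (h0 : 0 ≤ ε) (h1 : ε < 1) :
    ((2 ^ d : ℕ) : ℕ∞) ≤ (appProblem r M d).comp ε := by
  have hM0 : 0 ≤ M := le_trans (by positivity) hM
  have hone : (2 : ℝ) ^ r * (1 - 1 / 2) ^ r = 1 := by rw [← mul_pow]; norm_num
  have hmem : (1 / 2 : ℝ) ∈ Icc (0 : ℝ) 1 := by constructor <;> norm_num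
  have := card_le_comp_of_patterns hr hM0 hd h0 (a := 1 / 2)
    (powerLeft_mem_factorClass hr hmem (by positivity) hM hone.le)
    (powerRight_mem_factorClass hr hmem (by positivity) hM hone.le)
    (fun t ht => powerLeft_of_ge hr (by linarith)) (fun t ht => powerRight_of_le hr ht)
    (t₀ := 0) (t₁ := 1) (by rw [powerLeft_zero (by norm_num), hone]) Finset.univ
    (fun s _ => by rw [powerRight_one (by norm_num), hone]; simpa using h1)
  simpa using this

/-- For `M > r!` there is room for factors of norm one on `[0,a)` and smaller factors on `(a,1]`
with some `a < 1`. -/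
theorem choose_le_comp {r : ℕ} (hr : 1 ≤ r) {M : ℝ} (hM : (r ! : ℝ) < M) :
    ∃ c : ℝ, 0 < c ∧ c < 1 ∧ ∀ d : ℕ, 1 ≤ d → ∀ k : ℕ, ∀ ε : ℝ, 0 ≤ ε → ε < c ^ k →
      ((d.choose k : ℕ) : ℕ∞) ≤ (appProblem r M d).comp ε := by
  have hf0 : (0 : ℝ) < r ! := by exact_mod_cast Nat.factorial_pos r
  have hM0 : 0 < M := hf0.trans hM
  have hr0 : (r : ℝ) ≠ 0 := by
    have : r ≠ 0 := by omega
    exact_mod_cast this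
  set a : ℝ := ((r ! : ℝ) / M) ^ (1 / (r : ℝ)) with ha
  have ha0 : 0 < a := by positivity
  have har : a ^ r = (r ! : ℝ) / M := by
    rw [ha, ← Real.rpow_natCast, ← Real.rpow_mul (by positivity), one_div, inv_mul_cancel₀ hr0,
      Real.rpow_one]
  have ha1 : a < 1 := by
    rw [← pow_lt_one_iff_of_nonneg ha0.le (n := r) (by omega), har, div_lt_one hM0]
    exact hM
  have hmem : a ∈ Icc (0 : ℝ) 1 := ⟨ha0.le, ha1.le⟩
  have hmem' : 1 - a ∈ Icc (0 : ℝ) 1 := ⟨by linarith, by linarith⟩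
  refine ⟨(1 - a) ^ r, by have : 0 < 1 - a := by linarith
                          positivity,
    pow_lt_one₀ (by linarith) (by linarith) (by omega), fun d hd k ε h0 hε => ?_⟩
  have hb : M / r ! * (1 - (1 - a)) ^ r = 1 := by
    rw [sub_sub_cancel, har]
    field_simp
  have hb' : M / r ! * (r ! : ℝ) ≤ M := by field_simp; exact le_rfl
  have := card_le_comp_of_patterns hr hM0.le hd h0 (a := a)
    (powerLeft_mem_factorClass (β := M / r !) hr hmem' (by positivity) hb' hb.le)
    (powerRight_mem_factorClass (β := 1) hr hmem zero_le_one (by linarith)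
      (by rw [one_mul]; exact pow_le_one₀ (by linarith) (by linarith)))
    (fun t ht => powerLeft_of_ge hr (by linarith)) (fun t ht => powerRight_of_le hr ht)
    (t₀ := 0) (t₁ := 1) (by rw [powerLeft_zero (by linarith), hb])
    (Finset.powersetCard k Finset.univ)
    (fun s hs => by
      rw [powerRight_one ha1.le, one_mul, (Finset.mem_powersetCard.1 hs).2, abs_of_nonneg]
      · exact hε
      · have : 0 ≤ 1 - a := by linarith
        positivity)
  simpa using this

/-- For `M > 0` the number of function values has to grow with the dimension: if there are more
than `2ⁿ` coordinates and at most `n` points, then two coordinates lie in the same halves of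
`[0,1]` at all these points, and a product of a left and a right factor in these two coordinates
vanishes there. -/
theorem lt_comp_of_two_pow_lt {r : ℕ} (hr : 1 ≤ r) {M : ℝ} (hM : 0 < M) :
    ∃ ε : ℝ, 0 < ε ∧ ε < 1 ∧ ∀ n d : ℕ, 2 ^ n < d →
      ((n + 1 : ℕ) : ℕ∞) ≤ (appProblem r M d).comp ε := by
  have hf0 : (0 : ℝ) < r ! := by exact_mod_cast Nat.factorial_pos r
  set β : ℝ := min 1 (M / r !) with hβ
  have hβ0 : 0 < β := lt_min one_pos (by positivity)
  have hβM : β * r ! ≤ M := by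
    calc β * r ! ≤ M / r ! * r ! := by gcongr; exact min_le_right _ _
      _ = M := by field_simp
  set b : ℝ := β * (1 - 1 / 2) ^ r with hb
  have hb0 : 0 < b := by positivity
  have hb1 : b ≤ 1 := mul_le_one₀ (min_le_left _ _) (by positivity)
    (pow_le_one₀ (by norm_num) (by norm_num))
  have hmem : (1 / 2 : ℝ) ∈ Icc (0 : ℝ) 1 := by constructor <;> norm_num
  refine ⟨b ^ 2 / 2, by positivity, by nlinarith, fun n d hnd => ?_⟩
  have hd : 1 ≤ d := (Nat.zero_le _).trans_lt hnd
  refine le_comp_of_fooling hr hM.le hd (by positivity) fun X hX => ?_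
  classical
  obtain ⟨i, j, hij, hpat⟩ := Fintype.exists_ne_map_eq_of_card_lt
    (fun (i : Fin d) (x : X) => decide (1 / 2 < (x.1 i : ℝ))) (by
      rw [Fintype.card_fun, Fintype.card_bool, Fintype.card_coe, Fintype.card_fin]
      exact lt_of_le_of_lt (Nat.pow_le_pow_right (by norm_num) (by omega)) hnd)
  set g : Fin d → I → ℝ := fun k =>
    if k = i then powerLeft r (1 / 2) β else if k = j then powerRight r (1 / 2) β else fun _ => 1
    with hg
  have hgi : g i = powerLeft r (1 / 2) β := by simp [hg]
  have hgj : g j = powerRight r (1 / 2) β := by simp [hg, hij.symm]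
  refine ⟨_, ⟨g, fun k => ?_, rfl⟩, fun x hx => ?_, fun k => if k = i then 0 else 1, ?_⟩
  · simp only [hg]
    split_ifs
    · exact powerLeft_mem_factorClass hr hmem hβ0.le hβM hb1
    · exact powerRight_mem_factorClass hr hmem hβ0.le hβM hb1
    · exact const_mem_factorClass hr hM.le (by simp)
  · have h1 := congrFun hpat ⟨x, hx⟩
    simp only [decide_eq_decide] at h1
    rcases le_or_gt (x j : ℝ) (1 / 2) with h2 | h2
    · exact Finset.prod_eq_zero (Finset.mem_univ j) (by rw [hgj]; exact powerRight_of_le hr h2)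
    · exact Finset.prod_eq_zero (Finset.mem_univ i) (by
        rw [hgi]; exact powerLeft_of_ge hr (by linarith [h1.2 h2]))
  · have h1 : ∏ k, g k (if k = i then 0 else 1) = b * b := by
      rw [← Finset.mul_prod_erase _ _ (Finset.mem_univ i),
        ← Finset.mul_prod_erase _ _ (Finset.mem_erase.2 ⟨hij.symm, Finset.mem_univ j⟩),
        Finset.prod_eq_one, mul_one, hgi, hgj, if_pos rfl, if_neg hij.symm,
        powerLeft_zero (by norm_num), powerRight_one (by norm_num)]
      intro k hk
      have hkj := Finset.ne_of_mem_erase hk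
      have hki := Finset.ne_of_mem_erase (Finset.mem_of_mem_erase hk)
      simp [hg, hki, hkj]
    rw [h1, abs_of_pos (by positivity)]
    nlinarith

/-- For `r ≥ 2` the class contains products of affine functions, which may vanish at any `d`
points. -/
theorem lt_comp_of_two_le {r : ℕ} (hr : 2 ≤ r) {M : ℝ} (hM : 0 ≤ M) {d : ℕ} (hd : 1 ≤ d) {ε : ℝ}
    (h0 : 0 ≤ ε) (h1 : ε < 1) : ((d + 1 : ℕ) : ℕ∞) ≤ (appProblem r M d).comp ε := by
  classical
  refine le_comp_of_fooling (by omega) hM hd h0 fun X hX => ?_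
  have hfac : ∀ z : I, ∃ g ∈ factorClass r M, g z = 0 ∧ ∃ t, |g t| = 1 := by
    intro z
    set s : ℝ := max (z : ℝ) (1 - z) with hs
    have hs0 : 0 < s := by
      rcases le_total (z : ℝ) (1 / 2) with h | h
      · exact lt_max_of_lt_right (by linarith)
      · exact lt_max_of_lt_left (by linarith)
    have e : ∀ t : ℝ, -(z : ℝ) / s + 1 / s * t = (t - z) / s := fun t => by ring
    refine ⟨fun t => -(z : ℝ) / s + 1 / s * (t : ℝ),
      affine_mem_factorClass hr hM fun t => ?_, ?_, ?_⟩
    · rw [e, abs_div, abs_of_pos hs0, div_le_one hs0, abs_le]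
      have h2 := le_max_left (z : ℝ) (1 - z)
      have h3 := le_max_right (z : ℝ) (1 - z)
      constructor <;> linarith [t.2.1, t.2.2]
    · simp only [e, sub_self, zero_div]
    · rcases le_total (z : ℝ) (1 - z) with h | h
      · refine ⟨1, ?_⟩
        have hs' : s = 1 - z := max_eq_right h
        simp only [e, Icc.coe_one]
        rw [hs', div_self (by rw [← hs']; exact hs0.ne'), abs_one]
      · refine ⟨0, ?_⟩
        have hs' : s = z := max_eq_left h
        simp only [e, Icc.coe_zero]
        rw [hs', zero_sub, neg_div, div_self (by rw [← hs']; exact hs0.ne'), abs_neg, abs_one]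
  choose g hg hgz t ht using hfac
  have hXd : Fintype.card X ≤ Fintype.card (Fin d) := by
    rw [Fintype.card_coe, Fintype.card_fin]; omega
  obtain ⟨ι⟩ := Function.Embedding.nonempty_of_card_le hXd
  have hz : ∃ z : Fin d → I, ∀ x : X, z (ι x) = x.1 (ι x) := by
    refine ⟨fun i => Function.extend ι (fun x => x.1 (ι x)) 0 i, fun x => ?_⟩
    exact ι.injective.extend_apply (fun x : X => x.1 (ι x)) 0 x
  obtain ⟨z, hz⟩ := hz
  refine ⟨_, ⟨fun i => g (z i), fun i => hg _, rfl⟩, fun x hx => ?_, fun i => t (z i), ?_⟩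
  · refine Finset.prod_eq_zero (Finset.mem_univ (ι ⟨x, hx⟩)) ?_
    rw [← show z (ι ⟨x, hx⟩) = x (ι ⟨x, hx⟩) from hz ⟨x, hx⟩]
    exact hgz _
  · rw [Finset.abs_prod]
    simpa [ht] using h1

/-! ### Dispersion -/

theorem volume_preimage_eq {S : Set I} {α β : ℝ} (h0 : 0 ≤ α) (h1 : β ≤ 1)
    (h : ∀ t : I, α < (t : ℝ) → (t : ℝ) < β → t ∈ S)
    (h' : ∀ t ∈ S, α ≤ (t : ℝ) ∧ (t : ℝ) ≤ β) : volume S = ENNReal.ofReal (β - α) := by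
  rw [unitInterval.volume_apply]
  refine le_antisymm ?_ ?_
  · rw [← Real.volume_Icc]
    refine measure_mono ?_
    rintro _ ⟨t, ht, rfl⟩
    exact h' t ht
  · rw [← Real.volume_Ioo]
    refine measure_mono fun t ht => ?_
    exact ⟨⟨t, h0.trans ht.1.le, ht.2.le.trans h1⟩, h _ ht.1 ht.2, rfl⟩

/-- An order-connected set contains the open interval between its endpoints and has the same
measure. -/
theorem exists_endpoints {J : Set I} (hJ : J.OrdConnected) (hne : J.Nonempty) :
    ∃ α β : ℝ, 0 ≤ α ∧ α ≤ β ∧ β ≤ 1 ∧ (∀ t : I, α < (t : ℝ) → (t : ℝ) < β → t ∈ J) ∧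
      volume J = ENNReal.ofReal (β - α) := by
  set S : Set ℝ := Subtype.val '' J with hS
  have hSne : S.Nonempty := hne.image _
  have hb : BddBelow S := ⟨0, by rintro _ ⟨t, _, rfl⟩; exact t.2.1⟩
  have ha : BddAbove S := ⟨1, by rintro _ ⟨t, _, rfl⟩; exact t.2.2⟩
  have h0 : 0 ≤ sInf S := le_csInf hSne (by rintro _ ⟨t, _, rfl⟩; exact t.2.1)
  have h1 : sSup S ≤ 1 := csSup_le hSne (by rintro _ ⟨t, _, rfl⟩; exact t.2.2)
  have h2 : ∀ t : I, sInf S < (t : ℝ) → (t : ℝ) < sSup S → t ∈ J := by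
    intro t ht ht'
    obtain ⟨_, ⟨a, haJ, rfl⟩, hat⟩ := exists_lt_of_csInf_lt hSne ht
    obtain ⟨_, ⟨b, hbJ, rfl⟩, hbt⟩ := exists_lt_of_lt_csSup hSne ht'
    exact hJ.out haJ hbJ ⟨hat.le, hbt.le⟩
  refine ⟨sInf S, sSup S, h0, csInf_le_csSup hSne hb ha, h1, h2, volume_preimage_eq h0 h1 h2 ?_⟩
  exact fun t ht => ⟨csInf_le hb ⟨t, ht, rfl⟩, le_csSup ha ⟨t, ht, rfl⟩⟩

/-- Dispersion in terms of open boxes. -/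
theorem dispersion_le_iff {d : ℕ} {P : Finset (Cube d)} {η : ℝ} (hη : 0 ≤ η) :
    dispersion P ≤ ENNReal.ofReal η ↔ ∀ α β : Fin d → ℝ, (∀ i, 0 ≤ α i) → (∀ i, α i < β i) →
      (∀ i, β i ≤ 1) → η < ∏ i, (β i - α i) →
        ∃ x ∈ P, ∀ i, α i < (x i : ℝ) ∧ (x i : ℝ) < β i := by
  constructor
  · intro h α β h0 hab h1 hvol
    by_contra! hcon
    set J : Fin d → Set I := fun i => {t | α i < (t : ℝ) ∧ (t : ℝ) < β i} with hJ
    have hoc : ∀ i, (J i).OrdConnected := fun i => ⟨fun a ha b hb t ht =>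
      ⟨ha.1.trans_le ht.1, lt_of_le_of_lt ht.2 hb.2⟩⟩
    have hdis : Disjoint (univ.pi J) (P : Set (Cube d)) := by
      rw [Set.disjoint_left]
      intro x hx hxP
      obtain ⟨i, hi⟩ := hcon x hxP
      exact absurd (hx i (mem_univ i)).2 (not_lt.2 (hi (hx i (mem_univ i)).1))
    have hle : volume (univ.pi J) ≤ dispersion P :=
      le_iSup_of_le J (le_iSup_of_le hoc (le_iSup_of_le hdis le_rfl))
    have hv : volume (univ.pi J) = ENNReal.ofReal (∏ i, (β i - α i)) := by
      rw [volume_pi_pi, ENNReal.ofReal_prod_of_nonneg fun i _ => by linarith [hab i]]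
      exact Finset.prod_congr rfl fun i _ =>
        volume_preimage_eq (h0 i) (h1 i) (fun t h h' => ⟨h, h'⟩) fun t ht => ⟨ht.1.le, ht.2.le⟩
    rw [hv] at hle
    have := hle.trans h
    rw [ENNReal.ofReal_le_ofReal_iff hη] at this
    linarith
  · intro h
    refine iSup_le fun J => iSup_le fun hoc => iSup_le fun hdis => ?_
    by_contra! hlt
    rw [volume_pi_pi] at hlt
    have hpos : ∏ i, volume (J i) ≠ 0 := (lt_of_le_of_lt (zero_le) hlt).ne'
    have hne : ∀ i, (J i).Nonempty := fun i => by
      rw [nonempty_iff_ne_empty]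
      intro h0
      exact Finset.prod_ne_zero_iff.1 hpos i (Finset.mem_univ i) (by rw [h0, measure_empty])
    choose α β h0 hab h1 hin hv using fun i => exists_endpoints (hoc i) (hne i)
    have hab' : ∀ i, α i < β i := fun i => lt_of_le_of_ne (hab i) fun heq =>
      Finset.prod_ne_zero_iff.1 hpos i (Finset.mem_univ i) (by rw [hv, heq]; simp)
    simp_rw [hv] at hlt
    rw [← ENNReal.ofReal_prod_of_nonneg fun i _ => by linarith [hab i],
      ENNReal.ofReal_lt_ofReal_iff_of_nonneg hη] at hlt
    obtain ⟨x, hxP, hx⟩ := h α β h0 hab' h1 hlt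
    exact Set.disjoint_left.1 hdis (fun i _ => hin i _ (hx i).1 (hx i).2) hxP

/-- In dimension zero a single point has dispersion zero. -/
theorem dispersion_zero_dim (P : Finset (Cube 0)) (hP : P.Nonempty) {η : ℝ} (hη : 0 ≤ η) :
    dispersion P ≤ ENNReal.ofReal η := by
  rw [dispersion_le_iff hη]
  intro α β _ _ _ _
  obtain ⟨x, hx⟩ := hP
  exact ⟨x, hx, fun i => i.elim0⟩

/-! ### Hitting sets -/

/-- If for every finite family a single element hits a proportion `θ` of the family, then few
elements suffice to hit all of it: choose them greedily. -/
theorem exists_finset_hitting_of_pow {Ω C : Type*} (R : C → Ω → Prop) {θ : ℝ} (hθ1 : θ ≤ 1)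
    (havg : ∀ S : Finset C, ∃ y, ∃ S' : Finset C, (∀ c ∈ S, c ∉ S' → R c y) ∧
      (S'.card : ℝ) ≤ (1 - θ) * S.card) (n : ℕ) :
    ∀ S : Finset C, (1 - θ) ^ n * S.card < 1 →
      ∃ T : Finset Ω, T.card ≤ n ∧ ∀ c ∈ S, ∃ y ∈ T, R c y := by
  classical
  induction n with
  | zero =>
    intro S hS
    have : S = ∅ := by
      rw [pow_zero, one_mul] at hS
      have : S.card < 1 := by exact_mod_cast hS
      exact Finset.card_eq_zero.1 (by omega)
    exact ⟨∅, by simp, by simp [this]⟩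
  | succ n ih =>
    intro S hS
    obtain ⟨y, S', h1, h2⟩ := havg S
    have h3 : (1 - θ) ^ n * S'.card < 1 := by
      refine lt_of_le_of_lt ?_ hS
      rw [pow_succ, mul_assoc]
      exact mul_le_mul_of_nonneg_left h2 (pow_nonneg (by linarith) n)
    obtain ⟨T, hT, hT'⟩ := ih S' h3
    refine ⟨insert y T, (Finset.card_insert_le _ _).trans (by omega), fun c hc => ?_⟩
    by_cases hcS : c ∈ S'
    · obtain ⟨y', h, h'⟩ := hT' c hcS
      exact ⟨y', Finset.mem_insert_of_mem h, h'⟩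
    · exact ⟨y, Finset.mem_insert_self _ _, h1 c hc hcS⟩

/-- With proportion `θ`, about `b / θ` elements hit all members of a family of size `exp b`. -/
theorem exists_finset_hitting {Ω C : Type*} (R : C → Ω → Prop) {θ : ℝ} (hθ0 : 0 < θ) (hθ1 : θ ≤ 1)
    (havg : ∀ S : Finset C, ∃ y, ∃ S' : Finset C, (∀ c ∈ S, c ∉ S' → R c y) ∧
      (S'.card : ℝ) ≤ (1 - θ) * S.card) (S : Finset C) {b : ℝ} (hb : 0 ≤ b)
    (hS : (S.card : ℝ) ≤ Real.exp b) :
    ∃ T : Finset Ω, (T.card : ℝ) ≤ b / θ + 1 ∧ ∀ c ∈ S, ∃ y ∈ T, R c y := by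
  have hlt : (1 - θ) ^ (⌊b / θ⌋₊ + 1) * S.card < 1 := by
    have h1 : b < θ * (⌊b / θ⌋₊ + 1 : ℕ) := by
      have := Nat.lt_floor_add_one (b / θ)
      rw [div_lt_iff₀ hθ0] at this
      push_cast
      linarith
    have h2 : (1 - θ) ^ (⌊b / θ⌋₊ + 1) ≤ Real.exp (-(θ * (⌊b / θ⌋₊ + 1 : ℕ))) := by
      calc (1 - θ) ^ (⌊b / θ⌋₊ + 1) ≤ Real.exp (-θ) ^ (⌊b / θ⌋₊ + 1) := by
            gcongr
            linarith [Real.add_one_le_exp (-θ)]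
        _ = _ := by rw [← Real.exp_nat_mul]; congr 1; ring
    calc (1 - θ) ^ (⌊b / θ⌋₊ + 1) * S.card
        ≤ Real.exp (-(θ * (⌊b / θ⌋₊ + 1 : ℕ))) * Real.exp b := by gcongr
      _ = Real.exp (-(θ * (⌊b / θ⌋₊ + 1 : ℕ)) + b) := by rw [Real.exp_add]
      _ < 1 := by rw [Real.exp_lt_one_iff]; linarith
  obtain ⟨T, hT, hT'⟩ := exists_finset_hitting_of_pow R hθ1 havg _ S hlt
  refine ⟨T, ?_, hT'⟩
  calc (T.card : ℝ) ≤ ((⌊b / θ⌋₊ + 1 : ℕ) : ℝ) := by exact_mod_cast hT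
    _ ≤ b / θ + 1 := by
      push_cast
      linarith [Nat.floor_le (div_nonneg hb hθ0.le)]

/-- Random points: a finite family of measurable sets of probability at least `θ`. -/
theorem exists_finset_hitting_of_measure {Ω C : Type*} [MeasurableSpace Ω] (μ : Measure Ω)
    [IsProbabilityMeasure μ] (B : C → Set Ω) (hB : ∀ c, MeasurableSet (B c)) {θ : ℝ}
    (hθ0 : 0 < θ) (hθ1 : θ ≤ 1) (S : Finset C) (hθ : ∀ c ∈ S, θ ≤ μ.real (B c)) {b : ℝ}
    (hb : 0 ≤ b) (hS : (S.card : ℝ) ≤ Real.exp b) :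
    ∃ T : Finset Ω, (T.card : ℝ) ≤ b / θ + 1 ∧ ∀ c ∈ S, ∃ y ∈ T, y ∈ B c := by
  classical
  obtain ⟨T, hT, h⟩ := exists_finset_hitting (C := S) (fun c y => y ∈ B c.1) hθ0 hθ1 (fun S₁ => by
    obtain ⟨y, hy⟩ := exists_integral_le (μ := μ)
      (f := fun y => ∑ c ∈ S₁, (B c.1).indicator (fun _ => (1 : ℝ)) y)
      (integrable_finsetSum _ fun c _ => (integrable_const 1).indicator (hB c.1))
    rw [integral_finsetSum _ fun c _ => (integrable_const 1).indicator (hB c.1)] at hy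
    simp only [integral_indicator_const _ (hB _), smul_eq_mul, mul_one] at hy
    refine ⟨y, S₁.filter fun c => y ∉ B c.1, fun c hc hc' => ?_, ?_⟩
    · by_contra hcon
      exact hc' (Finset.mem_filter.2 ⟨hc, hcon⟩)
    · have h1 : ∑ c ∈ S₁, (B c.1).indicator (fun _ => (1 : ℝ)) y =
          ((S₁.filter fun c => y ∈ B c.1).card : ℝ) := by
        simp only [indicator_apply]
        rw [Finset.sum_boole]
      have h2 : (S₁.card : ℝ) * θ ≤ ∑ c ∈ S₁, μ.real (B c.1) := by
        rw [← nsmul_eq_mul, ← Finset.sum_const]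
        exact Finset.sum_le_sum fun c _ => hθ c.1 c.2
      have h3 : ((S₁.filter fun c => y ∈ B c.1).card : ℝ) +
          ((S₁.filter fun c => y ∉ B c.1).card : ℝ) = S₁.card := by
        exact_mod_cast Finset.card_filter_add_card_filter_not (s := S₁) (fun c => y ∈ B c.1)
      rw [h1] at hy
      linarith) Finset.univ hb (by simpa using hS)
  exact ⟨T, hT, fun c hc => h ⟨c, hc⟩ (Finset.mem_univ _)⟩

/-! ### Point sets whose size is linear in the dimension -/

/-- The number of `w : ι → ℕ` with `∑ wᵢ ≤ s |ι|` is at most `(e (1 + s)) ^ |ι|`. -/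
theorem card_sum_le_le {ι : Type*} [Fintype ι] [DecidableEq ι] {s : ℝ} (hs : 0 < s) (m : ℕ)
    (hm : (m : ℝ) ≤ s * Fintype.card ι) :
    (((Fintype.piFinset fun _ : ι => Finset.range (m + 1)).filter fun w => ∑ i, w i ≤ m).card : ℝ) ≤
      (Real.exp 1 * (1 + s)) ^ Fintype.card ι := by
  set W := (Fintype.piFinset fun _ : ι => Finset.range (m + 1)).filter fun w => ∑ i, w i ≤ m
  set x : ℝ := s / (1 + s) with hx
  have hx0 : 0 < x := by positivity
  have hx1 : x < 1 := by rw [hx, div_lt_one (by positivity)]; linarith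
  have h1 : (W.card : ℝ) * x ^ m ≤ (1 + s) ^ Fintype.card ι := by
    calc (W.card : ℝ) * x ^ m = ∑ w ∈ W, x ^ m := by rw [Finset.sum_const, nsmul_eq_mul]
      _ ≤ ∑ w ∈ W, ∏ i, x ^ w i := by
          refine Finset.sum_le_sum fun w hw => ?_
          rw [Finset.prod_pow_eq_pow_sum]
          exact pow_le_pow_of_le_one hx0.le hx1.le (Finset.mem_filter.1 hw).2
      _ ≤ ∑ w ∈ Fintype.piFinset fun _ : ι => Finset.range (m + 1), ∏ i, x ^ w i :=
          Finset.sum_le_sum_of_subset_of_nonneg (Finset.filter_subset _ _)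
            fun _ _ _ => by positivity
      _ = ∏ _i : ι, ∑ j ∈ Finset.range (m + 1), x ^ j :=
          (Finset.prod_univ_sum (fun _ => Finset.range (m + 1)) fun _ j => x ^ j).symm
      _ ≤ ∏ _i : ι, (1 + s) := by
          refine Finset.prod_le_prod (fun _ _ => by positivity) fun _ _ => ?_
          have h2 : ∑ j ∈ Finset.range (m + 1), x ^ j ≤ ∑' j, x ^ j :=
            (summable_geometric_of_lt_one hx0.le hx1).sum_le_tsum _ fun _ _ => by positivity
          rw [tsum_geometric_of_lt_one hx0.le hx1] at h2
          refine h2.trans_eq ?_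
          rw [hx]
          field_simp
          ring
      _ = (1 + s) ^ Fintype.card ι := by simp
  have h2 : (1 : ℝ) ≤ Real.exp 1 ^ Fintype.card ι * x ^ m := by
    have h3 : 1 / x ≤ Real.exp (1 / s) := by
      have : 1 / x = 1 / s + 1 := by rw [hx]; field_simp
      rw [this]
      exact Real.add_one_le_exp _
    have h4 : (1 / x) ^ m ≤ Real.exp 1 ^ Fintype.card ι := by
      calc (1 / x) ^ m ≤ Real.exp (1 / s) ^ m := by gcongr
        _ = Real.exp (m * (1 / s)) := by rw [← Real.exp_nat_mul]
        _ ≤ Real.exp (Fintype.card ι * 1) := by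
            apply Real.exp_le_exp.2
            rw [mul_one_div, mul_one, div_le_iff₀ hs]
            linarith
        _ = _ := by rw [← Real.exp_nat_mul]
    calc (1 : ℝ) = (1 / x) ^ m * x ^ m := by rw [← mul_pow]; field_simp; simp
      _ ≤ _ := by gcongr
  calc (W.card : ℝ) = W.card * 1 := by ring
    _ ≤ W.card * (Real.exp 1 ^ Fintype.card ι * x ^ m) := by gcongr
    _ = Real.exp 1 ^ Fintype.card ι * (W.card * x ^ m) := by ring
    _ ≤ Real.exp 1 ^ Fintype.card ι * (1 + s) ^ Fintype.card ι := by gcongr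
    _ = _ := by rw [mul_pow]

/-- There are `O(d η⁻¹ (1 + ln η⁻¹))` points that meet every box of volume greater than `η`. The
boxes are shrunk to boxes with corners in a grid; since all but few sides of a large box are
almost `1`, the number of these boxes is only exponential in `d (1 + ln η⁻¹)`. -/
theorem exists_dispersion_le_linear {d : ℕ} (hd : 1 ≤ d) {η : ℝ} (h0 : 0 < η) (h1 : η < 1) :
    ∃ P : Finset (Cube d), dispersion P ≤ ENNReal.ofReal η ∧
      (P.card : ℝ) ≤ 13 * d * η⁻¹ * (1 + Real.log η⁻¹) := by
  classical
  have hd0 : (0 : ℝ) < d := by exact_mod_cast hd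
  have hd1 : (1 : ℝ) ≤ d := by exact_mod_cast hd
  have hi1 : 1 < η⁻¹ := (one_lt_inv₀ h0).2 h1
  have hlog0 : 0 < Real.log η⁻¹ := Real.log_pos hi1
  have hlog1 : Real.log η⁻¹ ≤ η⁻¹ - 1 := Real.log_le_sub_one_of_pos (by positivity)
  -- the grid has mesh size `1 / N`
  set n : ℕ := ⌈4 * η⁻¹⌉₊ with hn
  have hn1 : 4 * η⁻¹ ≤ n := Nat.le_ceil _
  have hn2 : (n : ℝ) ≤ 4 * η⁻¹ + 1 := (Nat.ceil_lt_add_one (by positivity)).le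
  set N : ℝ := d * n with hN
  have hN0 : 0 < N := by
    have : (0 : ℝ) < n := lt_of_lt_of_le (by positivity) hn1
    positivity
  set s : ℝ := 4 * η⁻¹ ^ 2 with hs
  have hs0 : 0 < s := by positivity
  set m : ℕ := ⌊s * (2 * d)⌋₊ with hm
  set W := (Fintype.piFinset fun _ : Fin d ⊕ Fin d => Finset.range (m + 1)).filter
    fun w => ∑ i, w i ≤ m with hW
  let B : (Fin d ⊕ Fin d → ℕ) → Set (Cube d) := fun w =>
    univ.pi fun i => {t : I | (w (Sum.inl i) : ℝ) / N ≤ t ∧ (t : ℝ) ≤ 1 - w (Sum.inr i) / N}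
  have hBm : ∀ w, MeasurableSet (B w) := fun w =>
    MeasurableSet.univ_pi fun i => (measurableSet_le measurable_const measurable_subtype_coe).inter
      (measurableSet_le measurable_subtype_coe measurable_const)
  set S := W.filter fun w => η / 2 ≤ (volume : Measure (Cube d)).real (B w) with hS
  have hcard : (S.card : ℝ) ≤ Real.exp (6 * d * (1 + Real.log η⁻¹)) := by
    have hc := card_sum_le_le (ι := Fin d ⊕ Fin d) hs0 m (by
      refine (Nat.floor_le (by positivity)).trans_eq ?_
      simp only [Fintype.card_sum, Fintype.card_fin]
      push_cast
      ring)
    have h2 : Real.exp 1 * (1 + s) ≤ Real.exp (3 * (1 + Real.log η⁻¹)) := by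
      have e1 : Real.exp (3 * (1 + Real.log η⁻¹)) = Real.exp 1 * (Real.exp 1 ^ 2 * η⁻¹ ^ 3) := by
        have : 3 * (1 + Real.log η⁻¹) = 1 + (2 : ℕ) * 1 + (3 : ℕ) * Real.log η⁻¹ := by
          push_cast; ring
        rw [this, Real.exp_add, Real.exp_add, Real.exp_nat_mul, Real.exp_nat_mul,
          Real.exp_log (by positivity)]
        ring
      rw [e1]
      refine mul_le_mul_of_nonneg_left ?_ (Real.exp_pos 1).le
      have he := Real.exp_one_gt_d9
      have h3 : (5 : ℝ) ≤ Real.exp 1 ^ 2 := by nlinarith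
      have h4 : 1 ≤ η⁻¹ ^ 2 := one_le_pow₀ hi1.le
      have h5 : η⁻¹ ^ 2 ≤ η⁻¹ ^ 3 := pow_le_pow_right₀ hi1.le (by norm_num)
      nlinarith
    calc (S.card : ℝ) ≤ W.card := by exact_mod_cast Finset.card_filter_le _ _
      _ ≤ (Real.exp 1 * (1 + s)) ^ Fintype.card (Fin d ⊕ Fin d) := hc
      _ ≤ Real.exp (3 * (1 + Real.log η⁻¹)) ^ Fintype.card (Fin d ⊕ Fin d) := by gcongr
      _ = Real.exp (6 * d * (1 + Real.log η⁻¹)) := by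
          rw [← Real.exp_nat_mul]
          simp only [Fintype.card_sum, Fintype.card_fin]
          push_cast
          congr 1
          ring
  obtain ⟨P, hPc, hP⟩ := exists_finset_hitting_of_measure (volume : Measure (Cube d)) B hBm
    (θ := η / 2) (by positivity) (by linarith) S (fun w hw => (Finset.mem_filter.1 hw).2)
    (by positivity) hcard
  refine ⟨P, ?_, ?_⟩
  · rw [dispersion_le_iff h0.le]
    intro α β hα hab hβ hvol
    set ℓ : Fin d → ℝ := fun i => β i - α i with hℓ
    have hℓ0 : ∀ i, 0 < ℓ i := fun i => by simp only [hℓ]; linarith [hab i]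
    have hℓ1 : ∀ i, ℓ i ≤ 1 := fun i => by simp only [hℓ]; linarith [hα i, hβ i]
    have hℓη : ∀ i, η ≤ ℓ i := fun i => by
      refine hvol.le.trans ?_
      rw [← Finset.mul_prod_erase _ _ (Finset.mem_univ i)]
      exact mul_le_of_le_one_right (hℓ0 i).le
        (Finset.prod_le_one (fun j _ => (hℓ0 j).le) fun j _ => hℓ1 j)
    -- the sides of a large box are almost `1` in the sense of this sum
    have hsum : ∑ i, (1 - ℓ i) ≤ Real.log η⁻¹ := by
      calc ∑ i, (1 - ℓ i) ≤ ∑ i, -Real.log (ℓ i) := by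
            refine Finset.sum_le_sum fun i _ => ?_
            linarith [Real.log_le_sub_one_of_pos (hℓ0 i)]
        _ = -Real.log (∏ i, ℓ i) := by
            rw [Real.log_prod fun i _ => (hℓ0 i).ne', Finset.sum_neg_distrib]
        _ ≤ Real.log η⁻¹ := by
            rw [Real.log_inv]
            linarith [Real.log_le_log h0 hvol.le]
    set w : Fin d ⊕ Fin d → ℕ :=
      Sum.elim (fun i => ⌊α i * N⌋₊ + 1) (fun i => ⌊(1 - β i) * N⌋₊ + 1) with hw
    have hl1 : ∀ i, α i < (w (Sum.inl i) : ℝ) / N := fun i => by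
      rw [lt_div_iff₀ hN0]
      simp only [hw, Sum.elim_inl]
      push_cast
      exact Nat.lt_floor_add_one _
    have hl2 : ∀ i, (w (Sum.inl i) : ℝ) / N ≤ α i + 1 / N := fun i => by
      rw [div_le_iff₀ hN0, add_mul, one_div, inv_mul_cancel₀ hN0.ne']
      simp only [hw, Sum.elim_inl]
      push_cast
      linarith [Nat.floor_le (mul_nonneg (hα i) hN0.le)]
    have hr1 : ∀ i, 1 - β i < (w (Sum.inr i) : ℝ) / N := fun i => by
      rw [lt_div_iff₀ hN0]
      simp only [hw, Sum.elim_inr]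
      push_cast
      exact Nat.lt_floor_add_one _
    have hr2 : ∀ i, (w (Sum.inr i) : ℝ) / N ≤ 1 - β i + 1 / N := fun i => by
      have hb : 0 ≤ 1 - β i := by linarith [hβ i]
      rw [div_le_iff₀ hN0, add_mul, one_div, inv_mul_cancel₀ hN0.ne']
      simp only [hw, Sum.elim_inr]
      push_cast
      linarith [Nat.floor_le (mul_nonneg hb hN0.le)]
    have hwsum : ∑ i, w i ≤ m := by
      apply Nat.le_floor
      push_cast
      rw [Fintype.sum_sum_type, ← Finset.sum_add_distrib]
      have h2 : ∀ i : Fin d, (w (Sum.inl i) : ℝ) + w (Sum.inr i) ≤ (1 - ℓ i) * N + 2 := by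
        intro i
        have e1 := hl2 i
        have e2 := hr2 i
        rw [div_le_iff₀ hN0, add_mul, one_div, inv_mul_cancel₀ hN0.ne'] at e1 e2
        simp only [hℓ]
        linarith
      calc ∑ i : Fin d, ((w (Sum.inl i) : ℝ) + w (Sum.inr i))
          ≤ ∑ i : Fin d, ((1 - ℓ i) * N + 2) := Finset.sum_le_sum fun i _ => h2 i
        _ = (∑ i, (1 - ℓ i)) * N + d * 2 := by
            rw [Finset.sum_add_distrib, Finset.sum_mul]; simp
        _ ≤ (η⁻¹ - 1) * N + d * 2 := by gcongr; exact hsum.trans hlog1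
        _ ≤ (η⁻¹ - 1) * (d * (4 * η⁻¹ + 1)) + d * 2 := by
            have : 0 ≤ η⁻¹ - 1 := by linarith
            rw [hN]
            gcongr
        _ ≤ s * (2 * d) := by
            rw [hs]
            nlinarith [mul_pos hd0 hlog0, mul_pos hd0 (by positivity : 0 < η⁻¹),
              mul_pos hd0 (mul_pos (sub_pos.2 hi1) (sub_pos.2 hi1))]
    have hwW : w ∈ W := by
      refine Finset.mem_filter.2 ⟨Fintype.mem_piFinset.2 fun i => ?_, hwsum⟩
      rw [Finset.mem_range]
      have := Finset.single_le_sum (f := w) (fun _ _ => Nat.zero_le _) (Finset.mem_univ i)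
      omega
    have hNη : 4 * d ≤ N * η := by
      rw [hN]
      have : 4 ≤ n * η := by
        calc (4 : ℝ) = 4 * η⁻¹ * η := by field_simp
          _ ≤ n * η := by gcongr
      nlinarith
    -- the sides shrink by a factor of at least `1 - 1 / (2d)`
    have hside : ∀ i, ℓ i * (1 - 1 / (2 * d)) ≤
        (1 - (w (Sum.inr i) : ℝ) / N) - w (Sum.inl i) / N := by
      intro i
      have e1 : 2 / N ≤ ℓ i * (1 / (2 * d)) := by
        rw [mul_one_div, div_le_div_iff₀ hN0 (by positivity)]
        nlinarith [hℓη i]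
      have e2 := hl2 i
      have e3 := hr2 i
      have e4 : 2 / N = 1 / N + 1 / N := by ring
      have e5 : ℓ i = β i - α i := rfl
      rw [mul_sub, mul_one]
      linarith
    have hhalf : 1 / (2 * (d : ℝ)) ≤ 1 / 2 := by
      apply one_div_le_one_div_of_le <;> linarith
    have hwS : w ∈ S := by
      refine Finset.mem_filter.2 ⟨hwW, ?_⟩
      rw [measureReal_def, volume_pi_pi]
      have hv : ∀ i, volume {t : I | (w (Sum.inl i) : ℝ) / N ≤ t ∧
          (t : ℝ) ≤ 1 - w (Sum.inr i) / N} =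
          ENNReal.ofReal ((1 - (w (Sum.inr i) : ℝ) / N) - w (Sum.inl i) / N) := fun i =>
        volume_preimage_eq (by positivity)
          (by have : (0 : ℝ) ≤ w (Sum.inr i) / N := by positivity
              linarith)
          (fun t h h' => ⟨h.le, h'.le⟩) fun t ht => ht
      have hnn : ∀ i, 0 ≤ ℓ i * (1 - 1 / (2 * d)) := fun i =>
        mul_nonneg (hℓ0 i).le (by linarith)
      simp_rw [hv]
      rw [← ENNReal.ofReal_prod_of_nonneg fun i _ => (hnn i).trans (hside i),
        ENNReal.toReal_ofReal (Finset.prod_nonneg fun i _ => (hnn i).trans (hside i))]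
      have hbern : 1 / 2 ≤ (1 - 1 / (2 * (d : ℝ))) ^ d := by
        have := one_add_mul_le_pow (a := -(1 / (2 * (d : ℝ)))) (by linarith) d
        have e : 1 + (d : ℝ) * -(1 / (2 * (d : ℝ))) = 1 / 2 := by field_simp; ring
        rw [e] at this
        simpa [sub_eq_add_neg] using this
      calc η / 2 = η * (1 / 2) := by ring
        _ ≤ (∏ i, ℓ i) * (1 - 1 / (2 * (d : ℝ))) ^ d := by
            gcongr
            exact Finset.prod_nonneg fun i _ => (hℓ0 i).le
        _ = ∏ i, (ℓ i * (1 - 1 / (2 * (d : ℝ)))) := by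
            rw [Finset.prod_mul_distrib, Finset.prod_const, Finset.card_univ, Fintype.card_fin]
        _ ≤ _ := Finset.prod_le_prod (fun i _ => hnn i) fun i _ => hside i
    obtain ⟨x, hxP, hx⟩ := hP w hwS
    refine ⟨x, hxP, fun i => ?_⟩
    have := hx i (mem_univ i)
    exact ⟨(hl1 i).trans_le this.1, lt_of_le_of_lt this.2 (by linarith [hr1 i])⟩
  · have h2 : (1 : ℝ) ≤ d * η⁻¹ * (1 + Real.log η⁻¹) := by
      have : (1 : ℝ) ≤ d * η⁻¹ := by nlinarith
      nlinarith
    refine hPc.trans ?_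
    have e : 6 * d * (1 + Real.log η⁻¹) / (η / 2) = 12 * (d * η⁻¹ * (1 + Real.log η⁻¹)) := by
      field_simp
      ring
    rw [e]
    linarith

/-! ### Random affine images of codes with large distance -/

/-- Hitting sets for the uniform distribution on a finite set. -/
theorem exists_finset_hitting_of_card {Ω C : Type*} [Fintype Ω] [Nonempty Ω] (R : C → Ω → Prop)
    [∀ c, DecidablePred (R c)] {θ : ℝ} (hθ0 : 0 < θ) (hθ1 : θ ≤ 1) (S : Finset C)
    (hθ : ∀ c ∈ S, θ * Fintype.card Ω ≤ ((Finset.univ.filter (R c)).card : ℝ)) {b : ℝ}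
    (hb : 0 ≤ b) (hS : (S.card : ℝ) ≤ Real.exp b) :
    ∃ T : Finset Ω, (T.card : ℝ) ≤ b / θ + 1 ∧ ∀ c ∈ S, ∃ y ∈ T, R c y := by
  let _ : MeasurableSpace Ω := ⊤
  have hpos : (0 : ℝ) < Fintype.card Ω := by exact_mod_cast Fintype.card_pos
  refine exists_finset_hitting_of_measure (PMF.uniformOfFintype Ω).toMeasure
    (fun c => {y | R c y}) (fun _ => trivial) hθ0 hθ1 S (fun c hc => ?_) hb hS
  have : (PMF.uniformOfFintype Ω).toMeasure.real {y | R c y} =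
      ((Finset.univ.filter (R c)).card : ℝ) / Fintype.card Ω := by
    rw [measureReal_def,
      PMF.toMeasure_uniformOfFintype_apply _ MeasurableSpace.measurableSet_top,
      ENNReal.toReal_div]
    simp [Fintype.card_subtype]
  rw [this, le_div_iff₀ hpos]
  exact hθ c hc

section SecondMoment

variable {F : Type*} [Field F] [Fintype F] [DecidableEq F]

theorem card_affine_mem (v : F) (S : Finset F) :
    (Finset.univ.filter fun p : Fˣ × F => p.1 * v + p.2 ∈ S).card = Fintype.card Fˣ * S.card := by
  rw [← Finset.card_univ, ← Finset.card_product]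
  refine Finset.card_nbij' (fun p => (p.1, p.1 * v + p.2)) (fun p => (p.1, p.2 - p.1 * v))
    ?_ ?_ ?_ ?_
  · intro p hp
    simpa using hp
  · intro p hp
    simpa using hp
  · intro p _
    simp
  · intro p _
    simp

theorem card_affine_mem_mem_le {v v' : F} (h : v ≠ v') (S : Finset F) :
    (Finset.univ.filter fun p : Fˣ × F => p.1 * v + p.2 ∈ S ∧ p.1 * v' + p.2 ∈ S).card ≤
      S.offDiag.card := by
  refine Finset.card_le_card_of_injOn (fun p => (p.1 * v + p.2, p.1 * v' + p.2)) ?_ ?_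
  · intro p hp
    simp only [Finset.coe_filter, Finset.mem_univ, true_and, mem_ofPred_eq] at hp
    simp only [Finset.mem_coe, Finset.mem_offDiag]
    refine ⟨hp.1, hp.2, fun he => h ?_⟩
    exact mul_left_cancel₀ p.1.ne_zero (add_right_cancel he)
  · rintro ⟨a, t⟩ _ ⟨a', t'⟩ _ he
    simp only [Prod.mk.injEq] at he
    have h1 : (a : F) * (v - v') = a' * (v - v') := by linear_combination he.1 - he.2
    have h2 : (a : F) = a' := mul_right_cancel₀ (sub_ne_zero.2 h) h1
    have h3 : t = t' := by
      have := he.1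
      rw [h2] at this
      exact add_left_cancel this
    exact Prod.ext (Units.ext h2) h3

/-- In a code in which `κ` coordinates determine a word, at most `q ^ (κ - |A|)` words other than
`v` agree with `v` on `A`. -/
theorem card_agree_le {d κ : ℕ} {C : Finset (Fin d → F)} (hκ : κ ≤ d)
    (hC : ∀ v ∈ C, ∀ v' ∈ C, ∀ A : Finset (Fin d), κ ≤ A.card → (∀ i ∈ A, v i = v' i) → v = v')
    {v : Fin d → F} (hv : v ∈ C) (A : Finset (Fin d)) :
    ((C.filter fun v' => v' ≠ v ∧ ∀ i ∈ A, v' i = v i).card : ℝ) ≤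
      (Fintype.card F : ℝ) ^ κ * ((Fintype.card F : ℝ) ^ A.card)⁻¹ := by
  have hq : (0 : ℝ) < Fintype.card F := by exact_mod_cast Fintype.card_pos
  rcases le_or_gt κ A.card with h | h
  · have : (C.filter fun v' => v' ≠ v ∧ ∀ i ∈ A, v' i = v i) = ∅ := by
      refine Finset.filter_eq_empty_iff.2 fun v' hv' h' => h'.1 ?_
      exact hC v' hv' v hv A h h'.2
    rw [this]
    simp only [Finset.card_empty, Nat.cast_zero]
    positivity
  · obtain ⟨B, hAB, -, hB⟩ := Finset.exists_subsuperset_card_eq (Finset.subset_univ A) h.le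
      (by simpa using hκ)
    have h1 : (C.filter fun v' => v' ≠ v ∧ ∀ i ∈ A, v' i = v i).card ≤
        (Finset.univ : Finset (↥(B \ A) → F)).card := by
      refine Finset.card_le_card_of_injOn (fun v' i => v' i) (fun _ _ => Finset.mem_univ _) ?_
      intro v₁ h₁ v₂ h₂ he
      simp only [Finset.coe_filter, mem_ofPred_eq] at h₁ h₂
      refine hC v₁ h₁.1 v₂ h₂.1 B hB.ge fun i hi => ?_
      by_cases hiA : i ∈ A
      · rw [h₁.2.2 i hiA, h₂.2.2 i hiA]
      · exact congrFun he ⟨i, Finset.mem_sdiff.2 ⟨hi, hiA⟩⟩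
    rw [Finset.card_univ, Fintype.card_fun, Fintype.card_coe, Finset.card_sdiff_of_subset hAB,
      hB] at h1
    calc _ ≤ ((Fintype.card F ^ (κ - A.card) : ℕ) : ℝ) := by exact_mod_cast h1
      _ = (Fintype.card F : ℝ) ^ κ * ((Fintype.card F : ℝ) ^ A.card)⁻¹ := by
        push_cast
        rw [pow_sub₀ _ hq.ne' h.le]

/-- Second moment method: if `κ` coordinates determine a word of the code `C`, and on average a
random coordinatewise affine image of `C` has at least one word in the box `∏ Sᵢ`, then this image
meets the box with probability at least `2 ^ (-d - 1)`. -/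
theorem card_affine_hits_ge {d κ : ℕ} {C : Finset (Fin d → F)} (hκ : κ ≤ d)
    (hcard : C.card = Fintype.card F ^ κ)
    (hC : ∀ v ∈ C, ∀ v' ∈ C, ∀ A : Finset (Fin d), κ ≤ A.card → (∀ i ∈ A, v i = v' i) → v = v')
    {S : Fin d → Finset F} (hS : ∀ i, (S i).Nonempty)
    (hW : 1 ≤ (Fintype.card F : ℝ) ^ κ * ∏ i, (((S i).card : ℝ) / Fintype.card F)) :
    (1 / 2 : ℝ) ^ (d + 1) * Fintype.card (Fin d → Fˣ × F) ≤
      ((Finset.univ.filter fun y : Fin d → Fˣ × F =>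
        ∃ v ∈ C, ∀ i, (y i).1 * v i + (y i).2 ∈ S i).card : ℝ) := by
  set q : ℝ := (Fintype.card F : ℝ) with hq
  have hq1 : 1 < q := by rw [hq]; exact_mod_cast Fintype.one_lt_card (α := F)
  have hq0 : 0 < q := by linarith
  have hunits : (Fintype.card Fˣ : ℝ) = q - 1 := by
    rw [Fintype.card_units, Nat.cast_sub Fintype.card_pos, Nat.cast_one]
  set Q : ℝ := (q - 1) * q with hQ
  have hQ0 : 0 < Q := mul_pos (by linarith) hq0
  set τ : Fin d → ℝ := fun i => ((S i).card : ℝ) / q with hτ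
  have hs1 : ∀ i, (1 : ℝ) ≤ (S i).card := fun i => by exact_mod_cast (hS i).card_pos
  have hsq : ∀ i, ((S i).card : ℝ) ≤ q := fun i => by
    rw [hq]; exact_mod_cast Finset.card_le_univ (S i)
  have hτ0 : ∀ i, 0 < τ i := fun i => div_pos (by linarith [hs1 i]) hq0
  set W : ℝ := q ^ κ * ∏ i, τ i with hWd
  set hit : (Fin d → F) → (Fin d → Fˣ × F) → Prop :=
    fun v y => ∀ i, (y i).1 * v i + (y i).2 ∈ S i with hhit
  set N : (Fin d → Fˣ × F) → ℝ := fun y => ∑ v ∈ C, if hit v y then (1 : ℝ) else 0 with hN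
  have hΩ : (Fintype.card (Fin d → Fˣ × F) : ℝ) = Q ^ d := by
    rw [Fintype.card_fun, Fintype.card_prod, Fintype.card_fin]
    push_cast
    rw [hunits]
  -- the first moment
  have hfirst : ∑ y, N y = Q ^ d * W := by
    simp only [hN]
    rw [Finset.sum_comm]
    have h1 : ∀ v ∈ C, ∑ y, (if hit v y then (1 : ℝ) else 0) = Q ^ d * ∏ i, τ i := by
      intro v _
      rw [Finset.sum_boole]
      have : (Finset.univ.filter fun y => hit v y) = Fintype.piFinset fun i =>
          Finset.univ.filter fun p : Fˣ × F => p.1 * v i + p.2 ∈ S i := by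
        ext y
        simp [hhit, Fintype.mem_piFinset]
      rw [this, Fintype.card_piFinset]
      push_cast
      simp only [card_affine_mem]
      push_cast
      rw [hunits]
      have h2 : ∀ i, (q - 1) * ((S i).card : ℝ) = Q * τ i := fun i => by
        simp only [hQ, hτ]; field_simp
      simp only [h2]
      rw [Finset.prod_mul_distrib, Finset.prod_const, Finset.card_univ, Fintype.card_fin]
    rw [Finset.sum_congr rfl h1, Finset.sum_const, nsmul_eq_mul, hcard]
    push_cast
    rw [hWd]
    ring
  -- pairs of words
  have hpair : ∀ v v' : Fin d → F, ∑ y, (if hit v y ∧ hit v' y then (1 : ℝ) else 0) ≤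
      Q ^ d * ((∏ i, τ i ^ 2) * ∏ i ∈ Finset.univ.filter (fun i => v' i = v i), (τ i)⁻¹) := by
    intro v v'
    rw [Finset.sum_boole]
    have : (Finset.univ.filter fun y => hit v y ∧ hit v' y) = Fintype.piFinset fun i =>
        Finset.univ.filter fun p : Fˣ × F => p.1 * v i + p.2 ∈ S i ∧ p.1 * v' i + p.2 ∈ S i := by
      ext y
      simp [hhit, Fintype.mem_piFinset, forall_and]
    rw [this, Fintype.card_piFinset]
    push_cast
    have h2 : ∀ i, ((Finset.univ.filter fun p : Fˣ × F => p.1 * v i + p.2 ∈ S i ∧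
        p.1 * v' i + p.2 ∈ S i).card : ℝ) ≤ Q * (τ i ^ 2 * if v' i = v i then (τ i)⁻¹ else 1) := by
      intro i
      split_ifs with he
      · simp only [he, and_self]
        rw [card_affine_mem]
        push_cast
        rw [hunits]
        have : τ i ^ 2 * (τ i)⁻¹ = τ i := by have := (hτ0 i).ne'; field_simp
        rw [this]
        simp only [hQ, hτ]
        apply le_of_eq
        field_simp
      · refine le_trans (b := ((S i).offDiag.card : ℝ)) ?_ ?_
        · exact_mod_cast card_affine_mem_mem_le (Ne.symm he) (S i)
        · rw [Finset.offDiag_card, Nat.cast_sub (Nat.le_mul_self _)]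
          push_cast
          have h3 : Q * (τ i ^ 2 * 1) = (q - 1) * ((S i).card : ℝ) ^ 2 / q := by
            simp only [hQ, hτ]; field_simp
          rw [h3, le_div_iff₀ hq0]
          nlinarith [hs1 i, hsq i]
    refine (Finset.prod_le_prod (fun _ _ => Nat.cast_nonneg _) fun i _ => h2 i).trans_eq ?_
    rw [Finset.prod_mul_distrib, Finset.prod_const, Finset.card_univ, Fintype.card_fin,
      Finset.prod_mul_distrib, ← Finset.prod_filter]
  -- the words that agree with a given word in some coordinates
  have hagree : ∀ v ∈ C, ∑ v' ∈ C.filter (fun v' => v' ≠ v),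
      ∏ i ∈ Finset.univ.filter (fun i => v' i = v i), (τ i)⁻¹ ≤ q ^ κ * 2 ^ d := by
    intro v hv
    calc ∑ v' ∈ C.filter (fun v' => v' ≠ v),
          ∏ i ∈ Finset.univ.filter (fun i => v' i = v i), (τ i)⁻¹
        ≤ ∑ v' ∈ C.filter (fun v' => v' ≠ v), ∑ A : Finset (Fin d),
            if (∀ i ∈ A, v' i = v i) then ∏ i ∈ A, (τ i)⁻¹ else 0 := by
          refine Finset.sum_le_sum fun v' _ => ?_
          have hnn : ∀ A ∈ (Finset.univ : Finset (Finset (Fin d))),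
              0 ≤ (if (∀ i ∈ A, v' i = v i) then ∏ i ∈ A, (τ i)⁻¹ else 0) := fun A _ => by
            split_ifs
            · exact Finset.prod_nonneg fun i _ => (inv_pos.2 (hτ0 i)).le
            · exact le_rfl
          have := Finset.single_le_sum hnn
            (Finset.mem_univ (Finset.univ.filter fun i => v' i = v i))
          rwa [if_pos (by simp)] at this
      _ = ∑ A : Finset (Fin d), ((C.filter fun v' => v' ≠ v ∧ ∀ i ∈ A, v' i = v i).card : ℝ) *
            ∏ i ∈ A, (τ i)⁻¹ := by
          rw [Finset.sum_comm]
          refine Finset.sum_congr rfl fun A _ => ?_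
          rw [← Finset.sum_filter, Finset.sum_const, nsmul_eq_mul, Finset.filter_filter]
      _ ≤ ∑ _A : Finset (Fin d), q ^ κ := by
          refine Finset.sum_le_sum fun A _ => ?_
          calc _ ≤ (q ^ κ * (q ^ A.card)⁻¹) * ∏ i ∈ A, (τ i)⁻¹ :=
                mul_le_mul_of_nonneg_right (card_agree_le hκ hC hv A)
                  (Finset.prod_nonneg fun i _ => (inv_pos.2 (hτ0 i)).le)
            _ = q ^ κ * ∏ i ∈ A, ((S i).card : ℝ)⁻¹ := by
                rw [mul_assoc, ← inv_pow, ← Finset.prod_const, ← Finset.prod_mul_distrib]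
                congr 1
                refine Finset.prod_congr rfl fun i _ => ?_
                simp only [hτ]
                have := hs1 i
                field_simp
            _ ≤ q ^ κ * 1 := by
                refine mul_le_mul_of_nonneg_left (Finset.prod_le_one
                  (fun i _ => inv_nonneg.2 (by linarith [hs1 i])) fun i _ =>
                  inv_le_one_of_one_le₀ (hs1 i)) (by positivity)
            _ = q ^ κ := mul_one _
      _ = q ^ κ * 2 ^ d := by
          rw [Finset.sum_const, Finset.card_univ, Fintype.card_finset, Fintype.card_fin,
            nsmul_eq_mul]
          push_cast
          ring
  -- the second moment
  have hsecond : ∑ y, N y ^ 2 ≤ Q ^ d * (2 ^ (d + 1) * W ^ 2) := by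
    have h1 : ∀ y, N y ^ 2 = ∑ v ∈ C, ∑ v' ∈ C, if hit v y ∧ hit v' y then (1 : ℝ) else 0 := by
      intro y
      rw [sq, hN, Finset.sum_mul_sum]
      refine Finset.sum_congr rfl fun v _ => Finset.sum_congr rfl fun v' _ => ?_
      by_cases h : hit v y <;> by_cases h' : hit v' y <;> simp [h, h']
    have hτ2 : ∏ i, τ i ^ 2 = (∏ i, τ i) ^ 2 := Finset.prod_pow _ _ _
    have hdiag : ∀ v : Fin d → F,
        (∏ i, τ i ^ 2) * ∏ i ∈ Finset.univ.filter (fun i => v i = v i), (τ i)⁻¹ = ∏ i, τ i := by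
      intro v
      rw [Finset.filter_true_of_mem fun _ _ => rfl, ← Finset.prod_mul_distrib]
      refine Finset.prod_congr rfl fun i _ => ?_
      have := (hτ0 i).ne'
      field_simp
    calc ∑ y, N y ^ 2 = ∑ v ∈ C, ∑ v' ∈ C, ∑ y, (if hit v y ∧ hit v' y then (1 : ℝ) else 0) := by
          simp only [h1]
          rw [Finset.sum_comm]
          exact Finset.sum_congr rfl fun v _ => Finset.sum_comm
      _ ≤ ∑ v ∈ C, ∑ v' ∈ C, Q ^ d * ((∏ i, τ i ^ 2) *
            ∏ i ∈ Finset.univ.filter (fun i => v' i = v i), (τ i)⁻¹) :=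
          Finset.sum_le_sum fun v _ => Finset.sum_le_sum fun v' _ => hpair v v'
      _ = ∑ v ∈ C, Q ^ d * (∏ i, τ i + (∏ i, τ i) ^ 2 * ∑ v' ∈ C.filter (fun v' => v' ≠ v),
            ∏ i ∈ Finset.univ.filter (fun i => v' i = v i), (τ i)⁻¹) := by
          refine Finset.sum_congr rfl fun v hv => ?_
          rw [← Finset.mul_sum, ← Finset.add_sum_erase _ _ hv, hdiag v, Finset.filter_ne', hτ2,
            Finset.mul_sum]
      _ ≤ ∑ _v ∈ C, Q ^ d * (∏ i, τ i + (∏ i, τ i) ^ 2 * (q ^ κ * 2 ^ d)) := by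
          refine Finset.sum_le_sum fun v hv => ?_
          have := hagree v hv
          gcongr
      _ = Q ^ d * (W + 2 ^ d * W ^ 2) := by
          rw [Finset.sum_const, nsmul_eq_mul, hcard, hWd]
          push_cast
          ring
      _ ≤ Q ^ d * (2 ^ (d + 1) * W ^ 2) := by
          have h2 : (1 : ℝ) ≤ 2 ^ d := one_le_pow₀ (by norm_num)
          have h3 : W ≤ W ^ 2 := le_self_pow₀ hW (by norm_num)
          have h4 : W ^ 2 ≤ 2 ^ d * W ^ 2 := le_mul_of_one_le_left (by positivity) h2
          have h5 : (2 : ℝ) ^ (d + 1) * W ^ 2 = 2 ^ d * W ^ 2 + 2 ^ d * W ^ 2 := by ring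
          rw [h5]
          gcongr
          linarith
  set H := Finset.univ.filter fun y : Fin d → Fˣ × F => ∃ v ∈ C, hit v y with hH
  have hsub : ∑ y, N y = ∑ y ∈ H, N y := by
    refine (Finset.sum_subset (Finset.subset_univ H) fun y _ hy => ?_).symm
    refine Finset.sum_eq_zero fun v hv => ?_
    rw [if_neg fun h => hy (Finset.mem_filter.2 ⟨Finset.mem_univ y, v, hv, h⟩)]
  have hcs : (Q ^ d * W) ^ 2 ≤ H.card * (Q ^ d * (2 ^ (d + 1) * W ^ 2)) := by
    rw [← hfirst, hsub]
    refine (sq_sum_le_card_mul_sum_sq (s := H) (f := N)).trans ?_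
    gcongr
    exact (Finset.sum_le_sum_of_subset_of_nonneg (Finset.subset_univ H)
      fun _ _ _ => sq_nonneg _).trans hsecond
  have hW0 : 0 < W := by linarith
  have hfac : (Q ^ d * W ^ 2) * Q ^ d ≤ (Q ^ d * W ^ 2) * (H.card * 2 ^ (d + 1)) := by
    calc _ = (Q ^ d * W) ^ 2 := by ring
      _ ≤ _ := hcs
      _ = _ := by ring
  have hfin := le_of_mul_le_mul_left hfac (by positivity)
  rw [hΩ, div_pow, one_pow, div_mul_eq_mul_div, one_mul, div_le_iff₀ (by positivity)]
  exact hfin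

end SecondMoment

/-! ### Taylor digits of polynomials -/

open Polynomial in
/-- The polynomial of degree less than `κ` with the given coefficients. -/
def polyOf {F : Type*} [Field F] (κ : ℕ) (c : Fin κ → F) : F[X] :=
  ((degreeLTEquiv F κ).symm c : F[X])

section Polynomials

open Polynomial

variable {F : Type*} [Field F]

theorem degree_polyOf_lt (κ : ℕ) (c : Fin κ → F) : (polyOf κ c).degree < κ :=
  mem_degreeLT.1 ((degreeLTEquiv F κ).symm c).2

theorem polyOf_injective (κ : ℕ) : Function.Injective (polyOf (F := F) κ) := fun _ _ h =>
  (degreeLTEquiv F κ).symm.injective (Subtype.ext h)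

theorem exists_polyOf_eq {κ : ℕ} {f : F[X]} (hf : f.degree < κ) : ∃ c, polyOf κ c = f :=
  ⟨degreeLTEquiv F κ ⟨f, mem_degreeLT.2 hf⟩, by simp [polyOf]⟩

/-- The `j`-th Taylor coefficient of `f` at the `i`-th point. -/
def taylorDigit {d : ℕ} (α : Fin d → F) (i : Fin d) (j : ℕ) (f : F[X]) : F :=
  (taylor (α i) f).coeff j

/-- The polynomial that vanishes to order `K i` at the `i`-th point. -/
def vanishPoly {d : ℕ} (α : Fin d → F) (K : Fin d → ℕ) : F[X] := ∏ i, (X - C (α i)) ^ K i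

/-- The first Taylor coefficient of `vanishPoly α K` at the `i`-th point that may be nonzero. -/
def leadingDigit {d : ℕ} (α : Fin d → F) (K : Fin d → ℕ) (i : Fin d) : F :=
  ∏ j ∈ Finset.univ.erase i, (α i - α j) ^ K j

variable {d : ℕ} {α : Fin d → F}

theorem taylorDigit_add (i : Fin d) (j : ℕ) (f g : F[X]) :
    taylorDigit α i j (f + g) = taylorDigit α i j f + taylorDigit α i j g := by
  simp [taylorDigit]

theorem leadingDigit_ne_zero (hα : Function.Injective α) (K : Fin d → ℕ) (i : Fin d) :
    leadingDigit α K i ≠ 0 := by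
  refine Finset.prod_ne_zero_iff.2 fun j hj => pow_ne_zero _ (sub_ne_zero.2 fun h => ?_)
  exact Finset.ne_of_mem_erase hj (hα h).symm

theorem taylor_vanishPoly_mul (K : Fin d → ℕ) (g : F[X]) (i : Fin d) :
    taylor (α i) (vanishPoly α K * g) = X ^ K i *
      taylor (α i) ((∏ j ∈ Finset.univ.erase i, (X - C (α j)) ^ K j) * g) := by
  rw [vanishPoly, ← Finset.mul_prod_erase _ _ (Finset.mem_univ i), mul_assoc, taylor_mul]
  congr 1
  rw [taylor_pow]
  simp

theorem taylorDigit_vanishPoly_mul_of_lt (K : Fin d → ℕ) (g : F[X]) {i : Fin d} {j : ℕ}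
    (hj : j < K i) : taylorDigit α i j (vanishPoly α K * g) = 0 := by
  rw [taylorDigit, taylor_vanishPoly_mul, coeff_X_pow_mul', if_neg (not_le.2 hj)]

theorem taylorDigit_vanishPoly_mul_self (K : Fin d → ℕ) (g : F[X]) (i : Fin d) :
    taylorDigit α i (K i) (vanishPoly α K * g) = leadingDigit α K i * g.eval (α i) := by
  rw [taylorDigit, taylor_vanishPoly_mul, coeff_X_pow_mul', if_pos le_rfl, Nat.sub_self,
    taylor_coeff_zero, eval_mul, eval_prod, leadingDigit]
  simp

theorem degree_vanishPoly (K : Fin d → ℕ) : (vanishPoly α K).degree = (∑ i, K i : ℕ) := by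
  simp [vanishPoly, degree_prod, degree_pow, degree_X_sub_C]

theorem taylorDigit_C_mul (i : Fin d) (j : ℕ) (t : F) (f : F[X]) :
    taylorDigit α i j (C t * f) = t * taylorDigit α i j f := by
  simp [taylorDigit, taylor_mul]

/-- Hermite interpolation. -/
theorem exists_hermite (hα : Function.Injective α) (c : Fin d → ℕ → F) (n : ℕ) :
    ∀ K : Fin d → ℕ, ∑ i, K i = n → ∃ f : F[X], f.degree < (n : WithBot ℕ) ∧
      ∀ i, ∀ j < K i, taylorDigit α i j f = c i j := by
  induction n with
  | zero =>
    intro K hK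
    refine ⟨0, by simp, fun i j hj => ?_⟩
    have := Finset.sum_eq_zero_iff.1 hK i (Finset.mem_univ i)
    omega
  | succ n ih =>
    intro K hK
    obtain ⟨i, hi⟩ : ∃ i, 0 < K i := by
      by_contra! hcon
      rw [Finset.sum_eq_zero fun i _ => Nat.le_zero.1 (hcon i)] at hK
      omega
    set K' : Fin d → ℕ := Function.update K i (K i - 1) with hK'
    have hK'i : K' i = K i - 1 := by simp [hK']
    have hK'j : ∀ j, j ≠ i → K' j = K j := fun j hj => by simp [hK', hj]
    have hsum : ∑ j, K' j = n := by
      have h1 : K i + ∑ j ∈ Finset.univ.erase i, K j = ∑ j, K j :=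
        Finset.add_sum_erase Finset.univ K (Finset.mem_univ i)
      have h2 : K' i + ∑ j ∈ Finset.univ.erase i, K' j = ∑ j, K' j :=
        Finset.add_sum_erase Finset.univ K' (Finset.mem_univ i)
      have h3 : ∑ j ∈ Finset.univ.erase i, K' j = ∑ j ∈ Finset.univ.erase i, K j :=
        Finset.sum_congr rfl fun j hj => hK'j j (Finset.ne_of_mem_erase hj)
      omega
    obtain ⟨f, hf, hfd⟩ := ih K' hsum
    set t : F := (c i (K' i) - taylorDigit α i (K' i) f) / leadingDigit α K' i with ht
    refine ⟨f + C t * (vanishPoly α K' * 1), ?_, fun l j hj => ?_⟩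
    · have h1 : (n : WithBot ℕ) < (n + 1 : ℕ) := by exact_mod_cast n.lt_succ_self
      refine (degree_add_le _ _).trans_lt (max_lt (hf.trans h1) ?_)
      refine lt_of_le_of_lt (degree_mul_le _ _) ?_
      rw [mul_one, degree_vanishPoly, hsum]
      exact lt_of_le_of_lt (add_le_add_left degree_C_le _) (by rwa [zero_add])
    · rw [taylorDigit_add, taylorDigit_C_mul]
      by_cases hlj : l = i ∧ j = K' i
      · obtain ⟨rfl, rfl⟩ := hlj
        rw [taylorDigit_vanishPoly_mul_self, eval_one, mul_one, ht,
          div_mul_cancel₀ _ (leadingDigit_ne_zero hα K' l)]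
        ring
      · have hj' : j < K' l := by
          by_cases hl : l = i
          · subst hl
            have : j ≠ K' l := fun h => hlj ⟨rfl, h⟩
            omega
          · rwa [hK'j l hl]
        rw [taylorDigit_vanishPoly_mul_of_lt K' _ hj', mul_zero, add_zero, hfd l j hj']

/-- Division by the polynomial with the zeros `β₁, …, β_d`. -/
theorem exists_eq_interpolate_add {β : Fin d → F} (hβ : Function.Injective β) {M : ℕ} {f : F[X]}
    (hf : f.degree < ((M + d : ℕ) : WithBot ℕ)) : ∃ c : Fin M → F,
      f = Lagrange.interpolate Finset.univ β (fun l => f.eval (β l)) +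
        Lagrange.nodal Finset.univ β * polyOf M c := by
  classical
  set B := Lagrange.nodal Finset.univ β with hB
  have hmon : B.Monic := Lagrange.nodal_monic
  have hdeg : B.degree = (d : WithBot ℕ) := by rw [hB, Lagrange.degree_nodal]; simp
  have hmod : f %ₘ B = Lagrange.interpolate Finset.univ β (fun l => f.eval (β l)) := by
    refine Lagrange.eq_interpolate_of_eval_eq _ hβ.injOn ?_ fun l _ => ?_
    · rw [Finset.card_univ, Fintype.card_fin, ← hdeg]
      exact degree_modByMonic_lt f hmon
    · have h1 := congrArg (eval (β l)) (modByMonic_add_div f B)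
      rw [eval_add, eval_mul, Lagrange.eval_nodal_at_node (Finset.mem_univ l), zero_mul,
        add_zero] at h1
      exact h1
  obtain ⟨c, hc⟩ := exists_polyOf_eq (κ := M) (f := f /ₘ B) (by
    by_cases h0 : f /ₘ B = 0
    · rw [h0, degree_zero]; exact WithBot.bot_lt_coe M
    · have h1 : B.degree ≤ f.degree := by
        by_contra hlt
        exact h0 ((divByMonic_eq_zero_iff hmon).2 (not_le.1 hlt))
      have h2 := degree_add_divByMonic hmon h1
      rw [hdeg] at h2
      rw [← h2, degree_eq_natDegree h0] at hf
      rw [degree_eq_natDegree h0]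
      have h3 : d + (f /ₘ B).natDegree < M + d := by exact_mod_cast hf
      have h4 : (f /ₘ B).natDegree < M := by omega
      exact_mod_cast h4)
  refine ⟨c, ?_⟩
  rw [← hmod, hc]
  exact (modByMonic_add_div f B).symm

end Polynomials

/-- The values at the points `αᵢ` of the polynomial of degree less than `d` that takes the value
`hₗ` at `βₗ`. -/
def transfer {F : Type*} [Field F] {d : ℕ} (α β : Fin d → F) (h : Fin d → F) (i : Fin d) : F :=
  (Lagrange.interpolate Finset.univ β h).eval (α i)

theorem transfer_injective {F : Type*} [Field F] {d : ℕ} {α β : Fin d → F}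
    (hα : Function.Injective α) (hβ : Function.Injective β) :
    Function.Injective (transfer α β) := by
  intro h h' he
  have h1 : Lagrange.interpolate Finset.univ β h = Lagrange.interpolate Finset.univ β h' := by
    refine Polynomial.eq_of_degrees_lt_of_eval_index_eq Finset.univ (v := α) hα.injOn
      (Lagrange.degree_interpolate_lt _ hβ.injOn) (Lagrange.degree_interpolate_lt _ hβ.injOn)
      fun i _ => congrFun he i
  ext l
  rw [← Lagrange.eval_interpolate_at_node h hβ.injOn (Finset.mem_univ l), h1,
    Lagrange.eval_interpolate_at_node h' hβ.injOn (Finset.mem_univ l)]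

section Scales

open Polynomial

variable {F : Type*} [Field F] [Fintype F] [DecidableEq F] {d : ℕ}

open Classical in
/-- The scales `a` for which a random translate of the code of all words `(aᵢ wᵢ g(αᵢ))ᵢ`,
`deg g < κ`, meets the box `∏ Sᵢ` with a probability that is not too small. -/
def IsGoodScale (α : Fin d → F) (κ : ℕ) (w : Fin d → Fˣ) (S : Fin d → Finset F)
    (a : Fin d → Fˣ) : Prop :=
  (1 / 2 : ℝ) ^ (d + 2) * Fintype.card (Fin d → F) ≤
    ((Finset.univ.filter fun t : Fin d → F => ∃ c : Fin κ → F,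
      ∀ i, (a i : F) * (w i * (polyOf κ c).eval (α i)) + t i ∈ S i).card : ℝ)

open Classical in
/-- Polynomials of degree less than `κ` are determined by `κ` values, so the second moment method
applies to the code of their values. -/
theorem card_isGoodScale_ge {α : Fin d → F} (hα : Function.Injective α) {κ : ℕ} (hκ : κ ≤ d)
    (w : Fin d → Fˣ) {S : Fin d → Finset F} (hS : ∀ i, (S i).Nonempty)
    (hW : 1 ≤ (Fintype.card F : ℝ) ^ κ * ∏ i, (((S i).card : ℝ) / Fintype.card F)) :
    (1 / 2 : ℝ) ^ (d + 2) * Fintype.card (Fin d → Fˣ) ≤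
      ((Finset.univ.filter fun a => IsGoodScale α κ w S a).card : ℝ) := by
  set word : (Fin κ → F) → Fin d → F := fun c i => w i * (polyOf κ c).eval (α i) with hword
  have hdet : ∀ c c' : Fin κ → F, ∀ A : Finset (Fin d), κ ≤ A.card →
      (∀ i ∈ A, word c i = word c' i) → c = c' := by
    intro c c' A hA h
    apply polyOf_injective κ
    refine eq_of_degrees_lt_of_eval_index_eq A (v := α) hα.injOn ?_ ?_ fun i hi => ?_
    · exact (degree_polyOf_lt κ c).trans_le (by exact_mod_cast hA)
    · exact (degree_polyOf_lt κ c').trans_le (by exact_mod_cast hA)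
    · exact mul_left_cancel₀ (w i).ne_zero (h i hi)
  set C : Finset (Fin d → F) := Finset.univ.image word with hC
  have hcard : C.card = Fintype.card F ^ κ := by
    rw [hC, Finset.card_image_of_injective, Finset.card_univ, Fintype.card_fun, Fintype.card_fin]
    intro c c' h
    exact hdet c c' Finset.univ (by simpa using hκ) fun i _ => congrFun h i
  have hhits := card_affine_hits_ge hκ hcard (fun v hv v' hv' A hA h => by
    obtain ⟨c, -, rfl⟩ := Finset.mem_image.1 hv
    obtain ⟨c', -, rfl⟩ := Finset.mem_image.1 hv'
    rw [hdet c c' A hA h]) hS hW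
  set hit : (Fin d → Fˣ) → (Fin d → F) → Prop :=
    fun a t => ∃ c : Fin κ → F, ∀ i, (a i : F) * (w i * (polyOf κ c).eval (α i)) + t i ∈ S i
    with hhit
  set G := Finset.univ.filter fun a => IsGoodScale α κ w S a with hG
  set n : (Fin d → Fˣ) → ℝ := fun a => ((Finset.univ.filter fun t => hit a t).card : ℝ) with hn
  have hsum : ((Finset.univ.filter fun y : Fin d → Fˣ × F =>
      ∃ v ∈ C, ∀ i, (y i).1 * v i + (y i).2 ∈ S i).card : ℝ) = ∑ a, n a := by
    have h1 : (Finset.univ.filter fun y : Fin d → Fˣ × F =>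
        ∃ v ∈ C, ∀ i, (y i).1 * v i + (y i).2 ∈ S i).card =
        (Finset.univ.filter fun p : (Fin d → Fˣ) × (Fin d → F) => hit p.1 p.2).card := by
      refine Finset.card_nbij' (fun y => (fun i => (y i).1, fun i => (y i).2))
        (fun p i => (p.1 i, p.2 i)) ?_ ?_ (fun _ _ => rfl) (fun _ _ => rfl)
      · intro y hy
        simpa [hhit, hC, hword] using hy
      · intro p hp
        simpa [hhit, hC, hword] using hp
    rw [h1, Finset.card_filter, Fintype.sum_prod_type]
    push_cast
    refine Finset.sum_congr rfl fun a _ => ?_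
    simp only [hn]
    rw [Finset.card_filter]
    push_cast
    rfl
  rw [hsum] at hhits
  set T : ℝ := (Fintype.card (Fin d → F) : ℝ) with hT
  have hT0 : 0 < T := by rw [hT]; exact_mod_cast Fintype.card_pos
  have hprod : (Fintype.card (Fin d → Fˣ × F) : ℝ) = Fintype.card (Fin d → Fˣ) * T := by
    rw [hT]
    simp only [Fintype.card_fun, Fintype.card_prod]
    push_cast
    rw [mul_pow]
  have hle : ∑ a, n a ≤ G.card * T + Fintype.card (Fin d → Fˣ) * ((1 / 2) ^ (d + 2) * T) := by
    have h1 : ∀ a, n a ≤ (if a ∈ G then T else 0) + (1 / 2) ^ (d + 2) * T := by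
      intro a
      split_ifs with h
      · have : n a ≤ T := by
          simp only [hn, hT]
          exact_mod_cast Finset.card_le_univ _
        have : 0 ≤ (1 / 2 : ℝ) ^ (d + 2) * T := by positivity
        linarith
      · rw [zero_add]
        by_contra hlt
        exact h (Finset.mem_filter.2 ⟨Finset.mem_univ a, (not_le.1 hlt).le⟩)
    calc ∑ a, n a ≤ ∑ a, ((if a ∈ G then T else 0) + (1 / 2) ^ (d + 2) * T) :=
          Finset.sum_le_sum fun a _ => h1 a
      _ = _ := by
        rw [Finset.sum_add_distrib, Finset.sum_ite_mem, Finset.univ_inter, Finset.sum_const,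
          Finset.sum_const, nsmul_eq_mul, nsmul_eq_mul, Finset.card_univ]
  rw [hprod] at hhits
  have h2 : ((1 / 2 : ℝ) ^ (d + 2) * Fintype.card (Fin d → Fˣ)) * T ≤ G.card * T := by
    have : (1 / 2 : ℝ) ^ (d + 1) = 2 * (1 / 2) ^ (d + 2) := by ring
    rw [this] at hhits
    linarith
  exact le_of_mul_le_mul_right h2 hT0

theorem card_units_le : Fintype.card Fˣ ≤ Fintype.card F :=
  Fintype.card_le_of_injective _ Units.val_injective

theorem natCast_le_exp (n : ℕ) : (n : ℝ) ≤ Real.exp n := by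
  linarith [Real.add_one_le_exp (n : ℝ)]

theorem two_pow_le_exp (n : ℕ) : (2 : ℝ) ^ n ≤ Real.exp n := by
  have : Real.exp n = Real.exp 1 ^ n := by rw [← Real.exp_nat_mul, mul_one]
  rw [this]
  gcongr
  linarith [Real.add_one_le_exp (1 : ℝ)]

/-- Few scales suffice for all codes and boxes. -/
theorem exists_scales (α : Fin d → F) (hα : Function.Injective α) (hd : 1 ≤ d) :
    ∃ A : Finset (Fin d → Fˣ),
      (A.card : ℝ) ≤ (7 * Fintype.card F + 1) * d / (1 / 2) ^ (d + 2) + 1 ∧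
      ∀ κ ≤ d, ∀ (w : Fin d → Fˣ) (S : Fin d → Finset F), (∀ i, (S i).Nonempty) →
        1 ≤ (Fintype.card F : ℝ) ^ κ * ∏ i, (((S i).card : ℝ) / Fintype.card F) →
          ∃ a ∈ A, IsGoodScale α κ w S a := by
  classical
  set q := Fintype.card F with hq
  let Case := (Fin d → Fˣ × Finset F) × Fin (d + 1)
  set V : Finset Case := Finset.univ.filter fun c => (∀ i, (c.1 i).2.Nonempty) ∧
    1 ≤ (Fintype.card F : ℝ) ^ (c.2 : ℕ) * ∏ i, (((c.1 i).2.card : ℝ) / Fintype.card F) with hV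
  have hcard : (V.card : ℝ) ≤ Real.exp ((7 * q + 1) * d) := by
    have h1 : V.card ≤ (q * 2 ^ q) ^ d * (d + 1) := by
      refine (Finset.card_le_univ _).trans ?_
      simp only [Case, Fintype.card_prod, Fintype.card_fun, Fintype.card_finset, Fintype.card_fin]
      gcongr
      exact card_units_le
    calc (V.card : ℝ) ≤ (q * 2 ^ q) ^ d * (d + 1) := by exact_mod_cast h1
      _ ≤ (Real.exp q * Real.exp q) ^ d * Real.exp d := by
          gcongr
          · exact natCast_le_exp q
          · exact two_pow_le_exp q
          · exact Real.add_one_le_exp _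
      _ = Real.exp ((2 * q + 1) * d) := by
          rw [← Real.exp_add, ← Real.exp_nat_mul, ← Real.exp_add]
          congr 1
          ring
      _ ≤ _ := by
          gcongr
          norm_num
  obtain ⟨A, hA, h⟩ := exists_finset_hitting_of_card (C := Case)
    (fun c a => IsGoodScale α c.2 (fun i => (c.1 i).1) (fun i => (c.1 i).2) a)
    (θ := (1 / 2) ^ (d + 2)) (by positivity) (pow_le_one₀ (by norm_num) (by norm_num)) V
    (fun c hc => card_isGoodScale_ge hα (Nat.lt_succ_iff.1 c.2.2) _
      (Finset.mem_filter.1 hc).2.1 (Finset.mem_filter.1 hc).2.2) (by positivity) hcard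
  refine ⟨A, hA, fun κ hκ w S hS hW => ?_⟩
  exact h (fun i => (w i, S i), ⟨κ, Nat.lt_succ_iff.2 hκ⟩)
    (Finset.mem_filter.2 ⟨Finset.mem_univ _, hS, hW⟩)

/-- Few shifts suffice for all codes and boxes that belong to a good scale. -/
theorem exists_shifts {α β : Fin d → F} (hα : Function.Injective α) (hβ : Function.Injective β)
    (hd : 1 ≤ d) :
    ∃ H : Finset (Fin d → F),
      (H.card : ℝ) ≤ (7 * Fintype.card F + 1) * d / (1 / 2) ^ (d + 2) + 1 ∧
      ∀ κ ≤ d, ∀ (w : Fin d → Fˣ) (S : Fin d → Finset F) (a : Fin d → Fˣ), IsGoodScale α κ w S a →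
        ∀ (u e : Fin d → F) (v D : Fin d → Fˣ), ∃ h ∈ H, ∃ c : Fin κ → F, ∀ i,
          (a i : F) * (w i * (polyOf κ c).eval (α i)) +
            (u i + v i * transfer α β (fun l => D l * (h l - e l)) i) ∈ S i := by
  classical
  set q := Fintype.card F with hq
  let Case := (Fin d → Fˣ × Fˣ × Fˣ × Fˣ × F × F × Finset F) × Fin (d + 1)
  let cw : Case → Fin d → Fˣ := fun c i => (c.1 i).1
  let ca : Case → Fin d → Fˣ := fun c i => (c.1 i).2.1
  let cv : Case → Fin d → Fˣ := fun c i => (c.1 i).2.2.1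
  let cD : Case → Fin d → Fˣ := fun c i => (c.1 i).2.2.2.1
  let cu : Case → Fin d → F := fun c i => (c.1 i).2.2.2.2.1
  let ce : Case → Fin d → F := fun c i => (c.1 i).2.2.2.2.2.1
  let cS : Case → Fin d → Finset F := fun c i => (c.1 i).2.2.2.2.2.2
  let shift : Case → (Fin d → F) → Fin d → F := fun c h i =>
    cu c i + cv c i * transfer α β (fun l => cD c l * (h l - ce c l)) i
  set V : Finset Case := Finset.univ.filter fun c => IsGoodScale α c.2 (cw c) (cS c) (ca c) with hV
  have hcard : (V.card : ℝ) ≤ Real.exp ((7 * q + 1) * d) := by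
    have h1 : V.card ≤ (q * (q * (q * (q * (q * (q * 2 ^ q)))))) ^ d * (d + 1) := by
      refine (Finset.card_le_univ _).trans ?_
      simp only [Case, Fintype.card_prod, Fintype.card_fun, Fintype.card_finset, Fintype.card_fin]
      have := card_units_le (F := F)
      gcongr
    calc (V.card : ℝ) ≤ (q * (q * (q * (q * (q * (q * 2 ^ q)))))) ^ d * (d + 1) := by
          exact_mod_cast h1
      _ ≤ (Real.exp q * (Real.exp q * (Real.exp q * (Real.exp q * (Real.exp q *
            (Real.exp q * Real.exp q)))))) ^ d * Real.exp d := by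
          have h2 := natCast_le_exp q
          have h3 := two_pow_le_exp q
          have h4 := Real.add_one_le_exp (d : ℝ)
          gcongr
      _ = Real.exp ((7 * q + 1) * d) := by
          simp only [← Real.exp_add]
          rw [← Real.exp_nat_mul, ← Real.exp_add]
          congr 1
          ring
  obtain ⟨H, hH, h⟩ := exists_finset_hitting_of_card (C := Case)
    (fun c h => ∃ k : Fin c.2 → F, ∀ i,
      (ca c i : F) * (cw c i * (polyOf c.2 k).eval (α i)) + shift c h i ∈ cS c i)
    (θ := (1 / 2) ^ (d + 2)) (by positivity) (pow_le_one₀ (by norm_num) (by norm_num)) V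
    (fun c hc => by
      refine (Finset.mem_filter.1 hc).2.trans ?_
      -- the shift depends bijectively on `h`
      have hinj : Function.Injective (shift c) := by
        intro h h' he
        have h1 := transfer_injective hα hβ (a₁ := fun l => cD c l * (h l - ce c l))
          (a₂ := fun l => cD c l * (h' l - ce c l)) (by
            ext i
            exact mul_left_cancel₀ (cv c i).ne_zero (add_left_cancel (congrFun he i)))
        ext l
        exact sub_left_injective (mul_left_cancel₀ (cD c l).ne_zero (congrFun h1 l))
      have hsurj := Finite.surjective_of_injective hinj
      have : (Finset.univ.filter fun t : Fin d → F => ∃ k : Fin c.2 → F, ∀ i,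
          (ca c i : F) * (cw c i * (polyOf c.2 k).eval (α i)) + t i ∈ cS c i) ⊆
          (Finset.univ.filter fun h => ∃ k : Fin c.2 → F, ∀ i,
            (ca c i : F) * (cw c i * (polyOf c.2 k).eval (α i)) + shift c h i ∈ cS c i).image
              (shift c) := by
        intro t ht
        obtain ⟨h, rfl⟩ := hsurj t
        exact Finset.mem_image_of_mem _
          (Finset.mem_filter.2 ⟨Finset.mem_univ _, (Finset.mem_filter.1 ht).2⟩)
      exact_mod_cast (Finset.card_le_card this).trans Finset.card_image_le) (by positivity) hcard
  refine ⟨H, hH, fun κ hκ w S a hgood u e v D => ?_⟩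
  exact h (fun i => (w i, a i, v i, D i, u i, e i, S i), ⟨κ, Nat.lt_succ_iff.2 hκ⟩)
    (Finset.mem_filter.2 ⟨Finset.mem_univ _, hgood⟩)

/-- The finite family of polynomials and scales behind the point set: any digits that are
prescribed up to the orders `K i`, together with any boxes for the next digits, are realized,
provided that on average at least one polynomial does so. -/
theorem exists_polynomial_family {α β : Fin d → F} (hα : Function.Injective α)
    (hβ : Function.Injective β) (hαβ : ∀ i l, α i ≠ β l) (hd : 1 ≤ d) :
    ∃ (A : Finset (Fin d → Fˣ)) (H : Finset (Fin d → F)),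
      (A.card : ℝ) ≤ (7 * Fintype.card F + 1) * d / (1 / 2) ^ (d + 2) + 1 ∧
      (H.card : ℝ) ≤ (7 * Fintype.card F + 1) * d / (1 / 2) ^ (d + 2) + 1 ∧
      ∀ (M : ℕ) (K : Fin d → ℕ) (p : Fin d → ℕ → F) (S : Fin d → Finset F),
        (∀ i, (S i).Nonempty) → ∑ i, K i ≤ M →
        (Fintype.card F : ℝ) ^ (∑ i, K i) ≤
          (Fintype.card F : ℝ) ^ M * ∏ i, (((S i).card : ℝ) / Fintype.card F) →
        ∃ a ∈ A, ∃ h ∈ H, ∃ c : Fin M → F, ∀ i,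
          (∀ j < K i, (a i : F) * taylorDigit α i j (Lagrange.interpolate Finset.univ β h +
            Lagrange.nodal Finset.univ β * polyOf M c) = p i j) ∧
          (a i : F) * taylorDigit α i (K i) (Lagrange.interpolate Finset.univ β h +
            Lagrange.nodal Finset.univ β * polyOf M c) ∈ S i := by
  obtain ⟨A, hA, hA'⟩ := exists_scales α hα hd
  obtain ⟨H, hH, hH'⟩ := exists_shifts hα hβ hd
  refine ⟨A, H, hA, hH, fun M K p S hS hKM hvol => ?_⟩
  set N := ∑ i, K i with hN
  have hq1 : (1 : ℝ) ≤ Fintype.card F := by exact_mod_cast Fintype.card_pos (α := F)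
  have hq0 : (0 : ℝ) < Fintype.card F := by linarith
  set κ := min (M - N) d with hκ
  have hW : 1 ≤ (Fintype.card F : ℝ) ^ κ * ∏ i, (((S i).card : ℝ) / Fintype.card F) := by
    rcases le_total (M - N) d with h | h
    · rw [hκ, min_eq_left h]
      have : (Fintype.card F : ℝ) ^ M =
          (Fintype.card F : ℝ) ^ N * (Fintype.card F : ℝ) ^ (M - N) := by
        rw [← pow_add]; congr 1; omega
      rw [this, mul_assoc] at hvol
      exact le_of_mul_le_mul_left (by rwa [mul_one]) (by positivity : 0 < (Fintype.card F : ℝ) ^ N)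
    · rw [hκ, min_eq_right h, Finset.prod_div_distrib, Finset.prod_const, Finset.card_univ,
        Fintype.card_fin, mul_div_cancel₀ _ (by positivity)]
      refine Finset.one_le_prod fun i _ => ?_
      exact_mod_cast (hS i).card_pos
  set B := Lagrange.nodal Finset.univ β with hB
  have hBα : ∀ i, B.eval (α i) ≠ 0 := fun i =>
    Lagrange.eval_nodal_not_at_node fun l _ => hαβ i l
  have hV : ∀ l, (vanishPoly α K).eval (β l) ≠ 0 := fun l => by
    rw [vanishPoly, eval_prod, Finset.prod_ne_zero_iff]
    intro i _
    simpa using fun h => absurd (sub_eq_zero.1 h).symm (hαβ i l)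
  set w : Fin d → Fˣ := fun i =>
    Units.mk0 _ (mul_ne_zero (leadingDigit_ne_zero hα K i) (hBα i)) with hw
  obtain ⟨a, haA, hgood⟩ := hA' κ (min_le_right _ _) w S hS hW
  obtain ⟨f₀, hf₀, hdig⟩ := exists_hermite hα (fun i j => (a i : F)⁻¹ * p i j) N K hN.symm
  obtain ⟨h, hhH, c, hc⟩ := hH' κ (min_le_right _ _) w S a hgood
    (fun i => a i * taylorDigit α i (K i) f₀) (fun l => f₀.eval (β l))
    (fun i => a i * Units.mk0 _ (leadingDigit_ne_zero hα K i))
    (fun l => (Units.mk0 _ (hV l))⁻¹)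
  set ρ : Fin d → F := fun l => ((vanishPoly α K).eval (β l))⁻¹ * (h l - f₀.eval (β l)) with hρ
  set G := Lagrange.interpolate Finset.univ β ρ with hG
  set f := f₀ + vanishPoly α K * (G + B * polyOf κ c) with hf
  have hfβ : ∀ l, f.eval (β l) = h l := by
    intro l
    have h1 : G.eval (β l) = ρ l := Lagrange.eval_interpolate_at_node ρ hβ.injOn (Finset.mem_univ l)
    have h2 : B.eval (β l) = 0 := Lagrange.eval_nodal_at_node (Finset.mem_univ l)
    rw [hf, eval_add, eval_mul, eval_add, eval_mul, h1, h2, zero_mul, add_zero, hρ]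
    have := hV l
    field_simp
    ring
  have hdeg : f.degree < ((M + d : ℕ) : WithBot ℕ) := by
    have hBd : B.degree = (d : WithBot ℕ) := by rw [hB, Lagrange.degree_nodal]; simp
    have hGd : (G + B * polyOf κ c).degree < ((d + κ : ℕ) : WithBot ℕ) := by
      refine (degree_add_le _ _).trans_lt (max_lt ?_ ?_)
      · refine (Lagrange.degree_interpolate_lt _ hβ.injOn).trans_le ?_
        rw [Finset.card_univ, Fintype.card_fin]
        exact_mod_cast Nat.le_add_right d κ
      · rw [degree_mul, hBd]
        push_cast
        exact WithBot.add_lt_add_left (WithBot.natCast_ne_bot d) (degree_polyOf_lt κ c)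
    refine (degree_add_le _ _).trans_lt (max_lt (hf₀.trans_le ?_) ?_)
    · exact_mod_cast (by omega : N ≤ M + d)
    · rw [degree_mul, degree_vanishPoly]
      have h3 : ((N : ℕ) : WithBot ℕ) + (G + B * polyOf κ c).degree <
          (N : WithBot ℕ) + ((d + κ : ℕ) : WithBot ℕ) :=
        WithBot.add_lt_add_left (WithBot.natCast_ne_bot N) hGd
      refine h3.trans_le ?_
      exact_mod_cast (by omega : N + (d + κ) ≤ M + d)
  obtain ⟨c', hc'⟩ := exists_eq_interpolate_add hβ hdeg
  simp only [hfβ] at hc'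
  refine ⟨a, haA, h, hhH, c', fun i => ?_⟩
  have hc'' : Lagrange.interpolate Finset.univ β h + B * polyOf M c' = f := hc'.symm
  rw [hc'']
  refine ⟨fun j hj => ?_, ?_⟩
  · rw [hf, taylorDigit_add, taylorDigit_vanishPoly_mul_of_lt K _ hj, add_zero, hdig i j hj,
      mul_inv_cancel_left₀ (a i).ne_zero]
  · have h4 := hc i
    have h5 : transfer α β
        (fun l => (((Units.mk0 _ (hV l))⁻¹ : Fˣ) : F) * (h l - f₀.eval (β l))) i =
        G.eval (α i) := by
      simp only [Units.val_inv_eq_inv_val, Units.val_mk0]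
      rfl
    rw [h5] at h4
    rw [hf, taylorDigit_add, taylorDigit_vanishPoly_mul_self, eval_add, eval_mul]
    convert h4 using 1
    simp only [hw, Units.val_mul, Units.val_mk0]
    ring

end Scales

/-! ### Digit expansions and point sets with exponential cardinality -/

/-- The number with the digits `δ 0, …, δ (k - 1)` in base `q`, the most significant digit first. -/
def digitIndex (q : ℕ) (δ : ℕ → ℕ) : ℕ → ℕ
  | 0 => 0
  | k + 1 => q * digitIndex q δ k + δ k

theorem digitIndex_congr {q : ℕ} {δ δ' : ℕ → ℕ} {k : ℕ} (h : ∀ j < k, δ j = δ' j) :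
    digitIndex q δ k = digitIndex q δ' k := by
  induction k with
  | zero => rfl
  | succ k ih =>
    rw [digitIndex, digitIndex, ih fun j hj => h j (hj.trans k.lt_succ_self), h k k.lt_succ_self]

theorem digitIndex_mul_le (q : ℕ) (δ : ℕ → ℕ) (k n : ℕ) :
    digitIndex q δ k * q ^ n ≤ digitIndex q δ (k + n) := by
  induction n with
  | zero => simp
  | succ n ih =>
    rw [← add_assoc, digitIndex, pow_succ']
    nlinarith

theorem digitIndex_succ_le {q : ℕ} {δ : ℕ → ℕ} (hδ : ∀ j, δ j < q) (k n : ℕ) :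
    digitIndex q δ (k + n) + 1 ≤ (digitIndex q δ k + 1) * q ^ n := by
  induction n with
  | zero => simp
  | succ n ih =>
    rw [← add_assoc, digitIndex, pow_succ']
    have := hδ (k + n)
    nlinarith

theorem digitIndex_of_lt {q P K : ℕ} (hP : P < q ^ K) :
    digitIndex q (fun j => P / q ^ (K - 1 - j) % q) K = P := by
  have h : ∀ j ≤ K, digitIndex q (fun j => P / q ^ (K - 1 - j) % q) j = P / q ^ (K - j) := by
    intro j
    induction j with
    | zero => intro _; rw [digitIndex, Nat.sub_zero, Nat.div_eq_of_lt hP]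
    | succ j ih =>
      intro hj
      rw [digitIndex, ih (by omega), show K - j = K - 1 - j + 1 by omega,
        show K - (j + 1) = K - 1 - j by omega, pow_succ, ← Nat.div_div_eq_div_mul]
      exact Nat.div_add_mod _ _
  simpa using h K le_rfl

/-- An interval contains a block of `q`-adic cells with a common parent that makes up at least a
fourth of its length. -/
theorem exists_cell_block {q : ℕ} (hq : 2 ≤ q) {α β : ℝ} (hα : 0 ≤ α) (hαβ : α < β) (hβ : β ≤ 1) :
    ∃ (K P : ℕ) (S : Finset ℕ), S.Nonempty ∧ (∀ s ∈ S, s < q) ∧ P < q ^ K ∧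
      β - α ≤ 4 * S.card / (q : ℝ) ^ (K + 1) ∧
      ∀ s ∈ S, α < ((q * P + s : ℕ) : ℝ) / (q : ℝ) ^ (K + 1) ∧
        ((q * P + s : ℕ) + 1 : ℝ) / (q : ℝ) ^ (K + 1) ≤ β := by
  classical
  have hq0 : (0 : ℝ) < q := by exact_mod_cast (by omega : 0 < q)
  have hq1 : (1 : ℝ) < q := by exact_mod_cast (by omega : 1 < q)
  -- the first level at which some cell lies in the interval
  have hex : ∃ k : ℕ, ⌊α * (q : ℝ) ^ k⌋₊ + 1 < ⌊β * (q : ℝ) ^ k⌋₊ := by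
    obtain ⟨k, hk⟩ := pow_unbounded_of_one_lt (2 / (β - α)) hq1
    refine ⟨k, ?_⟩
    rw [div_lt_iff₀ (by linarith)] at hk
    have h1 := Nat.lt_floor_add_one (β * (q : ℝ) ^ k)
    have h2 := Nat.floor_le (by positivity : 0 ≤ α * (q : ℝ) ^ k)
    have : ((⌊α * (q : ℝ) ^ k⌋₊ + 1 : ℕ) : ℝ) < (⌊β * (q : ℝ) ^ k⌋₊ : ℝ) := by
      push_cast
      nlinarith
    exact_mod_cast this
  obtain ⟨k, hk, hmin⟩ : ∃ k, ⌊α * (q : ℝ) ^ k⌋₊ + 1 < ⌊β * (q : ℝ) ^ k⌋₊ ∧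
      ∀ j < k, ¬ ⌊α * (q : ℝ) ^ j⌋₊ + 1 < ⌊β * (q : ℝ) ^ j⌋₊ :=
    ⟨Nat.find hex, Nat.find_spec hex, fun j hj => Nat.find_min hex hj⟩
  have hβq : ∀ j : ℕ, ⌊β * (q : ℝ) ^ j⌋₊ ≤ q ^ j := fun j => by
    have : β * (q : ℝ) ^ j ≤ ((q ^ j : ℕ) : ℝ) := by
      push_cast
      exact mul_le_of_le_one_left (by positivity) hβ
    exact (Nat.floor_mono this).trans_eq (Nat.floor_natCast _)
  obtain ⟨K, rfl⟩ : ∃ K, k = K + 1 := by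
    refine Nat.exists_eq_succ_of_ne_zero ?_
    rintro rfl
    have := hβq 0
    simp only [pow_zero] at this hk
    omega
  set A := ⌊α * (q : ℝ) ^ (K + 1)⌋₊ + 1 with hA
  set B := ⌊β * (q : ℝ) ^ (K + 1)⌋₊ with hB
  set p := ⌊α * (q : ℝ) ^ K⌋₊ with hp
  have hAlt : α * (q : ℝ) ^ (K + 1) < A := by simpa [hA] using Nat.lt_floor_add_one _
  have hAle : (A : ℝ) - 1 ≤ α * (q : ℝ) ^ (K + 1) := by
    simpa [hA] using Nat.floor_le (by positivity : 0 ≤ α * (q : ℝ) ^ (K + 1))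
  have hBle : (B : ℝ) ≤ β * (q : ℝ) ^ (K + 1) :=
    Nat.floor_le (mul_nonneg (by linarith) (by positivity))
  have hBlt : β * (q : ℝ) ^ (K + 1) < B + 1 := Nat.lt_floor_add_one _
  have hpow : (0 : ℝ) < (q : ℝ) ^ (K + 1) := by positivity
  -- the cells have at most two parents, as their parents meet the interval
  have hpar : ∀ t ∈ Finset.Ico A B, t / q = p ∨ t / q = p + 1 := by
    intro t ht
    rw [Finset.mem_Ico] at ht
    have h1 : p ≤ t / q := by
      rw [Nat.le_div_iff_mul_le (by omega)]
      have h2 : (p : ℝ) ≤ α * (q : ℝ) ^ K := Nat.floor_le (by positivity)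
      have h3 : (A : ℝ) ≤ t := by exact_mod_cast ht.1
      have : ((p * q : ℕ) : ℝ) ≤ t := by
        push_cast
        calc (p : ℝ) * q ≤ α * (q : ℝ) ^ K * q := by gcongr
          _ = α * (q : ℝ) ^ (K + 1) := by ring
          _ ≤ t := by linarith
      exact_mod_cast this
    have h2 : t / q ≤ ⌊β * (q : ℝ) ^ K⌋₊ := by
      refine Nat.le_floor ?_
      have h3 : (t : ℝ) ≤ B := by exact_mod_cast ht.2.le
      calc ((t / q : ℕ) : ℝ) ≤ t / q := Nat.cast_div_le
        _ ≤ β * (q : ℝ) ^ K := by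
          rw [div_le_iff₀ hq0, mul_assoc, ← pow_succ]
          linarith
    have h3 := hmin K K.lt_succ_self
    omega
  -- the larger of the two groups of siblings
  obtain ⟨P, hP⟩ : ∃ P, B - A ≤ 2 * ((Finset.Ico A B).filter fun t => t / q = P).card := by
    have h1 : (Finset.Ico A B) ⊆ ((Finset.Ico A B).filter fun t => t / q = p) ∪
        ((Finset.Ico A B).filter fun t => t / q = p + 1) := fun t ht => by
      rw [Finset.mem_union, Finset.mem_filter, Finset.mem_filter]
      exact (hpar t ht).imp (fun h => ⟨ht, h⟩) fun h => ⟨ht, h⟩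
    have h2 := (Finset.card_le_card h1).trans (Finset.card_union_le _ _)
    rw [Nat.card_Ico] at h2
    rcases le_total ((Finset.Ico A B).filter fun t => t / q = p).card
      ((Finset.Ico A B).filter fun t => t / q = p + 1).card with h | h
    · exact ⟨p + 1, by omega⟩
    · exact ⟨p, by omega⟩
  set T := (Finset.Ico A B).filter fun t => t / q = P with hT
  have hTne : T.Nonempty := Finset.card_pos.1 (by omega)
  have hTmem : ∀ t ∈ T, (A ≤ t ∧ t < B) ∧ q * P + t % q = t := by
    intro t ht
    rw [hT, Finset.mem_filter, Finset.mem_Ico] at ht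
    exact ⟨ht.1, by rw [← ht.2]; exact Nat.div_add_mod _ _⟩
  have hcard : (T.image (· % q)).card = T.card := by
    refine Finset.card_image_of_injOn fun t ht t' ht' h => ?_
    have h1 := (hTmem t ht).2
    have h2 := (hTmem t' ht').2
    have h3 : t % q = t' % q := h
    omega
  refine ⟨K, P, T.image (· % q), hTne.image _, ?_, ?_, ?_, ?_⟩
  · intro s hs
    obtain ⟨t, -, rfl⟩ := Finset.mem_image.1 hs
    exact Nat.mod_lt _ (by omega)
  · obtain ⟨t, ht⟩ := hTne
    have h1 := (hTmem t ht).1.2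
    rw [← (Finset.mem_filter.1 ht).2, Nat.div_lt_iff_lt_mul (by omega), ← pow_succ]
    exact h1.trans_le (hβq _)
  · rw [hcard, le_div_iff₀ hpow]
    have h1 : 1 ≤ T.card := Finset.card_pos.2 hTne
    have h2 : B + 2 ≤ A + 4 * T.card := by omega
    have h3 : (B : ℝ) + 2 ≤ A + 4 * T.card := by exact_mod_cast h2
    nlinarith
  · intro s hs
    obtain ⟨t, ht, rfl⟩ := Finset.mem_image.1 hs
    obtain ⟨⟨h1, h2⟩, h3⟩ := hTmem t ht
    simp only [h3]
    have h1 : (A : ℝ) ≤ t := by exact_mod_cast h1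
    have h2 : (t : ℝ) + 1 ≤ B := by exact_mod_cast h2
    rw [lt_div_iff₀ hpow, div_le_iff₀ hpow]
    exact ⟨by linarith, by linarith⟩

/-- Point sets of dispersion at most `η` whose cardinality is exponential in the dimension and
proportional to `η⁻¹`: their coordinates have the (scaled) Taylor coefficients of the members of a
family of polynomials over a finite field as digits. -/
theorem exists_dispersion_le_exponential : ∃ A₀ : ℝ, 1 ≤ A₀ ∧ ∀ d : ℕ, 1 ≤ d → ∀ η : ℝ, 0 < η →
    η < 1 → ∃ P : Finset (Cube d), dispersion P ≤ ENNReal.ofReal η ∧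
      (P.card : ℝ) ≤ A₀ ^ d * η⁻¹ := by
  classical
  refine ⟨54756 * 512, by norm_num, fun d hd η h0 h1 => ?_⟩
  obtain ⟨q, hqp, hq1, hq2⟩ := Nat.exists_prime_lt_and_le_two_mul (2 * d) (by omega)
  have : Fact q.Prime := ⟨hqp⟩
  have hq0 : (0 : ℝ) < q := by exact_mod_cast hqp.pos
  have hval : ∀ n < q, ((n : ZMod q)).val = n := fun n hn => ZMod.val_cast_of_lt hn
  obtain ⟨A, H, hA, hH, hAH⟩ := exists_polynomial_family (F := ZMod q)
    (α := fun i : Fin d => ((i : ℕ) : ZMod q)) (β := fun i : Fin d => ((d + i : ℕ) : ZMod q))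
    (fun i j h => Fin.ext (by
      have := congrArg ZMod.val h
      simp only at this
      rwa [hval _ (by omega), hval _ (by omega)] at this))
    (fun i j h => Fin.ext (by
      have := congrArg ZMod.val h
      simp only at this
      rw [hval _ (by omega), hval _ (by omega)] at this
      omega))
    (fun i j h => by
      have := congrArg ZMod.val h
      rw [hval _ (by omega), hval _ (by omega)] at this
      omega) hd
  rw [ZMod.card] at hA hH
  set α : Fin d → ZMod q := fun i => ((i : ℕ) : ZMod q) with hα
  set β : Fin d → ZMod q := fun i => ((d + i : ℕ) : ZMod q) with hβ
  have hx1 : (1 : ℝ) ≤ 4 ^ d / η := by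
    rw [le_div_iff₀ h0]
    have : (1 : ℝ) ≤ 4 ^ d := one_le_pow₀ (by norm_num)
    linarith
  obtain ⟨n, hn1, hn2⟩ := exists_nat_pow_near hx1 (by exact_mod_cast hqp.one_lt : (1 : ℝ) < q)
  set M := n + 1 with hM
  have hMq : (q : ℝ) ^ M ≤ q * (4 ^ d / η) := by
    rw [hM, pow_succ']
    gcongr
  let digit : (Fin d → (ZMod q)ˣ) × (Fin d → ZMod q) × (Fin M → ZMod q) → Fin d → ℕ → ℕ :=
    fun t i j => ((t.1 i : ZMod q) * taylorDigit α i j (Lagrange.interpolate Finset.univ β t.2.1 +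
      Lagrange.nodal Finset.univ β * polyOf M t.2.2)).val
  let pt : (Fin d → (ZMod q)ˣ) × (Fin d → ZMod q) × (Fin M → ZMod q) → Cube d := fun t i =>
    projIcc (0 : ℝ) 1 zero_le_one ((digitIndex q (digit t i) (M + 1) : ℝ) / (q : ℝ) ^ (M + 1))
  refine ⟨(A ×ˢ H ×ˢ Finset.univ).image pt, ?_, ?_⟩
  · rw [dispersion_le_iff h0.le]
    intro a b ha hab hb hvol
    choose K P S hSne hSq hPK hlen hS using fun i =>
      exists_cell_block hqp.two_le (ha i) (hab i) (hb i)
    have hScard : ∀ i, ((S i).image (Nat.cast : ℕ → ZMod q)).card = (S i).card := fun i =>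
      Finset.card_image_of_injOn fun s hs s' hs' h => by
        have := congrArg ZMod.val h
        rwa [hval _ (hSq i s hs), hval _ (hSq i s' hs')] at this
    have hprod : (q : ℝ) ^ (∑ i, K i) ≤ (q : ℝ) ^ M * ∏ i, (((S i).card : ℝ) / q) := by
      have h2 : η ≤ ∏ i, (4 * (S i).card / (q : ℝ) ^ (K i + 1)) :=
        hvol.le.trans (Finset.prod_le_prod (fun i _ => by linarith [hab i]) fun i _ => hlen i)
      have h3 : ∏ i, (4 * (S i).card / (q : ℝ) ^ (K i + 1)) =
          4 ^ d * (∏ i, (((S i).card : ℝ) / q)) / (q : ℝ) ^ (∑ i, K i) := by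
        rw [← Finset.prod_pow_eq_pow_sum,
          show (4 : ℝ) ^ d = ∏ _i : Fin d, 4 by simp, ← Finset.prod_mul_distrib,
          ← Finset.prod_div_distrib]
        refine Finset.prod_congr rfl fun i _ => ?_
        rw [pow_succ]
        field_simp
      rw [h3, le_div_iff₀ (by positivity)] at h2
      have h4 : 4 ^ d / η * (∏ i, (((S i).card : ℝ) / q)) ≤
          (q : ℝ) ^ M * ∏ i, (((S i).card : ℝ) / q) := by gcongr
      refine le_trans ?_ h4
      rw [div_mul_eq_mul_div, le_div_iff₀ h0]
      linarith
    have hKM : ∑ i, K i ≤ M := by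
      have h2 : ∏ i, (((S i).card : ℝ) / q) ≤ 1 := by
        refine Finset.prod_le_one (fun i _ => by positivity) fun i _ => ?_
        rw [div_le_one hq0]
        have : (S i).card ≤ (Finset.range q).card :=
          Finset.card_le_card fun s hs => Finset.mem_range.2 (hSq i s hs)
        rw [Finset.card_range] at this
        exact_mod_cast this
      have h3 : (q : ℝ) ^ (∑ i, K i) ≤ (q : ℝ) ^ M :=
        hprod.trans (mul_le_of_le_one_right (by positivity) h2)
      exact (pow_le_pow_iff_right₀ (by exact_mod_cast hqp.one_lt)).1 h3
    obtain ⟨w, hw, h, hh, c, hc⟩ := hAH M K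
      (fun i j => ((P i / q ^ (K i - 1 - j) % q : ℕ) : ZMod q))
      (fun i => (S i).image (Nat.cast : ℕ → ZMod q)) (fun i => (hSne i).image _) hKM (by
        rw [ZMod.card]
        simp only [hScard]
        exact hprod)
    refine ⟨pt (w, h, c), Finset.mem_image_of_mem _ (by simp [hw, hh]), fun i => ?_⟩
    have hdig : ∀ j, digit (w, h, c) i j < q := fun j => ZMod.val_lt _
    have hKi : digitIndex q (digit (w, h, c) i) (K i) = P i := by
      rw [← digitIndex_of_lt (hPK i)]
      refine digitIndex_congr fun j hj => ?_
      simp only [digit]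
      rw [(hc i).1 j hj, hval _ (Nat.mod_lt _ hqp.pos)]
    obtain ⟨s, hs, hs'⟩ := Finset.mem_image.1 (hc i).2
    have hsd : digit (w, h, c) i (K i) = s := by
      simp only [digit]
      rw [← hs', hval _ (hSq i s hs)]
    have hKi1 : digitIndex q (digit (w, h, c) i) (K i + 1) = q * P i + s := by
      rw [digitIndex, hKi, hsd]
    have hKiM : K i ≤ M := (Finset.single_le_sum (fun _ _ => Nat.zero_le _)
      (Finset.mem_univ i)).trans hKM
    obtain ⟨e, he⟩ := Nat.exists_eq_add_of_le (Nat.succ_le_succ hKiM)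
    have hlow := digitIndex_mul_le q (digit (w, h, c) i) (K i + 1) e
    have hup := digitIndex_succ_le hdig (K i + 1) e
    rw [← Nat.succ_eq_add_one (K i), ← he, Nat.succ_eq_add_one, Nat.succ_eq_add_one] at hlow hup
    rw [hKi1] at hlow hup
    have hlow' : ((q * P i + s : ℕ) : ℝ) * (q : ℝ) ^ e ≤
      digitIndex q (digit (w, h, c) i) (M + 1) := by exact_mod_cast hlow
    have hup' : (digitIndex q (digit (w, h, c) i) (M + 1) : ℝ) + 1 ≤
      ((q * P i + s : ℕ) + 1 : ℝ) * (q : ℝ) ^ e := by exact_mod_cast hup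
    obtain ⟨hs1, hs2⟩ := hS i s hs
    set x : ℝ := (digitIndex q (digit (w, h, c) i) (M + 1) : ℝ) / (q : ℝ) ^ (M + 1) with hx
    have hpe : (q : ℝ) ^ (M + 1) = (q : ℝ) ^ (K i + 1) * (q : ℝ) ^ e := by
      rw [← pow_add]
      congr 1
    have hx1 : a i < x := by
      refine hs1.trans_le ?_
      rw [hx, hpe, div_le_div_iff₀ (by positivity) (by positivity)]
      have : (0 : ℝ) < (q : ℝ) ^ (K i + 1) := by positivity
      nlinarith
    have hx2 : x < b i := by
      refine lt_of_lt_of_le ?_ hs2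
      rw [hx, hpe, div_lt_div_iff₀ (by positivity) (by positivity)]
      have : (0 : ℝ) < (q : ℝ) ^ (K i + 1) := by positivity
      nlinarith
    have : ((pt (w, h, c) i : I) : ℝ) = x := by
      simp only [pt]
      rw [projIcc_of_mem _ ⟨by positivity, (hx2.le.trans (hb i))⟩]
    rw [this]
    exact ⟨hx1, hx2⟩
  · have hd2 : (d : ℝ) ≤ 2 ^ d := by exact_mod_cast d.lt_two_pow_self.le
    have hd1 : (1 : ℝ) ≤ d := by exact_mod_cast hd
    have hq4 : (q : ℝ) ≤ 4 * d := by
      have : q ≤ 4 * d := by omega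
      exact_mod_cast this
    have hb : (7 * q + 1) * d / (1 / 2 : ℝ) ^ (d + 2) + 1 ≤ 117 * 8 ^ d := by
      have h2 : (7 * q + 1) * d / (1 / 2 : ℝ) ^ (d + 2) = (7 * q + 1) * d * (4 * 2 ^ d) := by
        rw [pow_add, div_eq_mul_inv]
        congr 1
        simp
        ring
      have h3 : (1 : ℝ) ≤ 8 ^ d := one_le_pow₀ (by norm_num)
      have h4 : (8 : ℝ) ^ d = 2 ^ d * 2 ^ d * 2 ^ d := by
        rw [← mul_pow, ← mul_pow]
        norm_num
      rw [h2]
      calc (7 * q + 1) * d * (4 * 2 ^ d) + 1 ≤ (29 * d) * d * (4 * 2 ^ d) + (1 : ℝ) := by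
            gcongr
            linarith
        _ ≤ (29 * 2 ^ d) * 2 ^ d * (4 * 2 ^ d) + 8 ^ d := by gcongr
        _ = 117 * 8 ^ d := by rw [h4]; ring
    calc (((A ×ˢ H ×ˢ Finset.univ).image pt).card : ℝ)
        ≤ ((A ×ˢ H ×ˢ (Finset.univ : Finset (Fin M → ZMod q))).card : ℝ) := by
          exact_mod_cast Finset.card_image_le
      _ = A.card * (H.card * (q : ℝ) ^ M) := by simp [Finset.card_product, ZMod.card]
      _ ≤ (117 * 8 ^ d) * ((117 * 8 ^ d) * ((4 * 2 ^ d) * (4 ^ d / η))) := by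
          have h5 : (q : ℝ) ^ M ≤ (4 * 2 ^ d) * (4 ^ d / η) :=
            hMq.trans (by gcongr; linarith)
          gcongr
          · exact hA.trans hb
          · exact hH.trans hb
      _ = 54756 * 512 ^ d * η⁻¹ := by
          rw [show (512 : ℝ) ^ d = 8 ^ d * (8 ^ d * (2 ^ d * 4 ^ d)) by
            rw [← mul_pow, ← mul_pow, ← mul_pow]; norm_num]
          field_simp
          ring
      _ ≤ (54756 * 512) ^ d * η⁻¹ := by
          rw [mul_pow]
          gcongr
          exact le_self_pow₀ (by norm_num) (by omega)

/-! ### Detectors -/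

theorem rho_pos {r : ℕ} (hr : 1 ≤ r) (M : ℝ) : 0 < rho r M :=
  lt_max_of_lt_left (by exact_mod_cast hr)

theorem le_rho_pow {r : ℕ} (hr : 1 ≤ r) {M : ℝ} (hM : 0 ≤ M) : M ≤ rho r M ^ r := by
  have h : M ^ (1 / (r : ℝ)) ≤ rho r M := le_max_right _ _
  calc M = (M ^ (1 / (r : ℝ))) ^ r := by
        rw [one_div, Real.rpow_inv_natCast_pow hM (by omega)]
    _ ≤ rho r M ^ r := by gcongr

theorem prod_abs_sub_add_one_le {p r : ℕ} (hpr : p + 1 ≤ r) :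
    ∏ c ∈ Finset.range r, (|(c : ℝ) - p| + 1) ≤ (r ! : ℝ) := by
  induction r, hpr using Nat.le_induction with
  | base =>
    rw [← Finset.prod_range_reflect, ← Finset.prod_range_add_one_eq_factorial]
    push_cast
    refine (Finset.prod_congr rfl fun j hj => ?_).le
    rw [Finset.mem_range] at hj
    rw [Nat.cast_sub (by omega), abs_of_nonpos] <;>
    · have : (0 : ℝ) ≤ j := j.cast_nonneg
      linarith
  | succ r hr ih =>
    rw [Finset.prod_range_succ, Nat.factorial_succ, mul_comm]
    push_cast
    have h1 : (p : ℝ) + 1 ≤ r := by exact_mod_cast hr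
    have h2 : (0 : ℝ) ≤ p := p.cast_nonneg
    rw [abs_of_nonneg (by linarith)]
    have h3 : 0 ≤ ∏ c ∈ Finset.range r, (|(c : ℝ) - p| + 1) :=
      Finset.prod_nonneg fun _ _ => by positivity
    exact mul_le_mul (by linarith) ih h3 (by positivity)

theorem rpow_one_div_pow {r : ℕ} (hr : 1 ≤ r) {s : ℝ} (hs : 0 ≤ s) :
    (s ^ (1 / (r : ℝ))) ^ r = s := by
  rw [one_div, Real.rpow_inv_natCast_pow hs (by omega)]

/-- A univariate function of the class that is nonzero at `x` has no zeros on some interval of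
length `|g x|^(1/r) / ϱ`: otherwise, of `r` adjacent intervals of this length one of which contains
`x`, each contains a zero, and the interpolation error bound at these zeros contradicts the size
of `g x`. -/
theorem exists_zero_free_interval {r : ℕ} (hr : 1 ≤ r) {M : ℝ} (hM : 0 ≤ M) {g : I → ℝ}
    (hg : g ∈ factorClass r M) {x : I} (hx : g x ≠ 0) :
    ∃ α β : ℝ, 0 ≤ α ∧ α < β ∧ β ≤ 1 ∧ |g x| ^ (1 / (r : ℝ)) / rho r M ≤ β - α ∧
      ∀ t : I, α < t → (t : ℝ) < β → g t ≠ 0 := by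
  have hs : 0 < |g x| := abs_pos.2 hx
  have hs1 : |g x| ≤ 1 := abs_le.2 (hg.1 x)
  have hρ := rho_pos hr M
  have hr0 : (0 : ℝ) < r := by exact_mod_cast hr
  set L : ℝ := |g x| ^ (1 / (r : ℝ)) / rho r M with hL
  have hL0 : 0 < L := by positivity
  have hrL : r * L ≤ 1 := by
    have h1 : |g x| ^ (1 / (r : ℝ)) ≤ 1 := Real.rpow_le_one hs.le hs1 (by positivity)
    have h2 : (r : ℝ) ≤ rho r M := le_max_left _ _
    rw [hL, mul_div_assoc', div_le_one hρ]
    nlinarith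
  -- `r` adjacent cells of length `L`, cell `p` contains `x`
  set a : ℝ := min (x : ℝ) (1 - r * L) with ha
  have ha0 : 0 ≤ a := le_min x.2.1 (by linarith)
  have hax : a ≤ x := min_le_left _ _
  have har : a + r * L ≤ 1 := by linarith [min_le_right (x : ℝ) (1 - r * L)]
  have hxa : (x : ℝ) ≤ a + r * L := by
    rcases min_choice (x : ℝ) (1 - r * L) with h | h
    · rw [ha, h]
      linarith [mul_pos hr0 hL0]
    · rw [ha, h]
      linarith [x.2.2]
  obtain ⟨p, hpr, hp1, hp2⟩ : ∃ p : ℕ, p + 1 ≤ r ∧ a + p * L ≤ x ∧ (x : ℝ) ≤ a + (p + 1) * L := by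
    have h0 : 0 ≤ ((x : ℝ) - a) / L := div_nonneg (by linarith) hL0.le
    have h1 := Nat.floor_le h0
    have h2 := Nat.lt_floor_add_one (((x : ℝ) - a) / L)
    rw [le_div_iff₀ hL0] at h1
    rw [div_lt_iff₀ hL0] at h2
    by_cases h : ⌊((x : ℝ) - a) / L⌋₊ + 1 ≤ r
    · exact ⟨_, h, by linarith, by linarith⟩
    · have h3 : (r : ℝ) ≤ ⌊((x : ℝ) - a) / L⌋₊ := by
        exact_mod_cast (by omega : r ≤ ⌊((x : ℝ) - a) / L⌋₊)
      refine ⟨r - 1, by omega, ?_, ?_⟩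
      · rw [Nat.cast_sub hr]
        push_cast
        nlinarith
      · rw [Nat.cast_sub hr]
        push_cast
        linarith
  by_contra! hcon
  have hz : ∀ c : ℕ, ∃ t : I, c < r → a + c * L < t ∧ (t : ℝ) < a + (c + 1) * L ∧ g t = 0 := by
    intro c
    by_cases hc : c < r
    · have hc1 : ((c : ℝ) + 1) * L ≤ r * L := by
        gcongr
        exact_mod_cast hc
      obtain ⟨t, h1, h2, h3⟩ := hcon (a + c * L) (a + (c + 1) * L) (by positivity) (by linarith)
        (by linarith) (by linarith)
      exact ⟨t, fun _ => ⟨h1, h2, h3⟩⟩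
    · exact ⟨0, fun h => absurd h hc⟩
  choose z hz using hz
  have hinj : InjOn z (Finset.range r : Set ℕ) := by
    have hlt : ∀ c c' : ℕ, c' < r → c < c' → z c ≠ z c' := by
      intro c c' hc' hcc h
      have h1 := (hz c (hcc.trans hc')).2.1
      have h2 := (hz c' hc').1
      have h3 : ((c : ℝ) + 1) * L ≤ c' * L := by
        gcongr
        exact_mod_cast hcc
      rw [h] at h1
      linarith
    intro c hc c' hc' h
    rw [Finset.mem_coe, Finset.mem_range] at hc hc'
    rcases lt_trichotomy c c' with h' | h' | h'
    · exact absurd h (hlt c c' hc' h')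
    · exact h'
    · exact absurd h.symm (hlt c' c hc h')
  have hb := abs_le_of_zeros hM hg (Finset.range r) z hinj (Finset.card_range r)
    (fun c hc => (hz c (Finset.mem_range.1 hc)).2.2) x
  have hdist : ∀ c ∈ Finset.range r, |(x : ℝ) - z c| < (|(c : ℝ) - p| + 1) * L := by
    intro c hc
    obtain ⟨h1, h2, -⟩ := hz c (Finset.mem_range.1 hc)
    have h3 : ((c : ℝ) - p) * L ≤ |(c : ℝ) - p| * L := by gcongr; exact le_abs_self _
    have h4 : -((c : ℝ) - p) * L ≤ |(c : ℝ) - p| * L := by gcongr; exact neg_le_abs _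
    rw [abs_lt]
    constructor <;> nlinarith
  have hne : ∀ c ∈ Finset.range r, 0 < |(x : ℝ) - z c| := by
    intro c hc
    refine abs_pos.2 (sub_ne_zero.2 fun h => hx ?_)
    rw [Subtype.ext h]
    exact (hz c (Finset.mem_range.1 hc)).2.2
  have hprod : ∏ c ∈ Finset.range r, |(x : ℝ) - z c| < r ! * L ^ r := by
    calc ∏ c ∈ Finset.range r, |(x : ℝ) - z c|
        < ∏ c ∈ Finset.range r, ((|(c : ℝ) - p| + 1) * L) :=
          Finset.prod_lt_prod_of_nonempty hne hdist (by simpa using (by omega : r ≠ 0))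
      _ = (∏ c ∈ Finset.range r, (|(c : ℝ) - p| + 1)) * L ^ r := by
          rw [Finset.prod_mul_distrib, Finset.prod_const, Finset.card_range]
      _ ≤ r ! * L ^ r := by
          gcongr
          exact prod_abs_sub_add_one_le hpr
  have hML : M * L ^ r ≤ |g x| := by
    rw [hL, div_pow, rpow_one_div_pow hr hs.le, mul_div_assoc', div_le_iff₀ (by positivity),
      mul_comm]
    exact mul_le_mul_of_nonneg_left (le_rho_pow hr hM) hs.le
  rcases hM.eq_or_lt with rfl | hM0
  · simp only [zero_div, zero_mul] at hb
    linarith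
  · have : M / r ! * ∏ c ∈ Finset.range r, |(x : ℝ) - z c| < M / r ! * (r ! * L ^ r) := by
      gcongr
    have h5 : M / r ! * (r ! * L ^ r) = M * L ^ r := by
      field_simp
    linarith

theorem prod_abs_rpow_one_div {ι : Type*} (s : Finset ι) (r : ℕ) (u : ι → ℝ) :
    ∏ i ∈ s, |u i| ^ (1 / (r : ℝ)) = (∏ i ∈ s, |u i|) ^ (1 / (r : ℝ)) :=
  Real.finsetProd_rpow _ _ (fun _ _ => abs_nonneg _) _

/-- Sets of small dispersion are detectors. -/
theorem isDetector_of_dispersion_le {r : ℕ} (hr : 1 ≤ r) {M : ℝ} (hM : 0 ≤ M) {d : ℕ} {ε : ℝ}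
    (h0 : 0 < ε) {P : Finset (Cube d)}
    (hP : dispersion P ≤ ENNReal.ofReal ((rho r M ^ d)⁻¹ * ε ^ (1 / (r : ℝ)))) :
    IsDetector r M d ε P := by
  rintro ⟨f, g, hg, rfl⟩ hf
  have hρ := rho_pos hr M
  obtain ⟨x, hx⟩ := exists_lt_abs_of_lt_norm hf
  simp only [Finset.abs_prod] at hx
  have hne : ∀ i, g i (x i) ≠ 0 := fun i h => by
    rw [Finset.prod_eq_zero (Finset.mem_univ i) (by simp [h])] at hx
    linarith
  choose α β hα hαβ hβ hlen hzero using fun i => exists_zero_free_interval hr hM (hg i) (hne i)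
  have hr0 : (0 : ℝ) < r := by exact_mod_cast hr
  obtain ⟨z, hz, hz'⟩ := (dispersion_le_iff (by positivity)).1 hP α β hα hαβ hβ (by
    calc (rho r M ^ d)⁻¹ * ε ^ (1 / (r : ℝ))
        < (rho r M ^ d)⁻¹ * (∏ i, |g i (x i)|) ^ (1 / (r : ℝ)) := by gcongr
      _ = ∏ i, (|g i (x i)| ^ (1 / (r : ℝ)) / rho r M) := by
        rw [Finset.prod_div_distrib, prod_abs_rpow_one_div]
        simp [div_eq_inv_mul]
      _ ≤ _ := Finset.prod_le_prod (fun i _ => by positivity) fun i _ => hlen i)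
  refine ⟨z, hz, ?_⟩
  show ∏ i, g i (z i) ≠ 0
  exact Finset.prod_ne_zero_iff.2 fun i _ => hzero i _ (hz' i).1 (hz' i).2

/-- The product of the factors vanishes at each of the given points, so by the pigeonhole
principle one of the factors has many zeros among their coordinates. -/
theorem exists_card_lt_of_prod_eq_zero {ι : Type*} [DecidableEq ι] (T : Finset ι) (n : ℕ)
    (u : ℕ → ι → ℝ) (h : ∀ j ≤ n * T.card, ∃ i ∈ T, u j i = 0) :
    ∃ i ∈ T, n < ((Finset.range (n * T.card + 1)).filter fun j => u j i = 0).card := by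
  have : Nonempty ι := ⟨(h 0 (Nat.zero_le _)).choose⟩
  choose! c hc hc0 using h
  obtain ⟨i, hi, hlt⟩ := Finset.exists_lt_card_fiber_of_mul_lt_card_of_maps_to
    (s := Finset.range (n * T.card + 1)) (t := T) (f := c) (n := n)
    (fun j hj => hc j (Nat.lt_succ_iff.1 (Finset.mem_range.1 hj)))
    (by rw [Finset.card_range, mul_comm]; exact Nat.lt_succ_self _)
  refine ⟨i, hi, hlt.trans_le (Finset.card_le_card fun j hj => ?_)⟩
  rw [Finset.mem_filter] at hj ⊢
  exact ⟨hj.1, by rw [← hj.2]; exact hc0 j (Nat.lt_succ_iff.1 (Finset.mem_range.1 hj.1))⟩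

/-! ### Shifted diagonal sets -/

/-- For `M ≤ r!`, a function of the class that is nonzero at `x` has less than `r` zeros in some
open interval of length `|g x|^(1/r)` with `x` in its closure. -/
theorem exists_interval_few_zeros {r : ℕ} (hr : 1 ≤ r) {M : ℝ} (hM : 0 ≤ M) (hMr : M ≤ r !)
    {g : I → ℝ} (hg : g ∈ factorClass r M) {x : I} (hx : g x ≠ 0) :
    ∃ a : ℝ, 0 ≤ a ∧ a + |g x| ^ (1 / (r : ℝ)) ≤ 1 ∧ ∀ Z : Finset I,
      (∀ z ∈ Z, a < z ∧ (z : ℝ) < a + |g x| ^ (1 / (r : ℝ)) ∧ g z = 0) → Z.card < r := by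
  have hs : 0 < |g x| := abs_pos.2 hx
  have hs1 : |g x| ≤ 1 := abs_le.2 (hg.1 x)
  set L : ℝ := |g x| ^ (1 / (r : ℝ)) with hL
  have hL0 : 0 < L := by positivity
  have hL1 : L ≤ 1 := Real.rpow_le_one hs.le hs1 (by positivity)
  set a : ℝ := min (x : ℝ) (1 - L) with ha
  have hax : a ≤ x := min_le_left _ _
  have hxa : (x : ℝ) ≤ a + L := by
    rcases min_choice (x : ℝ) (1 - L) with h | h
    · rw [ha, h]
      linarith
    · rw [ha, h]
      linarith [x.2.2]
  refine ⟨a, le_min x.2.1 (by linarith), by linarith [min_le_right (x : ℝ) (1 - L)], ?_⟩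
  intro Z hZ
  by_contra! hcard
  obtain ⟨Z', hZ', hcard'⟩ := Finset.exists_subset_card_eq hcard
  have hb := abs_le_of_zeros hM hg Z' id Function.injective_id.injOn hcard'
    (fun z hz => (hZ z (hZ' hz)).2.2) x
  have hprod : ∏ z ∈ Z', |(x : ℝ) - z| < ∏ _z ∈ Z', L := by
    refine Finset.prod_lt_prod_of_nonempty (fun z hz => ?_) (fun z hz => ?_)
      (Finset.card_pos.1 (by omega))
    · refine abs_pos.2 (sub_ne_zero.2 fun h => hx ?_)
      rw [Subtype.ext h]
      exact (hZ z (hZ' hz)).2.2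
    · obtain ⟨h1, h2, -⟩ := hZ z (hZ' hz)
      rw [abs_lt]
      constructor <;> linarith
  rw [Finset.prod_const, hcard', hL, rpow_one_div_pow hr hs.le] at hprod
  have hMle : M / r ! ≤ 1 := by
    rw [div_le_one (by positivity)]
    exact hMr
  have hnn : 0 ≤ ∏ z ∈ Z', |(x : ℝ) - z| := Finset.prod_nonneg fun _ _ => abs_nonneg _
  have : M / r ! * ∏ z ∈ Z', |(x : ℝ) - z| ≤ ∏ z ∈ Z', |(x : ℝ) - z| :=
    mul_le_of_le_one_left hnn hMle
  simp only [id] at hb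
  linarith

theorem two_rpow_neg_one_div_pow {d : ℕ} (hd : 1 ≤ d) :
    ((2 : ℝ) ^ (-(1 / (d : ℝ)))) ^ d = 1 / 2 := by
  rw [Real.rpow_neg zero_le_two, inv_pow, rpow_one_div_pow hd zero_le_two, one_div]

theorem gam_pos {r d : ℕ} (hd : 1 ≤ d) {ε : ℝ} (h0 : 0 < ε) : 0 < gam r d ε := by
  have hd0 : (0 : ℝ) < d := by exact_mod_cast hd
  have : (2 : ℝ) ^ (-(1 / (d : ℝ))) < 1 :=
    Real.rpow_lt_one_of_one_lt_of_neg (by norm_num) (by rw [neg_lt_zero]; positivity)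
  exact mul_pos (by linarith) (by positivity)

theorem gam_lt_one {r d : ℕ} {ε : ℝ} (h0 : 0 < ε) (h1 : ε < 1) :
    gam r d ε < 1 := by
  have h2 : (0 : ℝ) < (2 : ℝ) ^ (-(1 / (d : ℝ))) := by positivity
  have h3 : ε ^ (1 / (r : ℝ)) ≤ 1 := Real.rpow_le_one h0.le h1.le (by positivity)
  have h4 : 0 < ε ^ (1 / (r : ℝ)) := by positivity
  unfold gam
  nlinarith

theorem shiftedDiagonalSet_finite (r d : ℕ) (γ : ℝ) (P₀ : Finset (Cube d)) :
    ∃ P : Finset (Cube d), (P : Set (Cube d)) = shiftedDiagonalSet r d γ P₀ ∧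
      P.card ≤ P₀.card * ((r - 1) * d + 1) := by
  classical
  set Q : Finset (Cube d) := (P₀ ×ˢ Finset.range ((r - 1) * d + 1)).image fun t i =>
    projIcc (0 : ℝ) 1 zero_le_one ((1 - γ) * (t.1 i : ℝ) + γ * t.2 / ((r - 1) * d : ℕ)) with hQ
  have hsub : shiftedDiagonalSet r d γ P₀ ⊆ Q := by
    rintro x ⟨y, hy, j, hj, hx⟩
    rw [hQ, Finset.mem_coe, Finset.mem_image]
    refine ⟨(y, j), by simp [hy]; omega, funext fun i => ?_⟩
    simp only [← hx i, projIcc_val]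
  have hfin := Q.finite_toSet.subset hsub
  refine ⟨hfin.toFinset, by simp, ?_⟩
  calc hfin.toFinset.card ≤ Q.card := Finset.card_le_card (by simpa using hsub)
    _ ≤ _ := Finset.card_image_le
    _ = _ := by rw [Finset.card_product, Finset.card_range]

/-- For `M ≤ r!`, shifting a set of small dispersion along the diagonal yields a detector. -/
theorem isDetector_of_shiftedDiagonalSet {r : ℕ} (hr : 1 ≤ r) {M : ℝ} (hM : 0 ≤ M) (hMr : M ≤ r !)
    {d : ℕ} (hd : 1 ≤ d) {ε : ℝ} (h0 : 0 < ε) (h1 : ε < 1) {P₀ P : Finset (Cube d)}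
    (hP₀ : dispersion P₀ ≤ ENNReal.ofReal (ε ^ (1 / (r : ℝ)) / 2))
    (hP : (P : Set (Cube d)) = shiftedDiagonalSet r d (gam r d ε) P₀) :
    IsDetector r M d ε P := by
  classical
  rintro ⟨f, g, hg, rfl⟩ hf
  obtain ⟨x, hx⟩ := exists_lt_abs_of_lt_norm hf
  simp only [Finset.abs_prod] at hx
  have hne : ∀ i, g i (x i) ≠ 0 := fun i h => by
    rw [Finset.prod_eq_zero (Finset.mem_univ i) (by simp [h])] at hx
    linarith
  have hr0 : (0 : ℝ) < r := by exact_mod_cast hr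
  have hd0 : (0 : ℝ) < d := by exact_mod_cast hd
  choose a ha haL hfew using fun i => exists_interval_few_zeros hr hM hMr (hg i) (hne i)
  set L : Fin d → ℝ := fun i => |g i (x i)| ^ (1 / (r : ℝ)) with hL
  have hL0 : ∀ i, 0 < L i := fun i => by
    have := abs_pos.2 (hne i)
    positivity
  have hL1 : ∀ i, L i ≤ 1 := fun i =>
    Real.rpow_le_one (abs_nonneg _) (abs_le.2 ((hg i).1 _)) (by positivity)
  have hprod : ε ^ (1 / (r : ℝ)) < ∏ i, L i := by
    rw [hL, prod_abs_rpow_one_div]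
    gcongr
  set γ := gam r d ε with hγ
  have hγ0 : 0 < γ := gam_pos hd h0
  have hγ1 : γ < 1 := gam_lt_one h0 h1
  set τ : ℝ := (2 : ℝ) ^ (-(1 / (d : ℝ))) with hτ
  have hτ0 : 0 < τ := by positivity
  have hτ1 : τ < 1 :=
    Real.rpow_lt_one_of_one_lt_of_neg (by norm_num) (by rw [neg_lt_zero]; positivity)
  have hγL : ∀ i, γ < (1 - τ) * L i := fun i => by
    have h2 : ∏ j, L j ≤ L i := by
      rw [← Finset.mul_prod_erase _ _ (Finset.mem_univ i)]
      exact mul_le_of_le_one_right (hL0 i).le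
        (Finset.prod_le_one (fun j _ => (hL0 j).le) fun j _ => hL1 j)
    exact mul_lt_mul_of_pos_left (hprod.trans_le h2) (by linarith)
  have hlen : ∀ i, τ * L i ≤ (a i + L i - γ) / (1 - γ) - a i / (1 - γ) := fun i => by
    rw [← sub_div, le_div_iff₀ (by linarith)]
    have := hγL i
    have h3 : 0 < τ * L i := mul_pos hτ0 (hL0 i)
    nlinarith
  obtain ⟨y, hy, hy'⟩ := (dispersion_le_iff (by positivity)).1 hP₀
    (fun i => a i / (1 - γ)) (fun i => (a i + L i - γ) / (1 - γ))
    (fun i => div_nonneg (ha i) (by linarith))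
    (fun i => by linarith [hlen i, mul_pos hτ0 (hL0 i)])
    (fun i => by
      rw [div_le_one (by linarith)]
      linarith [haL i])
    (by
      calc ε ^ (1 / (r : ℝ)) / 2 < (∏ i, L i) / 2 := by gcongr
        _ = ∏ i, (τ * L i) := by
          rw [Finset.prod_mul_distrib, Finset.prod_const, Finset.card_univ, Fintype.card_fin,
            two_rpow_neg_one_div_pow hd]
          ring
        _ ≤ _ := Finset.prod_le_prod (fun i _ => (mul_pos hτ0 (hL0 i)).le) fun i _ => hlen i)
  -- the diagonal through `(1 - γ) y` stays in the box with few zeros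
  have hin : ∀ (i : Fin d) (j : ℕ), j ≤ (r - 1) * d →
      a i < (1 - γ) * (y i : ℝ) + γ * j / ((r - 1) * d : ℕ) ∧
        (1 - γ) * (y i : ℝ) + γ * j / ((r - 1) * d : ℕ) < a i + L i := by
    intro i j hj
    obtain ⟨h2, h3⟩ := hy' i
    rw [div_lt_iff₀ (by linarith)] at h2
    rw [lt_div_iff₀ (by linarith)] at h3
    have h4 : 0 ≤ γ * j / ((r - 1) * d : ℕ) := by positivity
    have h5 : γ * j / ((r - 1) * d : ℕ) ≤ γ := by
      rw [mul_div_assoc]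
      refine mul_le_of_le_one_right hγ0.le (div_le_one_of_le₀ ?_ (by positivity))
      exact_mod_cast hj
    constructor <;> linarith
  let pt : ℕ → Cube d := fun j i =>
    projIcc (0 : ℝ) 1 zero_le_one ((1 - γ) * (y i : ℝ) + γ * j / ((r - 1) * d : ℕ))
  have hpt : ∀ (i : Fin d) (j : ℕ), j ≤ (r - 1) * d →
      (pt j i : ℝ) = (1 - γ) * (y i : ℝ) + γ * j / ((r - 1) * d : ℕ) := fun i j hj => by
    obtain ⟨h2, h3⟩ := hin i j hj
    simp only [pt]
    rw [projIcc_of_mem _ ⟨by linarith [ha i], by linarith [haL i]⟩]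
  by_contra! hcon
  have hzero : ∀ j ≤ (r - 1) * (Finset.univ : Finset (Fin d)).card,
      ∃ i ∈ (Finset.univ : Finset (Fin d)), g i (pt j i) = 0 := by
    intro j hj
    rw [Finset.card_univ, Fintype.card_fin] at hj
    have hmem : pt j ∈ P := by
      rw [← Finset.mem_coe, hP]
      exact ⟨y, hy, j, hj, fun i => hpt i j hj⟩
    exact Finset.prod_eq_zero_iff.1 (hcon _ hmem)
  obtain ⟨i, -, hi⟩ := exists_card_lt_of_prod_eq_zero Finset.univ (r - 1)
    (fun j i => g i (pt j i)) hzero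
  rw [Finset.card_univ, Fintype.card_fin] at hi
  set T := (Finset.range ((r - 1) * d + 1)).filter fun j => g i (pt j i) = 0 with hT
  have hTle : ∀ j ∈ T, j ≤ (r - 1) * d := fun j hj =>
    Nat.lt_succ_iff.1 (Finset.mem_range.1 (Finset.mem_filter.1 hj).1)
  have hcard : (T.image fun j => pt j i).card = T.card := by
    refine Finset.card_image_of_injOn fun j hj j' hj' h => ?_
    have h2 : (pt j i : ℝ) = pt j' i := congrArg Subtype.val h
    rw [hpt i j (hTle j hj), hpt i j' (hTle j' hj')] at h2
    rcases Nat.eq_zero_or_pos ((r - 1) * d) with hz | hz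
    · have h3 := hTle j hj
      have h4 := hTle j' hj'
      omega
    · have hz' : (0 : ℝ) < ((r - 1) * d : ℕ) := by exact_mod_cast hz
      have h3 := add_left_cancel h2
      rw [div_left_inj' hz'.ne'] at h3
      exact_mod_cast mul_left_cancel₀ hγ0.ne' h3
  have := hfew i (T.image fun j => pt j i) (fun z hz => by
    obtain ⟨j, hj, rfl⟩ := Finset.mem_image.1 hz
    have h2 := hin i j (hTle j hj)
    rw [hpt i j (hTle j hj)]
    exact ⟨h2.1, h2.2, (Finset.mem_filter.1 hj).2⟩)
  omega

/-! ### Cross-diagonal sets -/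

/-- A function of the class with `r` zeros in `[1/2 - δ, 1/2 + δ]` is bounded by `C_δ`. -/
theorem abs_le_cDelta {r : ℕ} {M : ℝ} (hM : 0 ≤ M) {g : I → ℝ} (hg : g ∈ factorClass r M)
    {δ : ℝ} {Z : Finset I} (hcard : r ≤ Z.card)
    (hZ : ∀ z ∈ Z, |(z : ℝ) - 1 / 2| ≤ δ ∧ g z = 0) (x : I) : |g x| ≤ cDelta r M δ := by
  obtain ⟨Z', hZ', hcard'⟩ := Finset.exists_subset_card_eq hcard
  refine (abs_le_of_zeros hM hg Z' id Function.injective_id.injOn hcard'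
    (fun z hz => (hZ z (hZ' hz)).2) x).trans ?_
  have h1 : ∏ z ∈ Z', |(x : ℝ) - (id z : I)| ≤ ∏ _z ∈ Z', ((1 + 2 * δ) / 2) := by
    refine Finset.prod_le_prod (fun _ _ => abs_nonneg _) fun z hz => ?_
    have h2 := abs_le.1 (hZ z (hZ' hz)).1
    have h3 := x.2.1
    have h4 := x.2.2
    rw [abs_le]
    constructor <;> simp only [id] <;> linarith
  rw [Finset.prod_const, hcard'] at h1
  calc M / r ! * ∏ z ∈ Z', |(x : ℝ) - (id z : I)| ≤ M / r ! * ((1 + 2 * δ) / 2) ^ r := by gcongr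
    _ = cDelta r M δ := by
      rw [cDelta, div_pow]
      field_simp

theorem pseudoDim_le (r : ℕ) (M δ ε : ℝ) (d : ℕ) : pseudoDim r M δ ε d ≤ d :=
  Nat.findGreatest_le d

theorem lt_cDelta_pow_pseudoDim {r : ℕ} {M δ ε : ℝ} (h1 : ε < 1) (d : ℕ) :
    ε < cDelta r M δ ^ pseudoDim r M δ ε d := by
  classical
  have h : ε < cDelta r M δ ^ 0 := by simpa using h1
  exact Nat.findGreatest_spec (P := fun k => ε < cDelta r M δ ^ k) (Nat.zero_le d) h

theorem le_pseudoDim {r : ℕ} {M δ ε : ℝ} {d k : ℕ} (hk : k ≤ d) (h : ε < cDelta r M δ ^ k) :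
    k ≤ pseudoDim r M δ ε d := Nat.le_findGreatest hk h

theorem crossDiagonalSet_finite (r d d₀ : ℕ) (δ : ℝ) (P₁ : Finset (Cube d₀)) :
    ∃ P : Finset (Cube d), (P : Set (Cube d)) = crossDiagonalSet r d d₀ δ P₁ ∧
      P.card ≤ d.choose d₀ * (P₁.card * ((r - 1) * (d - d₀) + 1)) := by
  classical
  set n := (r - 1) * (d - d₀) with hn
  set Q : Finset (Cube d) := ((Finset.univ : Finset (Fin d)).powersetCard d₀ ×ˢ P₁ ×ˢ
    Finset.range (n + 1)).image fun t =>
      if hJ : t.1.card = d₀ then Function.extend (t.1.orderEmbOfFin hJ) t.2.1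
        fun _ => projIcc (0 : ℝ) 1 zero_le_one (1 / 2 - δ + 2 * δ * t.2.2 / (n : ℕ))
      else 0 with hQ
  have hsub : crossDiagonalSet r d d₀ δ P₁ ⊆ Q := by
    rintro x ⟨J, hJ, hxJ, j, hj, hx⟩
    rw [hQ, Finset.mem_coe, Finset.mem_image]
    refine ⟨(J, fun i => x (J.orderEmbOfFin hJ i), j), ?_, ?_⟩
    · simp only [Finset.mem_product, Finset.mem_powersetCard, Finset.subset_univ, true_and,
        Finset.mem_range]
      exact ⟨hJ, hxJ, by omega⟩
    · simp only [hJ, dite_true]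
      funext i
      by_cases hi : i ∈ J
      · rw [← Finset.mem_coe, ← Finset.range_orderEmbOfFin J hJ] at hi
        obtain ⟨l, rfl⟩ := hi
        rw [(J.orderEmbOfFin hJ).injective.extend_apply]
      · rw [Function.extend_apply' _ _ _ (by
          rintro ⟨l, rfl⟩
          exact hi (Finset.orderEmbOfFin_mem J hJ l)), ← hx i hi, projIcc_val]
  have hfin := Q.finite_toSet.subset hsub
  refine ⟨hfin.toFinset, by simp, ?_⟩
  calc hfin.toFinset.card ≤ Q.card := Finset.card_le_card (by simpa using hsub)
    _ ≤ _ := Finset.card_image_le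
    _ = _ := by simp [Finset.card_product, Finset.card_powersetCard]

/-- Only few factors of a function of norm greater than `ε` can have `r` zeros close to `1/2`. A
set of small dispersion in these coordinates, combined with the diagonal in the others, is a
detector. -/
theorem isDetector_of_crossDiagonalSet {r : ℕ} (hr : 1 ≤ r) {M : ℝ} (hM : 0 ≤ M) {δ : ℝ}
    (hδ : 0 < δ) (hδ' : δ ≤ 1 / 2) {d : ℕ} {ε : ℝ} (h0 : 0 < ε)
    {P₁ : Finset (Cube (pseudoDim r M δ ε d))} {P : Finset (Cube d)}
    (hP₁ : dispersion P₁ ≤ ENNReal.ofReal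
      ((rho r M ^ pseudoDim r M δ ε d)⁻¹ * ε ^ (1 / (r : ℝ))))
    (hP : (P : Set (Cube d)) = crossDiagonalSet r d (pseudoDim r M δ ε d) δ P₁) :
    IsDetector r M d ε P := by
  classical
  rintro ⟨f, g, hg, rfl⟩ hf
  have hρ := rho_pos hr M
  have hr0 : (0 : ℝ) < r := by exact_mod_cast hr
  obtain ⟨x, hx⟩ := exists_lt_abs_of_lt_norm hf
  simp only [Finset.abs_prod] at hx
  have hne : ∀ i, g i (x i) ≠ 0 := fun i h => by
    rw [Finset.prod_eq_zero (Finset.mem_univ i) (by simp [h])] at hx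
    linarith
  have hle1 : ∀ i, |g i (x i)| ≤ 1 := fun i => abs_le.2 ((hg i).1 _)
  have hsubprod : ∀ J : Finset (Fin d), ε < ∏ i ∈ J, |g i (x i)| := fun J => by
    refine hx.trans_le ?_
    rw [← Finset.prod_mul_prod_compl J]
    exact mul_le_of_le_one_right (Finset.prod_nonneg fun _ _ => abs_nonneg _)
      (Finset.prod_le_one (fun _ _ => abs_nonneg _) fun i _ => hle1 i)
  set d₀ := pseudoDim r M δ ε d with hd₀
  -- the coordinates whose factor has `r` zeros close to `1/2`
  set B : Finset (Fin d) := Finset.univ.filter fun i => ∃ Z : Finset I, r ≤ Z.card ∧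
    ∀ z ∈ Z, |(z : ℝ) - 1 / 2| ≤ δ ∧ g i z = 0 with hB
  have hBcard : B.card ≤ d₀ := by
    refine le_pseudoDim ((Finset.card_le_univ _).trans_eq (Fintype.card_fin d)) ?_
    refine (hsubprod B).trans_le ?_
    rw [← Finset.prod_const]
    refine Finset.prod_le_prod (fun _ _ => abs_nonneg _) fun i hi => ?_
    obtain ⟨Z, hZ, hZ'⟩ := (Finset.mem_filter.1 hi).2
    exact abs_le_cDelta hM (hg i) hZ hZ' _
  obtain ⟨J, hBJ, -, hJ⟩ := Finset.exists_subsuperset_card_eq (Finset.subset_univ B) hBcard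
    (by rw [Finset.card_univ, Fintype.card_fin]; exact pseudoDim_le _ _ _ _ _)
  choose α β hα hαβ hβ hlen hzero using fun i => exists_zero_free_interval hr hM (hg i) (hne i)
  set e := J.orderEmbOfFin hJ with he
  have hJprod : ∀ u : Fin d → ℝ, ∏ l, u (e l) = ∏ i ∈ J, u i := fun u => by
    rw [← Finset.map_orderEmbOfFin_univ J hJ, Finset.prod_map]
    rfl
  obtain ⟨y, hy, hy'⟩ := (dispersion_le_iff (by positivity)).1 hP₁ (fun l => α (e l))
    (fun l => β (e l)) (fun l => hα _) (fun l => hαβ _) (fun l => hβ _) (by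
      calc (rho r M ^ d₀)⁻¹ * ε ^ (1 / (r : ℝ))
          < (rho r M ^ d₀)⁻¹ * (∏ i ∈ J, |g i (x i)|) ^ (1 / (r : ℝ)) := by
            gcongr
            exact hsubprod J
        _ = ∏ i ∈ J, (|g i (x i)| ^ (1 / (r : ℝ)) / rho r M) := by
          rw [Finset.prod_div_distrib, prod_abs_rpow_one_div, Finset.prod_const, hJ]
          simp [div_eq_inv_mul]
        _ ≤ ∏ i ∈ J, (β i - α i) := Finset.prod_le_prod (fun i _ => by positivity) fun i _ => hlen i
        _ = _ := (hJprod fun i => β i - α i).symm)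
  set n := (r - 1) * (d - d₀) with hn
  let t : ℕ → I := fun j => projIcc (0 : ℝ) 1 zero_le_one (1 / 2 - δ + 2 * δ * j / (n : ℕ))
  have hfrac : ∀ j ≤ n, 0 ≤ 2 * δ * j / (n : ℕ) ∧ 2 * δ * j / (n : ℕ) ≤ 2 * δ := fun j hj => by
    refine ⟨by positivity, ?_⟩
    rw [mul_div_assoc]
    refine mul_le_of_le_one_right (by positivity) (div_le_one_of_le₀ ?_ (by positivity))
    exact_mod_cast hj
  have ht : ∀ j ≤ n, (t j : ℝ) = 1 / 2 - δ + 2 * δ * j / (n : ℕ) := fun j hj => by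
    obtain ⟨h2, h3⟩ := hfrac j hj
    simp only [t]
    rw [projIcc_of_mem _ ⟨by linarith, by linarith⟩]
  let pt : ℕ → Cube d := fun j => Function.extend e y fun _ => t j
  have hptJ : ∀ j l, pt j (e l) = y l := fun j l => e.injective.extend_apply _ _ _
  have hptJc : ∀ j, ∀ i ∉ J, pt j i = t j := fun j i hi => Function.extend_apply' _ _ _ (by
    rintro ⟨l, rfl⟩
    exact hi (Finset.orderEmbOfFin_mem J hJ l))
  by_contra! hcon
  have hJc : Jᶜ.card = d - d₀ := by rw [Finset.card_compl, hJ, Fintype.card_fin]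
  have hz : ∀ j ≤ (r - 1) * Jᶜ.card, ∃ i ∈ Jᶜ, g i (pt j i) = 0 := by
    intro j hj
    rw [hJc] at hj
    have hmem : pt j ∈ P := by
      rw [← Finset.mem_coe, hP]
      refine ⟨J, hJ, ?_, j, hj, fun i hi => ?_⟩
      · simp only [← he, hptJ]
        exact hy
      · rw [hptJc j i hi]
        exact ht j hj
    have hprod : ∏ i, g i (pt j i) = 0 := hcon _ hmem
    obtain ⟨i, -, hi⟩ := Finset.prod_eq_zero_iff.1 hprod
    refine ⟨i, Finset.mem_compl.2 fun hiJ => ?_, hi⟩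
    rw [← Finset.mem_coe, ← Finset.range_orderEmbOfFin J hJ] at hiJ
    obtain ⟨l, rfl⟩ := hiJ
    rw [← he, hptJ] at hi
    exact hzero _ _ (hy' l).1 (hy' l).2 hi
  obtain ⟨i, hiJ, hi⟩ := exists_card_lt_of_prod_eq_zero Jᶜ (r - 1) (fun j i => g i (pt j i)) hz
  rw [hJc, ← hn] at hi
  rw [Finset.mem_compl] at hiJ
  refine hiJ (hBJ (Finset.mem_filter.2 ⟨Finset.mem_univ _, ?_⟩))
  set T := (Finset.range (n + 1)).filter fun j => g i (pt j i) = 0 with hT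
  have hTle : ∀ j ∈ T, j ≤ n := fun j hj =>
    Nat.lt_succ_iff.1 (Finset.mem_range.1 (Finset.mem_filter.1 hj).1)
  refine ⟨T.image t, ?_, fun z hz => ?_⟩
  · rw [Finset.card_image_of_injOn]
    · omega
    · intro j hj j' hj' h
      have h2 : (t j : ℝ) = t j' := congrArg Subtype.val h
      rw [ht j (hTle j hj), ht j' (hTle j' hj')] at h2
      rcases Nat.eq_zero_or_pos n with hz | hz
      · have h3 := hTle j hj
        have h4 := hTle j' hj'
        omega
      · have hz' : (0 : ℝ) < (n : ℕ) := by exact_mod_cast hz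
        have h3 := add_left_cancel h2
        rw [div_left_inj' hz'.ne'] at h3
        exact_mod_cast mul_left_cancel₀ (by positivity : (2 * δ) ≠ 0) h3
  · obtain ⟨j, hj, rfl⟩ := Finset.mem_image.1 hz
    have hj' := (Finset.mem_filter.1 hj).2
    rw [hptJc j i hiJ] at hj'
    refine ⟨?_, hj'⟩
    obtain ⟨h2, h3⟩ := hfrac j (hTle j hj)
    rw [ht j (hTle j hj), abs_le]
    constructor <;> linarith

/-! ### Cardinality of the detectors -/

theorem one_le_rpow_neg {ε : ℝ} (h0 : 0 < ε) (h1 : ε < 1) (r : ℕ) :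
    1 ≤ ε ^ (-(1 / (r : ℝ))) :=
  Real.one_le_rpow_of_pos_of_le_one_of_nonpos h0 h1.le (by rw [neg_nonpos]; positivity)

theorem sampleBudget_add_one_le {r : ℕ} (hr : 1 ≤ r) {C : ℝ} (hC : 0 ≤ C) {d : ℕ} (hd : 1 ≤ d)
    {ε : ℝ} (h0 : 0 < ε) (h1 : ε < 1) :
    (sampleBudget r C d ε : ℝ) + 1 ≤ (C + 1) * (d : ℝ) ^ 2 * ε ^ (-(1 / (r : ℝ))) := by
  have hd1 : (1 : ℝ) ≤ d := by exact_mod_cast hd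
  have hr1 : (1 : ℝ) ≤ r := by exact_mod_cast hr
  have hE := one_le_rpow_neg h0 h1 r
  set E := ε ^ (-(1 / (r : ℝ))) with hEdef
  have h2 : (d : ℝ) ^ (1 + 1 / (r : ℝ)) ≤ (d : ℝ) ^ 2 := by
    rw [← Real.rpow_two]
    refine Real.rpow_le_rpow_of_exponent_le hd1 ?_
    have : 1 / (r : ℝ) ≤ 1 := by
      rw [div_le_one (by linarith)]
      exact hr1
    linarith
  have h3 : (sampleBudget r C d ε : ℝ) ≤ C * (d : ℝ) ^ 2 * E := by
    refine (Nat.floor_le (by positivity)).trans ?_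
    gcongr
  have h4 : (1 : ℝ) ≤ (d : ℝ) ^ 2 * E := one_le_mul_of_one_le_of_one_le (one_le_pow₀ hd1) hE
  nlinarith

theorem inv_rho_mul_rpow {r : ℕ} (hr : 1 ≤ r) (M : ℝ) {ε : ℝ} (h0 : 0 < ε) (h1 : ε < 1) (k : ℕ) :
    0 < (rho r M ^ k)⁻¹ * ε ^ (1 / (r : ℝ)) ∧ (rho r M ^ k)⁻¹ * ε ^ (1 / (r : ℝ)) < 1 ∧
      ((rho r M ^ k)⁻¹ * ε ^ (1 / (r : ℝ)))⁻¹ = rho r M ^ k * ε ^ (-(1 / (r : ℝ))) := by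
  have hρ := rho_pos hr M
  have hr0 : (0 : ℝ) < r := by exact_mod_cast hr
  have hρ1 : 1 ≤ rho r M := le_max_of_le_left (by exact_mod_cast hr)
  have h2 : ε ^ (1 / (r : ℝ)) < 1 := Real.rpow_lt_one h0.le h1 (by positivity)
  refine ⟨by positivity, ?_, ?_⟩
  · exact (mul_le_of_le_one_left (by positivity) (inv_le_one_of_one_le₀ (one_le_pow₀ hρ1))).trans_lt
      h2
  · rw [mul_inv, inv_inv, Real.rpow_neg h0.le]

/-- The detector of small dispersion has at most exponentially many points. -/
theorem exists_exponentialBound {r : ℕ} (hr : 1 ≤ r) (M : ℝ) {C : ℝ} (hC : 0 ≤ C) :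
    ∃ c : ℝ, 0 < c ∧ ∀ d : ℕ, 1 ≤ d → ∀ ε : ℝ, 0 < ε → ε < 1 → ∃ P : Finset (Cube d),
      dispersion P ≤ ENNReal.ofReal ((rho r M ^ d)⁻¹ * ε ^ (1 / (r : ℝ))) ∧
      (P.card : ℝ) + sampleBudget r C d ε + 1 ≤ exponentialBound r c d ε := by
  obtain ⟨A, hA, h⟩ := exists_dispersion_le_exponential
  have hρ := rho_pos hr M
  refine ⟨A * rho r M + 4 * (C + 1), by positivity, fun d hd ε h0 h1 => ?_⟩
  obtain ⟨hη0, hη1, hη⟩ := inv_rho_mul_rpow hr M h0 h1 d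
  obtain ⟨P, hP, hcard⟩ := h d hd _ hη0 hη1
  refine ⟨P, hP, ?_⟩
  rw [hη] at hcard
  have hm := sampleBudget_add_one_le hr hC hd h0 h1
  have hE := one_le_rpow_neg h0 h1 r
  rw [exponentialBound]
  set E := ε ^ (-(1 / (r : ℝ))) with hEdef
  have h4 : (d : ℝ) ^ 2 ≤ 4 ^ d := by
    have : (d : ℝ) ≤ 2 ^ d := by exact_mod_cast d.lt_two_pow_self.le
    calc (d : ℝ) ^ 2 ≤ (2 ^ d) ^ 2 := by gcongr
      _ = 4 ^ d := by rw [← pow_mul, mul_comm, pow_mul]; norm_num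
  calc (P.card : ℝ) + sampleBudget r C d ε + 1
      ≤ A ^ d * (rho r M ^ d * E) + (C + 1) * (d : ℝ) ^ 2 * E := by linarith
    _ ≤ (A * rho r M) ^ d * E + (C + 1) ^ d * 4 ^ d * E := by
        rw [← mul_assoc, ← mul_pow]
        gcongr
        exact le_self_pow₀ (by linarith) (by omega)
    _ = ((A * rho r M) ^ d + (4 * (C + 1)) ^ d) * E := by rw [mul_pow 4]; ring
    _ ≤ (A * rho r M + 4 * (C + 1)) ^ d * E := by
        gcongr
        exact pow_add_pow_le (by positivity) (by positivity) (by omega)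

/-- The dispersion that a shifted diagonal set needs does not decay in `d`, so that its size is
polynomial. -/
theorem exists_polynomialBound {r : ℕ} (hr : 1 ≤ r) {C : ℝ} (hC : 0 ≤ C) :
    ∃ c : ℝ, 0 < c ∧ ∀ d : ℕ, 1 ≤ d → ∀ ε : ℝ, 0 < ε → ε < 1 → ∃ P₀ P : Finset (Cube d),
      dispersion P₀ ≤ ENNReal.ofReal (ε ^ (1 / (r : ℝ)) / 2) ∧
      (P : Set (Cube d)) = shiftedDiagonalSet r d (gam r d ε) P₀ ∧
      (P.card : ℝ) + sampleBudget r C d ε + 1 ≤ polynomialBound r c d ε := by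
  have hr1 : (1 : ℝ) ≤ r := by exact_mod_cast hr
  refine ⟨52 * r + (C + 1), by positivity, fun d hd ε h0 h1 => ?_⟩
  have hd1 : (1 : ℝ) ≤ d := by exact_mod_cast hd
  have he1 : ε ^ (1 / (r : ℝ)) < 1 := Real.rpow_lt_one h0.le h1 (by positivity)
  obtain ⟨P₀, hP₀, hcard₀⟩ := exists_dispersion_le_linear hd
    (η := ε ^ (1 / (r : ℝ)) / 2) (by positivity) (by linarith)
  obtain ⟨P, hP, hcard⟩ := shiftedDiagonalSet_finite r d (gam r d ε) P₀
  refine ⟨P₀, P, hP₀, hP, ?_⟩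
  have hm := sampleBudget_add_one_le hr hC hd h0 h1
  have hE := one_le_rpow_neg h0 h1 r
  have hinv : (ε ^ (1 / (r : ℝ)) / 2)⁻¹ = 2 * ε ^ (-(1 / (r : ℝ))) := by
    rw [inv_div, Real.rpow_neg h0.le]
    rfl
  rw [hinv] at hcard₀
  rw [polynomialBound]
  set E := ε ^ (-(1 / (r : ℝ))) with hEdef
  have hlog : 0 ≤ Real.log E := Real.log_nonneg hE
  have hlog2 : Real.log (2 * E) ≤ 1 + Real.log E := by
    rw [Real.log_mul two_ne_zero (by linarith)]
    linarith [Real.log_two_lt_d9]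
  have hP₀' : (P₀.card : ℝ) ≤ 52 * d * E * (1 + Real.log E) := by
    calc (P₀.card : ℝ) ≤ 13 * d * (2 * E) * (1 + Real.log (2 * E)) := hcard₀
      _ ≤ 13 * d * (2 * E) * (2 * (1 + Real.log E)) := by
          gcongr
          linarith
      _ = 52 * d * E * (1 + Real.log E) := by ring
  have hrd : (((r - 1) * d + 1 : ℕ) : ℝ) ≤ r * d := by
    have : (r - 1) * d + 1 ≤ r * d := by
      obtain ⟨n, rfl⟩ := Nat.exists_eq_add_of_le' hr
      rw [Nat.add_sub_cancel, add_mul]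
      omega
    exact_mod_cast this
  have hcard' : (P.card : ℝ) ≤ 52 * d * E * (1 + Real.log E) * (r * d) := by
    calc (P.card : ℝ) ≤ ((P₀.card * ((r - 1) * d + 1) : ℕ) : ℝ) := by exact_mod_cast hcard
      _ = (P₀.card : ℝ) * (((r - 1) * d + 1 : ℕ) : ℝ) := by push_cast; ring
      _ ≤ _ := by gcongr
  have h5 : (C + 1) * (d : ℝ) ^ 2 * E ≤ (C + 1) * (d : ℝ) ^ 2 * E * (1 + Real.log E) :=
    le_mul_of_one_le_right (by positivity) (by linarith)
  calc (P.card : ℝ) + sampleBudget r C d ε + 1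
      ≤ 52 * d * E * (1 + Real.log E) * (r * d) + (C + 1) * (d : ℝ) ^ 2 * E * (1 + Real.log E) := by
        linarith
    _ = _ := by ring

theorem exists_cDelta_lt_one {r : ℕ} {M : ℝ} (hM' : M < 2 ^ r * (r ! : ℝ)) :
    ∃ δ : ℝ, 0 < δ ∧ δ ≤ 1 / 2 ∧ cDelta r M δ < 1 := by
  have hcont : Continuous (cDelta r M) := by
    unfold cDelta
    fun_prop
  have h0 : cDelta r M 0 < 1 := by
    rw [cDelta, div_lt_one (by positivity)]
    simpa using hM'
  have h1 : ∀ᶠ δ in nhdsWithin (0 : ℝ) (Ioi 0), cDelta r M δ < 1 :=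
    (hcont.continuousAt.eventually_lt continuousAt_const h0).filter_mono nhdsWithin_le_nhds
  have h2 : ∀ᶠ δ in nhdsWithin (0 : ℝ) (Ioi 0), δ ∈ Ioc (0 : ℝ) (1 / 2) :=
    Ioc_mem_nhdsGT (by norm_num)
  obtain ⟨δ, hδ, hδ'⟩ := (h1.and h2).exists
  exact ⟨δ, hδ'.1, hδ'.2, hδ⟩

/-- As `d₀` is at most a multiple of `ln ε⁻¹`, the number `d.choose d₀` of index sets and the size
of a set of small dispersion in `d₀` dimensions are quasi-polynomial. -/
theorem exists_quasiPolynomialBound {r : ℕ} (hr : 1 ≤ r) {M : ℝ} (hM : 0 < M) {C : ℝ} (hC : 0 ≤ C)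
    {δ : ℝ} (hδ : 0 < δ) (hδ1 : cDelta r M δ < 1) :
    ∃ c c' : ℝ, 0 < c ∧ 0 < c' ∧ ∀ d : ℕ, 1 ≤ d → ∀ ε : ℝ, 0 < ε → ε < 1 →
      ∃ (P₁ : Finset (Cube (pseudoDim r M δ ε d))) (P : Finset (Cube d)),
        dispersion P₁ ≤ ENNReal.ofReal
          ((rho r M ^ pseudoDim r M δ ε d)⁻¹ * ε ^ (1 / (r : ℝ))) ∧
        (P : Set (Cube d)) = crossDiagonalSet r d (pseudoDim r M δ ε d) δ P₁ ∧
        (P.card : ℝ) + sampleBudget r C d ε + 1 ≤ quasiPolynomialBound c c' d ε := by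
  obtain ⟨A, hA, h⟩ := exists_dispersion_le_exponential
  have hρ := rho_pos hr M
  have hρ1 : 1 ≤ rho r M := le_max_of_le_left (by exact_mod_cast hr)
  have hr1 : (1 : ℝ) ≤ r := by exact_mod_cast hr
  have hC0 : 0 < cDelta r M δ := by
    unfold cDelta
    positivity
  set lam : ℝ := -Real.log (cDelta r M δ) with hlam
  have hlam0 : 0 < lam := neg_pos.2 (Real.log_neg hC0 hδ1)
  set B : ℝ := Real.log (A * rho r M) with hB
  have hAρ : 1 ≤ A * rho r M := one_le_mul_of_one_le_of_one_le hA hρ1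
  have hB0 : 0 ≤ B := Real.log_nonneg hAρ
  refine ⟨r + (C + 1), lam⁻¹ + B * lam⁻¹ + 3, by positivity, by positivity,
    fun d hd ε h0 h1 => ?_⟩
  have hd1 : (1 : ℝ) ≤ d := by exact_mod_cast hd
  have hd0 : (0 : ℝ) < d := by linarith
  have hlt := lt_cDelta_pow_pseudoDim (r := r) (M := M) (δ := δ) h1 d
  have hE := one_le_rpow_neg h0 h1 r
  have hdd := pseudoDim_le r M δ ε d
  -- a set of small dispersion in `d₀` dimensions, where `d₀ = 0` is possible
  obtain ⟨P₁, hP₁, hcard₁⟩ : ∃ P₁ : Finset (Cube (pseudoDim r M δ ε d)),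
      dispersion P₁ ≤ ENNReal.ofReal
        ((rho r M ^ pseudoDim r M δ ε d)⁻¹ * ε ^ (1 / (r : ℝ))) ∧
      (P₁.card : ℝ) ≤ (A * rho r M) ^ pseudoDim r M δ ε d * ε ^ (-(1 / (r : ℝ))) := by
    generalize pseudoDim r M δ ε d = k
    obtain ⟨hη0, hη1, hη⟩ := inv_rho_mul_rpow hr M h0 h1 k
    rcases Nat.eq_zero_or_pos k with rfl | hk
    · exact ⟨{0}, dispersion_zero_dim _ (Finset.singleton_nonempty _) hη0.le, by simpa using hE⟩
    · obtain ⟨P₁, hP₁, hcard⟩ := h k hk _ hη0 hη1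
      refine ⟨P₁, hP₁, hcard.trans_eq ?_⟩
      rw [hη, mul_pow, mul_assoc]
  obtain ⟨P, hP, hcard⟩ := crossDiagonalSet_finite r d (pseudoDim r M δ ε d) δ P₁
  refine ⟨P₁, P, hP₁, hP, ?_⟩
  generalize pseudoDim r M δ ε d = k at *
  have hm := sampleBudget_add_one_le hr hC hd h0 h1
  set ℓ := Real.log ε⁻¹ with hℓ
  have hℓ0 : 0 ≤ ℓ := Real.log_nonneg ((one_le_inv₀ h0).2 h1.le)
  set D := Real.log d with hD
  have hD0 : 0 ≤ D := Real.log_nonneg hd1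
  have hexpD : Real.exp D = d := Real.exp_log hd0
  have hEexp : ε ^ (-(1 / (r : ℝ))) ≤ Real.exp ℓ := by
    rw [hℓ, Real.exp_log (inv_pos.2 h0), ← Real.rpow_neg_one]
    refine Real.rpow_le_rpow_of_exponent_ge h0 h1.le ?_
    rw [neg_le_neg_iff, div_le_one (by linarith)]
    exact hr1
  set E := ε ^ (-(1 / (r : ℝ))) with hEdef
  have hk : (k : ℝ) ≤ ℓ * lam⁻¹ := by
    rw [← div_eq_mul_inv, le_div_iff₀ hlam0]
    have h2 := Real.log_lt_log h0 hlt
    rw [Real.log_pow] at h2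
    rw [hℓ, Real.log_inv, hlam]
    linarith
  have hchoose : (d.choose k : ℝ) ≤ Real.exp (k * D) := by
    rw [Real.exp_nat_mul, hexpD]
    exact_mod_cast Nat.choose_le_pow d k
  have hpow : (A * rho r M) ^ k = Real.exp (k * B) := by
    rw [Real.exp_nat_mul, hB, Real.exp_log (by linarith)]
  have hrd : (((r - 1) * (d - k) + 1 : ℕ) : ℝ) ≤ r * Real.exp D := by
    rw [hexpD]
    have : (r - 1) * (d - k) + 1 ≤ r * d := by
      obtain ⟨n, rfl⟩ := Nat.exists_eq_add_of_le' hr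
      rw [Nat.add_sub_cancel, add_mul]
      have := Nat.mul_le_mul_left n (Nat.sub_le d k)
      omega
    exact_mod_cast this
  have hcard' : (P.card : ℝ) ≤ r * Real.exp (k * D + k * B + ℓ + D) := by
    calc (P.card : ℝ) ≤ ((d.choose k * (P₁.card * ((r - 1) * (d - k) + 1)) : ℕ) : ℝ) := by
          exact_mod_cast hcard
      _ = (d.choose k : ℝ) * (P₁.card * (((r - 1) * (d - k) + 1 : ℕ) : ℝ)) := by
          push_cast
          ring
      _ ≤ Real.exp (k * D) * ((Real.exp (k * B) * Real.exp ℓ) * (r * Real.exp D)) := by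
          gcongr
          exact hcard₁.trans (by rw [hpow]; gcongr)
      _ = _ := by
          rw [Real.exp_add, Real.exp_add, Real.exp_add]
          ring
  have hm' : (C + 1) * (d : ℝ) ^ 2 * E ≤ (C + 1) * Real.exp (2 * D + ℓ) := by
    rw [Real.exp_add, show (2 : ℝ) * D = (2 : ℕ) * D by norm_num, Real.exp_nat_mul, hexpD,
      mul_assoc]
    gcongr
  have hkD : (k : ℝ) * D ≤ lam⁻¹ * (ℓ * D) :=
    (mul_le_mul_of_nonneg_right hk hD0).trans_eq (by ring)
  have hkB : (k : ℝ) * B ≤ B * lam⁻¹ * ℓ := (mul_le_mul_of_nonneg_right hk hB0).trans_eq (by ring)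
  have e1 : k * D + k * B + ℓ + D ≤ (lam⁻¹ + B * lam⁻¹ + 3) * (1 + ℓ) * (1 + D) := by
    have h2 : (lam⁻¹ + B * lam⁻¹ + 3) * (1 + ℓ) * (1 + D) =
        lam⁻¹ * (ℓ * D) + B * lam⁻¹ * ℓ + ℓ + D + (lam⁻¹ * (1 + ℓ + D) +
          B * lam⁻¹ * (1 + D + ℓ * D) + 3 + 2 * ℓ + 2 * D + 3 * (ℓ * D)) := by ring
    have h3 : 0 ≤ lam⁻¹ * (1 + ℓ + D) + B * lam⁻¹ * (1 + D + ℓ * D) + 3 + 2 * ℓ + 2 * D +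
      3 * (ℓ * D) := by positivity
    linarith
  have e2 : 2 * D + ℓ ≤ (lam⁻¹ + B * lam⁻¹ + 3) * (1 + ℓ) * (1 + D) := by
    have h2 : (lam⁻¹ + B * lam⁻¹ + 3) * (1 + ℓ) * (1 + D) = 2 * D + ℓ +
        ((lam⁻¹ + B * lam⁻¹) * (1 + ℓ + D + ℓ * D) + 3 + 2 * ℓ + D + 3 * (ℓ * D)) := by ring
    have h3 : 0 ≤ (lam⁻¹ + B * lam⁻¹) * (1 + ℓ + D + ℓ * D) + 3 + 2 * ℓ + D + 3 * (ℓ * D) := by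
      positivity
    linarith
  calc (P.card : ℝ) + sampleBudget r C d ε + 1
      ≤ r * Real.exp (k * D + k * B + ℓ + D) + (C + 1) * Real.exp (2 * D + ℓ) := by linarith
    _ ≤ r * Real.exp ((lam⁻¹ + B * lam⁻¹ + 3) * (1 + ℓ) * (1 + D)) +
          (C + 1) * Real.exp ((lam⁻¹ + B * lam⁻¹ + 3) * (1 + ℓ) * (1 + D)) := by gcongr
    _ = quasiPolynomialBound (r + (C + 1)) (lam⁻¹ + B * lam⁻¹ + 3) d ε := by
        rw [quasiPolynomialBound]
        ring

/-- If there is a detector, there is one of minimal cardinality. -/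
theorem exists_isDetector_card_minimal {r : ℕ} {M : ℝ} {d : ℕ} {ε : ℝ}
    (h : ∃ P, IsDetector r M d ε P) :
    ∃ P, IsDetector r M d ε P ∧ ∀ Q, IsDetector r M d ε Q → P.card ≤ Q.card := by
  classical
  have hex : ∃ n, ∃ P, IsDetector r M d ε P ∧ P.card = n := by
    obtain ⟨P, hP⟩ := h
    exact ⟨_, P, hP, rfl⟩
  obtain ⟨P, hP, hcard⟩ := Nat.find_spec hex
  exact ⟨P, hP, fun Q hQ => hcard.trans_le (Nat.find_min' hex ⟨Q, hQ, rfl⟩)⟩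

/-! ### Complexity -/

theorem comp_le_of_err_le {p : Problem} {ε : ℝ} (A : p.Alg) (h : p.err A ≤ ENNReal.ofReal ε) :
    p.comp ε ≤ p.cost A := sInf_le ⟨A, h, rfl⟩

theorem comp_antitone (p : Problem) {ε ε' : ℝ} (h : ε ≤ ε') : p.comp ε' ≤ p.comp ε := by
  refine le_sInf ?_
  rintro _ ⟨A, hA, rfl⟩
  exact comp_le_of_err_le A (hA.trans (ENNReal.ofReal_le_ofReal h))

theorem DetectorAlgorithmBound.comp_le {r : ℕ} {M : ℝ} {d : ℕ} {ε : ℝ} {P : Finset (Cube d)} {m : ℕ}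
    {b : ℝ} (h : DetectorAlgorithmBound r M d ε P m b) :
    ((appProblem r M d).comp ε : ℝ≥0∞) ≤ ENNReal.ofReal b :=
  le_trans (by exact_mod_cast comp_le_of_err_le (p := appProblem r M d) ⟨_, h.2.1⟩ h.2.2.1) h.2.2.2

theorem natCast_le_of_le_comp {n : ℕ} {x : ℕ∞} {b : ℝ} (hb : 0 ≤ b) (h : (n : ℕ∞) ≤ x)
    (h' : (x : ℝ≥0∞) ≤ ENNReal.ofReal b) : (n : ℝ) ≤ b := by
  have h1 : ((n : ℕ∞) : ℝ≥0∞) ≤ ENNReal.ofReal b := le_trans (by exact_mod_cast h) h'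
  rw [ENat.toENNReal_coe, ← ENNReal.ofReal_natCast] at h1
  exact (ENNReal.ofReal_le_ofReal_iff hb).1 h1

theorem factorClass_mono {r : ℕ} {M M₁ : ℝ} (h : M ≤ M₁) : factorClass r M ⊆ factorClass r M₁ :=
  fun _ ⟨h1, h2, u, hu, hw, hn⟩ => ⟨h1, h2, u, hu, hw, hn.trans (ENNReal.ofReal_le_ofReal h)⟩

theorem IsDetector.mono {r : ℕ} {M M₁ : ℝ} (h : M ≤ M₁) {d : ℕ} {ε : ℝ} {P : Finset (Cube d)}
    (hP : IsDetector r M₁ d ε P) : IsDetector r M d ε P := by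
  rintro ⟨f, g, hg, rfl⟩ hf
  exact hP ⟨_, g, fun i => factorClass_mono h (hg i), rfl⟩ hf

/-- For `M = 0`, the class is contained in the class for `M = 1`, to which the same upper bounds
apply. -/
theorem exists_pos_parameter {r : ℕ} (hr : 1 ≤ r) {M : ℝ} (hM : 0 ≤ M) :
    ∃ M₁ : ℝ, 0 < M₁ ∧ M ≤ M₁ ∧ (M < 2 ^ r * (r ! : ℝ) → M₁ < 2 ^ r * (r ! : ℝ)) ∧
      (M ≤ (r ! : ℝ) → M₁ ≤ (r ! : ℝ)) := by
  rcases hM.eq_or_lt with rfl | hM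
  · have h1 : (1 : ℝ) ≤ r ! := by exact_mod_cast Nat.factorial_pos r
    have h2 : (1 : ℝ) < 2 ^ r := one_lt_pow₀ (by norm_num) (by omega)
    exact ⟨1, one_pos, zero_le_one, fun _ => by nlinarith, fun _ => h1⟩
  · exact ⟨M, hM, le_rfl, id, id⟩

theorem quasiPolynomiallyTractable {r : ℕ} (hr : 1 ≤ r) {M : ℝ} (hM : 0 ≤ M)
    (hM' : M < 2 ^ r * (r ! : ℝ)) : QuasiPolynomiallyTractable (appProblem r M) := by
  obtain ⟨M₁, hM₁, hMM, h1, -⟩ := exists_pos_parameter hr hM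
  obtain ⟨δ, hδ, hδ', hδ1⟩ := exists_cDelta_lt_one (h1 hM')
  obtain ⟨c, t, hc, ht, h⟩ := exists_quasiPolynomialBound hr hM₁
    (C := 2 * r * (2 * M₁ + 1)) (by positivity) hδ hδ1
  refine ⟨c, t, hc, ht, fun ε hε0 hε1 d hd => ?_⟩
  obtain ⟨P₁, P, hP₁, hP, hb⟩ := h d hd ε hε0 hε1
  exact (detectorAlgorithmBound_of_isDetector hr hM hMM hd hε0 hε1
    ((isDetector_of_crossDiagonalSet hr hM₁.le hδ hδ' hε0 hP₁ hP).mono hMM) hb).comp_le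

theorem polynomiallyTractable {r : ℕ} (hr : 1 ≤ r) {M : ℝ} (hM : 0 ≤ M) (hM' : M ≤ (r ! : ℝ)) :
    PolynomiallyTractable (appProblem r M) := by
  obtain ⟨M₁, hM₁, hMM, -, h1⟩ := exists_pos_parameter hr hM
  have hr0 : (0 : ℝ) < r := by exact_mod_cast hr
  obtain ⟨c, hc, h⟩ := exists_polynomialBound hr (C := 2 * r * (2 * M₁ + 1)) (by positivity)
  refine ⟨c, 2, 2 / r, hc, two_pos, by positivity, fun ε hε0 hε1 d hd => ?_⟩
  obtain ⟨P₀, P, hP₀, hP, hb⟩ := h d hd ε hε0 hε1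
  refine (detectorAlgorithmBound_of_isDetector hr hM hMM hd hε0 hε1
    ((isDetector_of_shiftedDiagonalSet hr hM₁.le (h1 hM') hd hε0 hε1 hP₀ hP).mono hMM)
    hb).comp_le.trans (ENNReal.ofReal_le_ofReal ?_)
  have hE := one_le_rpow_neg hε0 hε1 r
  have hsq : ε ^ (-(2 / (r : ℝ))) = ε ^ (-(1 / (r : ℝ))) * ε ^ (-(1 / (r : ℝ))) := by
    rw [← Real.rpow_add hε0]
    congr 1
    ring
  rw [polynomialBound, hsq, Real.rpow_two]
  set E := ε ^ (-(1 / (r : ℝ))) with hEdef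
  have hlog := Real.log_le_sub_one_of_pos (by linarith : 0 < E)
  calc c * (d : ℝ) ^ 2 * E * (1 + Real.log E) ≤ c * (d : ℝ) ^ 2 * E * E := by
        gcongr
        linarith
    _ = _ := by ring

theorem curseOfDimensionality {r : ℕ} (hr : 1 ≤ r) {M : ℝ} (hM : 2 ^ r * (r ! : ℝ) ≤ M) :
    CurseOfDimensionality (appProblem r M) := by
  refine ⟨1 / 2, 1, 2, by norm_num, one_pos, by norm_num, fun d hd => ?_⟩
  have h := two_pow_le_comp hr hM hd (ε := 1 / 2) (by norm_num) (by norm_num)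
  have h1 : (((2 ^ d : ℕ) : ℕ∞) : ℝ≥0∞) ≤ ((appProblem r M d).comp (1 / 2) : ℝ≥0∞) := by
    exact_mod_cast h
  refine le_trans (le_of_eq ?_) h1
  rw [ENat.toENNReal_coe, ← ENNReal.ofReal_natCast]
  push_cast
  rw [one_mul]

/-- Exponential growth in `d` rules out growth of the order `d^κ` with
`κ = t (1 + ln ε⁻¹)`. -/
theorem not_curseOfDimensionality {p : ℕ → Problem} (h : QuasiPolynomiallyTractable p) :
    ¬ CurseOfDimensionality p := by
  rintro ⟨ε, c, α, hε, hc, hα, hlow⟩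
  obtain ⟨C, t, hC, ht, hup⟩ := h
  set ε' := min ε (1 / 2) with hε'
  have hε0 : 0 < ε' := lt_min hε (by norm_num)
  have hε1 : ε' < 1 := (min_le_right _ _).trans_lt (by norm_num)
  set K : ℝ := t * (1 + Real.log ε'⁻¹) with hK
  have hlog : 0 ≤ Real.log ε'⁻¹ := Real.log_nonneg ((one_le_inv₀ hε0).2 hε1.le)
  have hK0 : 0 ≤ K := by positivity
  set k := ⌈K⌉₊ with hk
  have hbound : ∀ d : ℕ, 1 ≤ d → c / (C * Real.exp K) ≤ (d : ℝ) ^ k / α ^ d := by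
    intro d hd
    have hd1 : (1 : ℝ) ≤ d := by exact_mod_cast hd
    have hd0 : 0 < (d : ℝ) := by linarith
    have h1 : ((p d).comp ε : ℝ≥0∞) ≤ ((p d).comp ε' : ℝ≥0∞) := by
      exact_mod_cast comp_antitone (p d) (min_le_left _ _)
    have h2 := ((hlow d hd).trans h1).trans (hup ε' hε0 hε1 d hd)
    rw [ENNReal.ofReal_le_ofReal_iff (by positivity), ← hK] at h2
    have h3 : Real.exp (K * (1 + Real.log d)) ≤ Real.exp K * (d : ℝ) ^ k := by
      rw [mul_add, mul_one, Real.exp_add]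
      gcongr
      rw [← Real.exp_log (pow_pos hd0 k), Real.log_pow]
      gcongr
      exact Nat.le_ceil K
    rw [div_le_div_iff₀ (by positivity) (by positivity)]
    calc c * α ^ d ≤ C * Real.exp (K * (1 + Real.log d)) := h2
      _ ≤ C * (Real.exp K * (d : ℝ) ^ k) := by gcongr
      _ = _ := by ring
  have hlim := tendsto_pow_const_div_const_pow_of_one_lt k hα
  have h0 : c / (C * Real.exp K) ≤ 0 :=
    ge_of_tendsto hlim (Filter.eventually_atTop.2 ⟨1, fun d hd => hbound d hd⟩)
  have : 0 < c / (C * Real.exp K) := by positivity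
  linarith

/-- For `M > r!` and every `k`, the complexity grows at least like `d^k` for suitable `ε`. -/
theorem not_polynomiallyTractable {r : ℕ} (hr : 1 ≤ r) {M : ℝ} (hM : (r ! : ℝ) < M) :
    ¬ PolynomiallyTractable (appProblem r M) := by
  rintro ⟨C, q, s, hC, hq, hs, hup⟩
  obtain ⟨c, hc0, hc1, hlow⟩ := choose_le_comp hr hM
  set k := ⌈q⌉₊ + 1 with hk
  set ε : ℝ := c ^ k / 2 with hε
  have hck : 0 < c ^ k := by positivity
  have hck1 : c ^ k ≤ 1 := pow_le_one₀ hc0.le hc1.le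
  have hε0 : 0 < ε := by positivity
  have hε1 : ε < 1 := by linarith
  set A : ℝ := C * ε ^ (-s) * (k : ℝ) ^ q with hA
  have hk0 : (0 : ℝ) < k := by positivity
  have hbound : ∀ n : ℕ, (n : ℝ) + 1 ≤ k ! * A := by
    intro n
    have h1 := natCast_le_of_le_comp (by positivity)
      (hlow (n + k) (by omega) k ε hε0.le (by linarith)) (hup ε hε0 hε1 (n + k) (by omega))
    have h2 := Nat.pow_le_choose (α := ℝ) k (n + k)
    rw [show n + k + 1 - k = n + 1 by omega] at h2
    have h3 : ((n + k : ℕ) : ℝ) ≤ k * (n + 1) := by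
      have : n + k ≤ k * (n + 1) := by nlinarith [Nat.zero_le (⌈q⌉₊ * n)]
      exact_mod_cast this
    have hn1 : (1 : ℝ) ≤ n + 1 := by linarith [n.cast_nonneg (α := ℝ)]
    have h4 : ((n + k : ℕ) : ℝ) ^ q ≤ (k : ℝ) ^ q * ((n : ℝ) + 1) ^ (k - 1) := by
      calc ((n + k : ℕ) : ℝ) ^ q ≤ (k * ((n : ℝ) + 1)) ^ q := by gcongr
        _ = (k : ℝ) ^ q * ((n : ℝ) + 1) ^ q := Real.mul_rpow hk0.le (by linarith)
        _ ≤ (k : ℝ) ^ q * ((n : ℝ) + 1) ^ (k - 1) := by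
          gcongr
          rw [← Real.rpow_natCast]
          refine Real.rpow_le_rpow_of_exponent_le hn1 ?_
          rw [hk, Nat.add_sub_cancel]
          exact Nat.le_ceil q
    have h5 : ((n : ℝ) + 1) ^ k ≤ k ! * A * ((n : ℝ) + 1) ^ (k - 1) := by
      rw [div_le_iff₀ (by positivity)] at h2
      push_cast at h2
      calc ((n : ℝ) + 1) ^ k ≤ ((n + k).choose k : ℝ) * k ! := h2
        _ ≤ (C * ε ^ (-s) * ((n + k : ℕ) : ℝ) ^ q) * k ! := by gcongr
        _ ≤ (C * ε ^ (-s) * ((k : ℝ) ^ q * ((n : ℝ) + 1) ^ (k - 1))) * k ! := by gcongr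
        _ = _ := by rw [hA]; ring
    have h6 : ((n : ℝ) + 1) ^ k = (n + 1) * ((n : ℝ) + 1) ^ (k - 1) := by
      rw [← pow_succ', Nat.sub_add_cancel (by omega)]
    rw [h6] at h5
    exact le_of_mul_le_mul_right h5 (by positivity)
  obtain ⟨n, hn⟩ := exists_nat_gt (k ! * A)
  linarith [hbound n]

theorem not_stronglyPolynomiallyTractable {r : ℕ} (hr : 1 ≤ r) {M : ℝ} (hM : 0 ≤ M)
    (h : ¬ (M = 0 ∧ r = 1)) : ¬ StronglyPolynomiallyTractable (appProblem r M) := by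
  rintro ⟨C, q, hC, hq, hup⟩
  obtain ⟨ε, hε0, hε1, hlow⟩ : ∃ ε : ℝ, 0 < ε ∧ ε < 1 ∧ ∀ n : ℕ, ∃ d, 1 ≤ d ∧
      ((n + 1 : ℕ) : ℕ∞) ≤ (appProblem r M d).comp ε := by
    rcases hM.eq_or_lt with hM | hM
    · have hr2 : 2 ≤ r := by
        have : r ≠ 1 := fun hr1 => h ⟨hM.symm, hr1⟩
        omega
      refine ⟨1 / 2, by norm_num, by norm_num, fun n => ⟨n + 1, by omega, ?_⟩⟩
      refine le_trans ?_ (lt_comp_of_two_le hr2 hM.le (d := n + 1) (by omega) (by norm_num)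
        (by norm_num))
      exact_mod_cast (by omega : n + 1 ≤ n + 1 + 1)
    · obtain ⟨ε, h0, h1, h2⟩ := lt_comp_of_two_pow_lt hr hM
      exact ⟨ε, h0, h1, fun n => ⟨2 ^ n + 1, Nat.le_add_left 1 _, h2 n _ (Nat.lt_succ_self _)⟩⟩
  obtain ⟨n, hn⟩ := exists_nat_gt (C * ε ^ (-q))
  obtain ⟨d, hd, h1⟩ := hlow n
  have h2 := natCast_le_of_le_comp (by positivity) h1 (hup ε hε0 hε1 d hd)
  push_cast at h2
  linarith

/-- For `M = 0` and `r = 1`, all functions of the class are constant. -/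
theorem eq_of_mem_tensorClass_one_zero {d : ℕ} {f : Cube d → ℝ} (hf : f ∈ tensorClass 1 0 d)
    (x y : Cube d) : f x = f y := by
  obtain ⟨g, hg, rfl⟩ := hf
  refine Finset.prod_congr rfl fun i _ => ?_
  have h := abs_sub_interpolate_le le_rfl (hg i) {()} (fun _ => y i) (by simp) (by simp) (x i)
  simp only [zero_div, zero_mul, Lagrange.interpolate_singleton, Polynomial.eval_C] at h
  exact sub_eq_zero.1 (abs_nonpos_iff.1 h)

theorem stronglyPolynomiallyTractable_one_zero :
    StronglyPolynomiallyTractable (appProblem 1 0) := by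
  refine ⟨1, 1, one_pos, one_pos, fun ε hε0 hε1 d hd => ?_⟩
  set L : List ℝ → tensorClass 1 0 d → ℝ := fun _ f => f.1 0 with hL
  have hLmem : ∀ y, L y ∈ standardInformation (tensorClass 1 0 d) := fun _ => ⟨0, rfl⟩
  have hN : IsInformationMapping (standardInformation (tensorClass 1 0 d))
      (fun f => collected L f 1) :=
    isInformationMapping_collected hLmem le_rfl
  obtain ⟨out, hout⟩ := exists_isRepresentation (A := app 1 0 d) hN (by
    intro f f' h
    have h0 : f.1 0 = f'.1 0 := by simpa [collected, hL] using h
    have : f = f' := Subtype.ext (funext fun x => by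
      rw [eq_of_mem_tensorClass_one_zero f.2 x 0, h0, eq_of_mem_tensorClass_one_zero f'.2 0 x])
    rw [this])
  have hcost : (appProblem 1 0 d).comp ε ≤ 1 := by
    refine (comp_le_of_err_le (p := appProblem 1 0 d) ⟨app 1 0 d, out, _, hout⟩ ?_).trans ?_
    · refine le_trans (iSup_le fun f => (edist_self _).le) bot_le
    · have h1 : worstCaseCost (standardInformation (tensorClass 1 0 d)) (app 1 0 d) ≤
          informationCost fun f => collected L f 1 := sInf_le ⟨out, _, hout, rfl⟩
      refine h1.trans (iSup_le fun f => ?_)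
      simp [length_collected]
  have h2 : ((appProblem 1 0 d).comp ε : ℝ≥0∞) ≤ ((1 : ℕ∞) : ℝ≥0∞) := by exact_mod_cast hcost
  refine h2.trans ?_
  rw [one_mul, ENat.toENNReal_one, ENNReal.one_le_ofReal]
  exact Real.one_le_rpow_of_pos_of_le_one_of_nonpos hε0 hε1.le (by norm_num)

end RankOne

end

theorem mainTheorem9 (r : ℕ) (hr : 1 ≤ r) (M : ℝ) (hM : 0 ≤ M) :
    (RankOne.CurseOfDimensionality (RankOne.appProblem r M) ↔ 2 ^ r * (r ! : ℝ) ≤ M) ∧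
    (RankOne.QuasiPolynomiallyTractable (RankOne.appProblem r M) ↔ M < 2 ^ r * (r ! : ℝ)) ∧
    (RankOne.PolynomiallyTractable (RankOne.appProblem r M) ↔ M ≤ (r ! : ℝ)) ∧
    (RankOne.StronglyPolynomiallyTractable (RankOne.appProblem r M) ↔ M = 0 ∧ r = 1) ∧
    (0 < M → ∃ C : ℝ, 0 < C ∧ ∃ c₁ c₂ c₃ c₄ : ℝ, 0 < c₁ ∧ 0 < c₂ ∧ 0 < c₃ ∧ 0 < c₄ ∧
      -- one point set for which all the bounds that apply to `M` hold
      (∀ d : ℕ, 1 ≤ d → ∀ ε : ℝ, 0 < ε → ε < 1 →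
        ∃ P : Finset (RankOne.Cube d), ∃ m : ℕ, m = RankOne.sampleBudget r C d ε ∧
          RankOne.DetectorAlgorithmBound r M d ε P m (RankOne.exponentialBound r c₁ d ε) ∧
          (M < 2 ^ r * (r ! : ℝ) →
            RankOne.DetectorAlgorithmBound r M d ε P m
              (RankOne.quasiPolynomialBound c₂ c₃ d ε)) ∧
          (M ≤ (r ! : ℝ) →
            RankOne.DetectorAlgorithmBound r M d ε P m (RankOne.polynomialBound r c₄ d ε))) ∧
      -- the detector is a set of low dispersion
      (∀ d : ℕ, 1 ≤ d → ∀ ε : ℝ, 0 < ε → ε < 1 →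
        ∃ P : Finset (RankOne.Cube d),
          RankOne.dispersion P ≤
            ENNReal.ofReal ((RankOne.rho r M ^ d)⁻¹ * ε ^ (1 / (r : ℝ))) ∧
          RankOne.DetectorAlgorithmBound r M d ε P (RankOne.sampleBudget r C d ε)
            (RankOne.exponentialBound r c₁ d ε)) ∧
      -- the detector is built from a set of low dispersion in few coordinates and a diagonal set
      (M < 2 ^ r * (r ! : ℝ) →
        ∃ δ : ℝ, 0 < δ ∧ δ ≤ 1 / 2 ∧ RankOne.cDelta r M δ < 1 ∧
          ∀ d : ℕ, 1 ≤ d → ∀ ε : ℝ, 0 < ε → ε < 1 →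
            ∃ (P₁ : Finset (RankOne.Cube (RankOne.pseudoDim r M δ ε d)))
              (P : Finset (RankOne.Cube d)),
              RankOne.dispersion P₁ ≤ ENNReal.ofReal
                ((RankOne.rho r M ^ RankOne.pseudoDim r M δ ε d)⁻¹ * ε ^ (1 / (r : ℝ))) ∧
              (P : Set (RankOne.Cube d)) =
                RankOne.crossDiagonalSet r d (RankOne.pseudoDim r M δ ε d) δ P₁ ∧
              RankOne.DetectorAlgorithmBound r M d ε P (RankOne.sampleBudget r C d ε)
                (RankOne.quasiPolynomialBound c₂ c₃ d ε)) ∧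
      -- the detector is the sum of a scaled set of low dispersion and a diagonal set
      (M ≤ (r ! : ℝ) →
        ∀ d : ℕ, 1 ≤ d → ∀ ε : ℝ, 0 < ε → ε < 1 →
          ∃ P₀ P : Finset (RankOne.Cube d),
            RankOne.dispersion P₀ ≤ ENNReal.ofReal (ε ^ (1 / (r : ℝ)) / 2) ∧
            (P : Set (RankOne.Cube d)) =
              RankOne.shiftedDiagonalSet r d (RankOne.gam r d ε) P₀ ∧
            RankOne.DetectorAlgorithmBound r M d ε P (RankOne.sampleBudget r C d ε)
              (RankOne.polynomialBound r c₄ d ε))) := by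
  have hcurse : 2 ^ r * (r ! : ℝ) ≤ M → RankOne.CurseOfDimensionality (RankOne.appProblem r M) :=
    fun h => RankOne.curseOfDimensionality hr h
  have hqpt : M < 2 ^ r * (r ! : ℝ) →
      RankOne.QuasiPolynomiallyTractable (RankOne.appProblem r M) :=
    RankOne.quasiPolynomiallyTractable hr hM
  refine ⟨⟨fun h => ?_, hcurse⟩, ⟨fun h => ?_, hqpt⟩,
    ⟨fun h => ?_, RankOne.polynomiallyTractable hr hM⟩, ⟨fun h => ?_, ?_⟩, fun hM0 => ?_⟩
  · by_contra hcon
    exact RankOne.not_curseOfDimensionality (hqpt (not_le.1 hcon)) h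
  · by_contra hcon
    exact RankOne.not_curseOfDimensionality h (hcurse (not_lt.1 hcon))
  · by_contra hcon
    exact RankOne.not_polynomiallyTractable hr (not_le.1 hcon) h
  · by_contra hcon
    exact RankOne.not_stronglyPolynomiallyTractable hr hM hcon h
  · rintro ⟨rfl, rfl⟩
    exact RankOne.stronglyPolynomiallyTractable_one_zero
  · set C : ℝ := 2 * r * (2 * M + 1) with hC
    have hC0 : 0 < C := by
      have : (0 : ℝ) < r := by exact_mod_cast hr
      positivity
    obtain ⟨c₁, hc₁, h₁⟩ := RankOne.exists_exponentialBound hr M hC0.le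
    obtain ⟨c₄, hc₄, h₄⟩ := RankOne.exists_polynomialBound hr hC0.le
    -- the parameter `δ` and the constants `c₂`, `c₃` matter only for `M < 2 ^ r * r !`
    obtain ⟨δ, c₂, c₃, hc₂, hc₃, h₂⟩ : ∃ δ c₂ c₃ : ℝ, 0 < c₂ ∧ 0 < c₃ ∧
        (M < 2 ^ r * (r ! : ℝ) → 0 < δ ∧ δ ≤ 1 / 2 ∧ RankOne.cDelta r M δ < 1 ∧
          ∀ d : ℕ, 1 ≤ d → ∀ ε : ℝ, 0 < ε → ε < 1 →
            ∃ (P₁ : Finset (RankOne.Cube (RankOne.pseudoDim r M δ ε d)))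
              (P : Finset (RankOne.Cube d)),
              RankOne.dispersion P₁ ≤ ENNReal.ofReal
                ((RankOne.rho r M ^ RankOne.pseudoDim r M δ ε d)⁻¹ * ε ^ (1 / (r : ℝ))) ∧
              (P : Set (RankOne.Cube d)) =
                RankOne.crossDiagonalSet r d (RankOne.pseudoDim r M δ ε d) δ P₁ ∧
              (P.card : ℝ) + RankOne.sampleBudget r C d ε + 1 ≤
                RankOne.quasiPolynomialBound c₂ c₃ d ε) := by
      by_cases hM' : M < 2 ^ r * (r ! : ℝ)
      · obtain ⟨δ, hδ, hδ', hδ1⟩ := RankOne.exists_cDelta_lt_one hM'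
        obtain ⟨c₂, c₃, hc₂, hc₃, h⟩ := RankOne.exists_quasiPolynomialBound hr hM0 hC0.le hδ hδ1
        exact ⟨δ, c₂, c₃, hc₂, hc₃, fun _ => ⟨hδ, hδ', hδ1, h⟩⟩
      · exact ⟨1, 1, 1, one_pos, one_pos, fun h => absurd h hM'⟩
    refine ⟨C, hC0, c₁, c₂, c₃, c₄, hc₁, hc₂, hc₃, hc₄, fun d hd ε h0 h1 => ?_,
      fun d hd ε h0 h1 => ?_, fun hM' => ?_, fun hM' d hd ε h0 h1 => ?_⟩
    · obtain ⟨P₁, hP₁, hb₁⟩ := h₁ d hd ε h0 h1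
      have hdet₁ := RankOne.isDetector_of_dispersion_le hr hM h0 hP₁
      -- a detector of minimal cardinality satisfies all applicable bounds simultaneously
      obtain ⟨P, hP, hmin⟩ := RankOne.exists_isDetector_card_minimal ⟨P₁, hdet₁⟩
      have key : ∀ Q : Finset (RankOne.Cube d), RankOne.IsDetector r M d ε Q → ∀ b : ℝ,
          (Q.card : ℝ) + RankOne.sampleBudget r C d ε + 1 ≤ b →
          RankOne.DetectorAlgorithmBound r M d ε P (RankOne.sampleBudget r C d ε) b := by
        intro Q hQ b hb
        have hcard : (P.card : ℝ) ≤ Q.card := by exact_mod_cast hmin Q hQ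
        exact RankOne.detectorAlgorithmBound_of_isDetector hr hM le_rfl hd h0 h1 hP
          (le_trans (by gcongr) hb)
      refine ⟨P, _, rfl, key P₁ hdet₁ _ hb₁, fun hM' => ?_, fun hM' => ?_⟩
      · obtain ⟨hδ, hδ', -, h⟩ := h₂ hM'
        obtain ⟨P₁, Q, hP₁, hQ, hb⟩ := h d hd ε h0 h1
        exact key Q (RankOne.isDetector_of_crossDiagonalSet hr hM hδ hδ' h0 hP₁ hQ) _ hb
      · obtain ⟨P₀, Q, hP₀, hQ, hb⟩ := h₄ d hd ε h0 h1
        exact key Q (RankOne.isDetector_of_shiftedDiagonalSet hr hM hM' hd h0 h1 hP₀ hQ) _ hb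
    · obtain ⟨P, hP, hb⟩ := h₁ d hd ε h0 h1
      exact ⟨P, hP, RankOne.detectorAlgorithmBound_of_isDetector hr hM le_rfl hd h0 h1
        (RankOne.isDetector_of_dispersion_le hr hM h0 hP) hb⟩
    · obtain ⟨hδ, hδ', hδ1, h⟩ := h₂ hM'
      refine ⟨δ, hδ, hδ', hδ1, fun d hd ε h0 h1 => ?_⟩
      obtain ⟨P₁, P, hP₁, hP, hb⟩ := h d hd ε h0 h1
      exact ⟨P₁, P, hP₁, hP, RankOne.detectorAlgorithmBound_of_isDetector hr hM le_rfl hd h0 h1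
        (RankOne.isDetector_of_crossDiagonalSet hr hM hδ hδ' h0 hP₁ hP) hb⟩
    · obtain ⟨P₀, P, hP₀, hP, hb⟩ := h₄ d hd ε h0 h1
      exact ⟨P₀, P, hP₀, hP, RankOne.detectorAlgorithmBound_of_isDetector hr hM le_rfl hd h0 h1
        (RankOne.isDetector_of_shiftedDiagonalSet hr hM hM' hd h0 h1 hP₀ hP) hb⟩
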